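/- Graphs are finite and undirected, and may have self-loops and multiple edges; a self-loop counts twice in the degree of its vertex. For a graph $G$ with at least one edge and with all degrees even, a transition system $P$ is a choice, at every vertex, of a perfect matching of the half-edges at that vertex; following it, the edges of $G$ are partitioned into $c(P)\ge 1$ circuits. The Martin polynomial is $\mathfrak m(G,x)=\sum_P (x-2)^{c(P)-1}\in\mathbb Z[x]$, and the Martin invariant of a $2k$-regular graph $G$ ($k\ge 2$, $G$ non-empty) is $$\mathsf M(G)=\frac{4\,(-1)^k}{(k-2)!\,(2k)!}\;\mathfrak m'(G,4-2k)\in\mathbb Q .$$ $G^{[r]}$ denotes the graph obtained from $G$ by replacing each edge by $r$ parallel edges, and $G\setminus v$ the graph obtained by removing the vertex $v$ and all edges at $v$. A graph is a planar dual of a graph $G'$ if it is isomorphic to the dual graph of a plane embedding of $G'$; here $G'$ is taken to be non-empty and connected. Theorem. (1) Let $G_1,G_2$ be 4-regular graphs with vertices $v_1,v_2$ such that $G_1\setminus v_1$ is a planar dual of $G_2\setminus v_2$. Then $\mathsf M(G_1)=\mathsf M(G_2)$. (2) If in (1) moreover $v_1$ and $v_2$ have no self-loops, then the Martin sequences of $G_1$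 and $G_2$ agree: $\mathsf M(G_1^{[r]})=\mathsf M(G_2^{[r]})$ for every integer $r\ge 1$. (3) Let $G_3$ be a 3-regular graph and $G_6$ a 6-regular graph with vertices $v$ of $G_3$ and $w$ of $G_6$, both without self-loops, such that $G_3\setminus v$ is a planar dual of $G_6\setminus w$. Let $n$ be the number of vertices of $G_6$. Then for every integer $r\ge 1$, $$\mathsf M\bigl(G_3^{[2r]}\bigr)=\left(\frac{(2r)!}{r!}\right)^{3(n-2)}\mathsf M\bigl(G_6^{[r]}\bigr).$$ -/

import Mathlib

/-- An undirected graph, with self-loops and multiple edges allowed, with vertex set `V` and set of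
half-edges `H`. The half-edge `h` is incident with the vertex `vert h`, and its other half is `opp h`;
the edges are the pairs `{h, opp h}`. -/
structure HGraph (V H : Type*) where
  vert : H → V
  opp : H → H
  opp_opp : ∀ h, opp (opp h) = h
  opp_ne : ∀ h, opp h ≠ h

namespace HGraph

variable {V H V' H' : Type*}

/-- The matching of half-edges into edges, as a permutation of the half-edges. -/
def oppPerm (G : HGraph V H) : Equiv.Perm H where
  toFun := G.opp
  invFun := G.opp
  left_inv := G.opp_opp
  right_inv := G.opp_opp

/-- Every vertex has degree `d` (a self-loop contributes `2` to the degree). -/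
def IsRegular (G : HGraph V H) (d : ℕ) : Prop :=
  ∀ v, Nat.card {h // G.vert h = v} = d

/-- There is no self-loop at the vertex `v`. -/
def NoSelfLoopAt (G : HGraph V H) (v : V) : Prop :=
  ∀ h, G.vert h = v → G.vert (G.opp h) ≠ v

/-- `G ∖ v`: remove the vertex `v` together with all edges incident with it. -/
def deleteVertex (G : HGraph V H) (v : V) :
    HGraph {w // w ≠ v} {h // G.vert h ≠ v ∧ G.vert (G.opp h) ≠ v} where
  vert h := ⟨G.vert h.1, h.2.1⟩
  opp h := ⟨G.opp h.1, h.2.2, by rw [G.opp_opp]; exact h.2.1⟩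
  opp_opp h := Subtype.ext (G.opp_opp h.1)
  opp_ne h hh := G.opp_ne h.1 (congrArg Subtype.val hh)

/-- `G^[r]`: replace every edge by a bundle of `r` parallel edges. -/
def duplicate (G : HGraph V H) (r : ℕ) : HGraph V (H × Fin r) where
  vert h := G.vert h.1
  opp h := (G.opp h.1, h.2)
  opp_opp h := Prod.ext (G.opp_opp h.1) rfl
  opp_ne h hh := G.opp_ne h.1 (congrArg Prod.fst hh)

/-- The graph is non-empty and connected. -/
def IsConnected (G : HGraph V H) : Prop :=
  Nonempty V ∧ ∀ u w, Relation.ReflTransGen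
    (fun a b => ∃ h, G.vert h = a ∧ G.vert (G.opp h) = b) u w

/-- Isomorphism of graphs. -/
structure Iso (G : HGraph V H) (G' : HGraph V' H') where
  onVert : V ≃ V'
  onHalf : H ≃ H'
  vert_eq : ∀ h, G'.vert (onHalf h) = onVert (G.vert h)
  opp_eq : ∀ h, G'.opp (onHalf h) = onHalf (G.opp h)

/-! ### The Martin polynomial and the Martin invariant -/

/-- A transition system: at every vertex, a perfect matching of the half-edges at that vertex. All
these matchings together form a fixed-point free involution of the half-edges. -/
def IsTransitionSystem (G : HGraph V H) (P : H → H) : Prop :=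
  ∀ h, P (P h) = h ∧ P h ≠ h ∧ G.vert (P h) = G.vert h

/-- The number of circuits determined by a transition system `P`: the number of classes of half-edges
when each half-edge is identified with its partner under `P` and with its opposite half. -/
noncomputable def circuitCount (G : HGraph V H) (P : H → H) : ℕ :=
  Nat.card (Quot fun h h' => h' = P h ∨ h' = G.opp h)

open Classical in
/-- The Martin polynomial `∑_P (x - 2)^(c(P) - 1)` of a graph with at least one edge and with all
degrees even. -/
noncomputable def martinPolynomial [Fintype H] (G : HGraph V H) : Polynomial ℤ :=
  ∑ P : {P : H → H // G.IsTransitionSystem P},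
    (Polynomial.X - 2) ^ (G.circuitCount P.1 - 1)

/-- The Martin invariant of a `2k`-regular graph, `k ≥ 2`:
`4 (-1)^k / ((k-2)! (2k)!)` times the derivative of the Martin polynomial at `4 - 2k`. -/
noncomputable def martinInvariant [Fintype H] (k : ℕ) (G : HGraph V H) : ℚ :=
  4 * (-1) ^ k / ((Nat.factorial (k - 2) : ℚ) * (Nat.factorial (2 * k) : ℚ)) *
    ((G.martinPolynomial.derivative.eval (4 - 2 * (k : ℤ)) : ℤ) : ℚ)

/-! ### Plane embeddings and planar duals -/

/-- The permutation of the half-edges that walks along the boundaries of the faces of the rotation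
system `σ`: cross the edge to its other end, then turn to the next half-edge there. -/
def facePerm (G : HGraph V H) (σ : Equiv.Perm H) : Equiv.Perm H :=
  σ * G.oppPerm

/-- The faces of a rotation system on a connected graph: the cycles of `facePerm`, except that a
graph without edges (a single vertex) has exactly one face. -/
def Face (G : HGraph V H) (σ : Equiv.Perm H) : Type _ :=
  Quotient (Equiv.Perm.SameCycle.setoid (G.facePerm σ)) ⊕ PLift (IsEmpty H)

/-- A plane embedding of a connected graph, up to homeomorphism of the sphere: a cyclic order of the
half-edges around each vertex (the cycles of `rot`), such that the resulting surface is a sphere, that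
is, Euler's formula `|V| - |E| + |F| = 2` holds. -/
structure PlaneEmbedding (G : HGraph V H) where
  connected : G.IsConnected
  rot : Equiv.Perm H
  rot_cycle : ∀ h h', rot.SameCycle h h' ↔ G.vert h = G.vert h'
  euler : Nat.card V + Nat.card (G.Face rot) = Nat.card H / 2 + 2

/-- The dual graph of a plane embedding: its vertices are the faces, and every edge becomes an edge
between the faces on its two sides. -/
def PlaneEmbedding.dual {G : HGraph V H} (e : G.PlaneEmbedding) : HGraph (G.Face e.rot) H where
  vert h := Sum.inl (Quotient.mk _ h)
  opp := G.opp
  opp_opp := G.opp_opp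
  opp_ne := G.opp_ne

/-- `G` is a planar dual of `G'`: it is isomorphic to the dual graph of a plane embedding of `G'`. -/
def IsPlanarDual (G : HGraph V H) (G' : HGraph V' H') : Prop :=
  ∃ e : G'.PlaneEmbedding, Nonempty (Iso G e.dual)

end HGraph

/-! For a `2k`-regular graph the Martin invariant is, up to a constant depending only on `k`, the
number of ways to distribute the edges of `G ∖ v` over `k` spanning trees of `G ∖ v`; planar duality
exchanges spanning trees with complements of spanning trees.

Put `J(G, x) = ∑_P x^c(P)`. The invariant is a multiple of `J'(2 - 2k)` (`martinInvariant_eq`). A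
vertex without self-loops can be removed by joining its half-edges in all possible ways
(`circuitPolynomial_splitVertex`), and deleting a self-loop at a vertex of degree `d` costs the
factor `x + d - 2` (`circuitPolynomial_loop'`). So every vertex of degree `2k` gives the root `2 -
2k`, and a self-loop makes this root double.

The tree count is a coefficient of `S^(2k) Ψ^k`, where `S` is the total edge weight at `v` and `Ψ`
is the Kirchhoff determinant of `G ∖ v`. It vanishes if there is a self-loop, and it obeys the same
splitting recursion (`kirchhoffNumber_splitVertex`): by Wick's rule, summing over all splittings of
`w` replaces the star of `w` by a complete graph on its neighbours with product weights, and a Schur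
complement (`coeff_det_star`, the star-mesh transformation) shows that the coefficient of degree
`2k` in the neighbouring half-edges is the same for both. As both quantities are known for two
vertices joined by `2k` edges, they are proportional (`eval_derivative_circuitPolynomial`).

For `r` parallel copies of every edge, the count is `r!^|E|` times the coefficient of `∏ x_e^r` in
`Ψ^k` (`kirchhoffNumber_cover`). For plane duals `Ψ₁(x) = ∏ x_e · Ψ₂(1/x)`, so the coefficients of
`∏ x_e^r₁` in `Ψ₁^k` and of `∏ x_e^r₂` in `Ψ₂^k` agree when `r₁ + r₂ = k`
(`coeff_kirchhoffPolynomial_pow_dual`). The three claims are the cases `(1, 1)`, `(r, r)` and `(2r,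
r)` of `martinInvariant_of_isPlanarDual`; in (1), self-loops at the removed vertices are excluded by
Euler's formula. -/

section

/-! ### Joint orbits of two involutions -/

/-- A perfect matching of the elements of a type, as a fixed-point free involution. -/
def IsMatching {X : Type*} (μ : X → X) : Prop := ∀ h, μ (μ h) = h ∧ μ h ≠ h

/-- Contracting a subset that is stable under the involution `α` and is moved off itself by the
involution `β` does not change the number of joint orbits. -/
theorem card_orbits_contract {H : Type*} (p : H → Prop) (α β : H → H)
    (hα : ∀ h, α (α h) = h) (hβ : ∀ h, β (β h) = h) (hpα : ∀ h, p h → p (α h))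
    (hpβ : ∀ h, ¬ p h → p (β h)) (α' β' : {h // p h} → {h // p h})
    (hα' : ∀ h, (α' h).1 = α h.1) (h₁ : ∀ h, p (β h.1) → (β' h).1 = β h.1)
    (h₂ : ∀ h, ¬ p (β h.1) → (β' h).1 = β (α (β h.1))) :
    Nat.card (Quot fun h h' => h' = α h ∨ h' = β h) =
      Nat.card (Quot fun h h' => h' = α' h ∨ h' = β' h) := by
  classical
  have hnα : ∀ h, ¬ p h → ¬ p (α h) := fun h hh hh' => hh (by simpa [hα] using hpα _ hh')
  -- Every orbit meets `p`, because an element off `p` is moved into `p` by `β`; orbits therefore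
  -- correspond to their traces on `p`.
  refine Nat.card_congr
    { toFun := Quot.lift
        (fun h => Quot.mk _ (if hh : p h then ⟨h, hh⟩ else ⟨β h, hpβ h hh⟩)) ?_
      invFun := Quot.lift (fun h => Quot.mk _ h.1) ?_
      left_inv := ?_
      right_inv := ?_ }
  · rintro h h' (rfl | rfl)
    · by_cases hh : p h
      · rw [dif_pos hh, dif_pos (hpα h hh)]
        exact Quot.sound (Or.inl (Subtype.ext (hα' ⟨h, hh⟩).symm))
      · rw [dif_neg hh, dif_neg (hnα h hh)]
        refine Quot.sound (Or.inr (Subtype.ext ?_))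
        rw [h₂ _ (by simpa [hβ] using hh)]
        simp [hβ]
    · by_cases hh : p h
      · by_cases hb : p (β h)
        · rw [dif_pos hh, dif_pos hb]
          exact Quot.sound (Or.inr (Subtype.ext (h₁ ⟨h, hh⟩ hb).symm))
        · rw [dif_pos hh, dif_neg hb]
          exact congrArg _ (Subtype.ext (hβ h).symm)
      · rw [dif_neg hh, dif_pos (hpβ h hh)]
  · rintro h h' (rfl | rfl)
    · exact Quot.sound (Or.inl (hα' _))
    · by_cases hb : p (β h.1)
      · exact Quot.sound (Or.inr (h₁ _ hb))
      · rw [h₂ _ hb]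
        have e1 : Quot.mk (fun h h' => h' = α h ∨ h' = β h) h.1 = Quot.mk _ (β h.1) :=
          Quot.sound (Or.inr rfl)
        have e2 : Quot.mk (fun h h' => h' = α h ∨ h' = β h) (β h.1) = Quot.mk _ (α (β h.1)) :=
          Quot.sound (Or.inl rfl)
        have e3 : Quot.mk (fun h h' => h' = α h ∨ h' = β h) (α (β h.1)) =
            Quot.mk _ (β (α (β h.1))) := Quot.sound (Or.inr rfl)
        exact e1.trans (e2.trans e3)
  · rintro ⟨h⟩
    by_cases hh : p h
    · simp [hh]
    · simp only [hh, dite_false]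
      exact (Quot.sound (r := fun h h' => h' = α h ∨ h' = β h) (Or.inr rfl)).symm
  · rintro ⟨h⟩
    simp [h.2]

/-- Removing a joint orbit `{e, α e}` on which the two involutions agree. -/
theorem card_orbits_remove {H : Type*} [Finite H] (e e' : H) (α β : H → H)
    (hα : ∀ h, α (α h) = h) (hβ : ∀ h, β (β h) = h) (hαe : α e = e') (hβe : β e = e')
    (α' β' : {h // h ≠ e ∧ h ≠ e'} → {h // h ≠ e ∧ h ≠ e'})
    (hα' : ∀ h, (α' h).1 = α h.1) (hβ' : ∀ h, (β' h).1 = β h.1) :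
    Nat.card (Quot fun h h' => h' = α h ∨ h' = β h) =
      Nat.card (Quot fun h h' => h' = α' h ∨ h' = β' h) + 1 := by
  classical
  have hαe' : α e' = e := by rw [← hαe, hα]
  have hβe' : β e' = e := by rw [← hβe, hβ]
  have kα : ∀ h, (h ≠ e ∧ h ≠ e') → (α h ≠ e ∧ α h ≠ e') := fun h hh =>
    ⟨fun h1 => hh.2 (by rw [← hα h, h1, hαe]), fun h1 => hh.1 (by rw [← hα h, h1, hαe'])⟩
  have kβ : ∀ h, (h ≠ e ∧ h ≠ e') → (β h ≠ e ∧ β h ≠ e') := fun h hh =>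
    ⟨fun h1 => hh.2 (by rw [← hβ h, h1, hβe]), fun h1 => hh.1 (by rw [← hβ h, h1, hβe'])⟩
  have key : ∀ h, ¬ (h ≠ e ∧ h ≠ e') → h = e ∨ h = e' := by intro h; tauto
  rw [← Finite.card_option]
  refine Nat.card_congr
    { toFun := Quot.lift
        (fun h => if hh : h ≠ e ∧ h ≠ e' then some (Quot.mk _ ⟨h, hh⟩) else none) ?_
      invFun := fun o => o.elim (Quot.mk _ e) (Quot.lift (fun h => Quot.mk _ h.1) ?_)
      left_inv := ?_
      right_inv := ?_ }
  · have aux : ∀ h, ¬ (h ≠ e ∧ h ≠ e') →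
        ¬ (α h ≠ e ∧ α h ≠ e') ∧ ¬ (β h ≠ e ∧ β h ≠ e') := by
      intro h hh
      rcases key h hh with rfl | rfl
      · rw [hαe, hβe]; simp
      · rw [hαe', hβe']; simp
    rintro h h' (rfl | rfl)
    · by_cases hh : h ≠ e ∧ h ≠ e'
      · rw [dif_pos hh, dif_pos (kα h hh)]
        exact congrArg some (Quot.sound (Or.inl (Subtype.ext (hα' ⟨h, hh⟩).symm)))
      · rw [dif_neg hh, dif_neg (aux h hh).1]
    · by_cases hh : h ≠ e ∧ h ≠ e'
      · rw [dif_pos hh, dif_pos (kβ h hh)]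
        exact congrArg some (Quot.sound (Or.inr (Subtype.ext (hβ' ⟨h, hh⟩).symm)))
      · rw [dif_neg hh, dif_neg (aux h hh).2]
  · rintro h h' (rfl | rfl)
    · exact Quot.sound (Or.inl (hα' _))
    · exact Quot.sound (Or.inr (hβ' _))
  · rintro ⟨h⟩
    by_cases hh : h ≠ e ∧ h ≠ e'
    · simp [hh]
    · simp only [hh, dite_false, Option.elim]
      rcases key h hh with rfl | rfl
      · rfl
      · exact Quot.sound (Or.inl hαe.symm)
  · rintro (_ | h)
    · simp
    · obtain ⟨h⟩ := h
      simp [h.2]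

/-! ### The circuit polynomial and the splitting of a vertex -/

namespace HGraph

open Polynomial

variable {V H : Type*}

/-- The generating polynomial `∑_P X^(c(P))` of the transition systems by number of circuits. -/
noncomputable def circuitPolynomial [Finite H] (G : HGraph V H) : ℤ[X] :=
  letI := Fintype.ofFinite {P : H → H // G.IsTransitionSystem P}
  ∑ P : {P : H → H // G.IsTransitionSystem P}, X ^ G.circuitCount P.1

theorem circuitPolynomial_eq_sum [Finite H] (G : HGraph V H)
    [Fintype {P : H → H // G.IsTransitionSystem P}] :
    G.circuitPolynomial =
      ∑ P : {P : H → H // G.IsTransitionSystem P}, X ^ G.circuitCount P.1 := by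
  unfold circuitPolynomial
  congr!

/-- Removing the vertex `w`, which has no self-loop, after joining the half-edges at `w` in pairs
according to `τ`. The vertex stays behind as an isolated one. -/
def splitVertex (G : HGraph V H) [DecidableEq V] (w : V) (hw : G.NoSelfLoopAt w)
    (τ : {h // G.vert h = w} → {h // G.vert h = w}) (hτ : IsMatching τ) :
    HGraph V {h // G.vert h ≠ w} where
  vert h := G.vert h.1
  opp h := if hh : G.vert (G.opp h.1) = w then
      ⟨G.opp (τ ⟨G.opp h.1, hh⟩).1, hw _ (τ ⟨G.opp h.1, hh⟩).2⟩ else ⟨G.opp h.1, hh⟩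
  opp_opp h := by
    by_cases hh : G.vert (G.opp h.1) = w
    · simp only [hh, dite_true]
      apply Subtype.ext
      simp [G.opp_opp, (τ ⟨G.opp h.1, hh⟩).2, (hτ _).1]
    · simp only [hh, dite_false]
      apply Subtype.ext
      simp [G.opp_opp, h.2]
  opp_ne h := by
    by_cases hh : G.vert (G.opp h.1) = w
    · simp only [hh, dite_true]
      intro h1
      have h2 := congrArg (fun x => G.opp x.1) h1
      simp only [G.opp_opp] at h2
      exact (hτ ⟨G.opp h.1, hh⟩).2 (Subtype.ext h2)
    · simp only [hh, dite_false]
      exact fun h1 => G.opp_ne h.1 (congrArg Subtype.val h1)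

/-- Removing an edge. -/
def deleteEdge (G : HGraph V H) (e : H) : HGraph V {h // h ≠ e ∧ h ≠ G.opp e} where
  vert h := G.vert h.1
  opp h := ⟨G.opp h.1, fun h1 => h.2.2 ((G.opp_opp h.1).symm.trans (congrArg G.opp h1)),
    fun h1 => h.2.1 (by rw [← G.opp_opp h.1, h1, G.opp_opp])⟩
  opp_opp h := Subtype.ext (G.opp_opp h.1)
  opp_ne h hh := G.opp_ne h.1 (congrArg Subtype.val hh)


/-- A transition system consists of a matching at the vertex `w` and matchings at the others. -/
def glueTransitions (G : HGraph V H) [DecidableEq V] (w : V)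
    (τ : {h // G.vert h = w} → {h // G.vert h = w})
    (P : {h // G.vert h ≠ w} → {h // G.vert h ≠ w}) (h : H) : H :=
  if hh : G.vert h = w then (τ ⟨h, hh⟩).1 else (P ⟨h, hh⟩).1

/-- A transition system is a matching at `w` together with matchings at the other vertices.
Contracting the half-edges at `w`, all of which `opp` moves away from `w` for want of self-loops,
keeps the number of circuits. -/
theorem circuitPolynomial_splitVertex [Finite H] [DecidableEq V] (G : HGraph V H) (w : V)
    (hw : G.NoSelfLoopAt w)
    [Fintype {τ : {h // G.vert h = w} → {h // G.vert h = w} // IsMatching τ}] :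
    G.circuitPolynomial =
      ∑ τ : {τ : {h // G.vert h = w} → {h // G.vert h = w} // IsMatching τ},
        (G.splitVertex w hw τ.1 τ.2).circuitPolynomial := by
  -- The transitions away from `w` do not depend on `τ`, since splitting changes only `opp`; the
  -- double sum is thus a sum over a product.
  let T := {P : {h // G.vert h ≠ w} → {h // G.vert h ≠ w} //
    ∀ h, P (P h) = h ∧ P h ≠ h ∧ G.vert (P h).1 = G.vert h.1}
  let _ : Fintype T := Fintype.ofFinite _
  let _ := Fintype.ofFinite {P : H → H // G.IsTransitionSystem P}
  have e : ∀ τ : {τ : {h // G.vert h = w} → {h // G.vert h = w} // IsMatching τ},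
      (G.splitVertex w hw τ.1 τ.2).circuitPolynomial =
        ∑ P : T, (X : ℤ[X]) ^ (G.splitVertex w hw τ.1 τ.2).circuitCount P.1 := by
    intro τ
    let _ := Fintype.ofFinite {P // (G.splitVertex w hw τ.1 τ.2).IsTransitionSystem P}
    rw [circuitPolynomial_eq_sum]
    exact Fintype.sum_equiv (Equiv.subtypeEquivRight fun _ => Iff.rfl) _ _ fun _ => rfl
  rw [Fintype.sum_congr _ _ e, ← Fintype.sum_prod_type', circuitPolynomial_eq_sum]
  symm
  have vτ : ∀ τ : {h // G.vert h = w} → {h // G.vert h = w}, ∀ h, G.vert (τ h).1 = w :=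
    fun τ h => (τ h).2
  have vP : ∀ P : {h // G.vert h ≠ w} → {h // G.vert h ≠ w}, ∀ h, G.vert (P h).1 ≠ w :=
    fun P h => (P h).2
  have hg : ∀ x : {τ : {h // G.vert h = w} → {h // G.vert h = w} // IsMatching τ} × T,
      G.IsTransitionSystem (G.glueTransitions w x.1.1 x.2.1) := by
    intro x h
    by_cases hh : G.vert h = w
    · simp only [glueTransitions, hh, dite_true, vτ]
      refine ⟨congrArg Subtype.val (x.1.2 _).1,
        fun h1 => (x.1.2 ⟨h, hh⟩).2 (Subtype.ext h1), trivial⟩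
    · simp only [glueTransitions, hh, dite_false, vP]
      refine ⟨congrArg Subtype.val (x.2.2 _).1,
        fun h1 => (x.2.2 ⟨h, hh⟩).2.1 (Subtype.ext h1), (x.2.2 ⟨h, hh⟩).2.2⟩
  refine Fintype.sum_bijective
    (fun x => (⟨G.glueTransitions w x.1.1 x.2.1, hg x⟩ : {P : H → H // G.IsTransitionSystem P}))
    ⟨?_, ?_⟩ _ _ ?_
  · rintro ⟨τ, P⟩ ⟨τ', P'⟩ h1
    have h2 : ∀ h, G.glueTransitions w τ.1 P.1 h = G.glueTransitions w τ'.1 P'.1 h :=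
      fun h => congrFun (congrArg Subtype.val h1) h
    refine Prod.ext (Subtype.ext (funext fun h => Subtype.ext ?_))
      (Subtype.ext (funext fun h => Subtype.ext ?_))
    · simpa [glueTransitions, h.2] using h2 h.1
    · simpa [glueTransitions, h.2] using h2 h.1
  · rintro ⟨P, hP⟩
    refine ⟨⟨⟨fun h => ⟨P h.1, (hP h.1).2.2.trans h.2⟩, fun h => ⟨Subtype.ext (hP h.1).1,
      fun h1 => (hP h.1).2.1 (congrArg Subtype.val h1)⟩⟩,
      ⟨fun h => ⟨P h.1, fun h1 => h.2 ((hP h.1).2.2.symm.trans h1)⟩,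
        fun h => ⟨Subtype.ext (hP h.1).1, fun h1 => (hP h.1).2.1 (congrArg Subtype.val h1),
          (hP h.1).2.2⟩⟩⟩, ?_⟩
    refine Subtype.ext (funext fun h => ?_)
    by_cases hh : G.vert h = w <;> simp [glueTransitions, hh]
  · rintro ⟨τ, P⟩
    refine congrArg _ (card_orbits_contract (fun h => G.vert h ≠ w) _ _ ?_ G.opp_opp ?_ ?_ _ _
      ?_ ?_ ?_).symm
    · intro h
      by_cases hh : G.vert h = w
      · simp only [glueTransitions, hh, dite_true, vτ]
        exact congrArg Subtype.val (τ.2 _).1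
      · simp only [glueTransitions, hh, dite_false, vP]
        exact congrArg Subtype.val (P.2 _).1
    · intro h hh
      simp [glueTransitions, hh, vP]
    · intro h hh
      exact hw h (not_not.1 hh)
    · intro h
      simp [glueTransitions, h.2]
    · intro h hh
      simp [splitVertex, hh]
    · intro h hh
      have hh := not_not.1 hh
      simp [splitVertex, glueTransitions, hh]

theorem card_splitVertex (G : HGraph V H) [DecidableEq V] (w : V) (hw : G.NoSelfLoopAt w)
    (τ : {h // G.vert h = w} → {h // G.vert h = w}) (hτ : IsMatching τ) (u : V) (hu : u ≠ w) :
    Nat.card {h // (G.splitVertex w hw τ hτ).vert h = u} = Nat.card {h // G.vert h = u} :=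
  Nat.card_congr
    { toFun := fun h => ⟨h.1.1, h.2⟩
      invFun := fun h => ⟨⟨h.1, fun h1 => hu (h.2.symm.trans h1)⟩, h.2⟩
      left_inv := fun _ => rfl
      right_inv := fun _ => rfl }

theorem card_deleteEdge_of_ne (G : HGraph V H) (e : H) (u : V) (hu : u ≠ G.vert e)
    (hu' : u ≠ G.vert (G.opp e)) :
    Nat.card {h // (G.deleteEdge e).vert h = u} = Nat.card {h // G.vert h = u} :=
  Nat.card_congr
    { toFun := fun h => ⟨h.1.1, h.2⟩
      invFun := fun h => ⟨⟨h.1, fun h1 => hu (h.2.symm.trans (congrArg _ h1)),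
        fun h1 => hu' (h.2.symm.trans (congrArg _ h1))⟩, h.2⟩
      left_inv := fun _ => rfl
      right_inv := fun _ => rfl }

theorem card_deleteEdge_loop [Finite H] (G : HGraph V H) (e : H)
    (he : G.vert (G.opp e) = G.vert e) :
    Nat.card {h // (G.deleteEdge e).vert h = G.vert e} + 2 =
      Nat.card {h // G.vert h = G.vert e} := by
  classical
  let x : {h // G.vert h = G.vert e} := ⟨e, rfl⟩
  let y : {h // G.vert h = G.vert e} := ⟨G.opp e, he⟩
  have hxy : x ≠ y := fun h => G.opp_ne e (congrArg Subtype.val h).symm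
  have h1 : Nat.card {h // (G.deleteEdge e).vert h = G.vert e} =
      (({x, y} : Finset {h // G.vert h = G.vert e}) : Set {h // G.vert h = G.vert e})ᶜ.ncard := by
    refine Nat.card_congr
      { toFun := fun h => ⟨⟨h.1.1, h.2⟩, ?_⟩
        invFun := fun h => ⟨⟨h.1.1, ?_⟩, h.1.2⟩
        left_inv := fun _ => rfl
        right_inv := fun _ => rfl }
    · have := h.1.2
      simp only [x, y, Finset.coe_insert, Finset.coe_singleton, Set.mem_compl_iff,
        Set.mem_insert_iff, Set.mem_singleton_iff, not_or]
      exact ⟨fun h1 => this.1 (congrArg Subtype.val h1), fun h1 => this.2 (congrArg Subtype.val h1)⟩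
    · have := h.2
      simp only [Finset.coe_insert, Finset.coe_singleton, Set.mem_compl_iff, Set.mem_insert_iff,
        Set.mem_singleton_iff, not_or] at this
      exact ⟨fun h1 => this.1 (Subtype.ext h1), fun h1 => this.2 (Subtype.ext h1)⟩
  rw [h1, ← Set.ncard_add_ncard_compl
    (({x, y} : Finset {h // G.vert h = G.vert e}) : Set {h // G.vert h = G.vert e}),
    Set.ncard_coe_finset, Finset.card_pair hxy, add_comm]

end HGraph

end

/-! ### Insertion and deletion of a self-loop -/

section

namespace HGraph

open Polynomial

variable {V H : Type*}

/-- Inserting the self-loop `e` into a transition system of the graph without it: closed up by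
itself, or inserted between `a` and its partner. -/
def insertLoop [DecidableEq H] (G : HGraph V H) (e : H)
    (P : {h // h ≠ e ∧ h ≠ G.opp e} → {h // h ≠ e ∧ h ≠ G.opp e}) :
    Option {a // (G.deleteEdge e).vert a = G.vert e} → H → H
  | none, h => if hh : h ≠ e ∧ h ≠ G.opp e then (P ⟨h, hh⟩).1 else G.opp h
  | some a, h => if hh : h ≠ e ∧ h ≠ G.opp e then
      (if h = a.1.1 then e else if h = (P a.1).1 then G.opp e else (P ⟨h, hh⟩).1)
      else if h = e then a.1.1 else (P a.1).1

theorem insertLoop_isTransitionSystem [DecidableEq H] (G : HGraph V H) (e : H)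
    (he : G.vert (G.opp e) = G.vert e)
    (P : {h // h ≠ e ∧ h ≠ G.opp e} → {h // h ≠ e ∧ h ≠ G.opp e})
    (hP : (G.deleteEdge e).IsTransitionSystem P)
    (o : Option {a // (G.deleteEdge e).vert a = G.vert e}) :
    G.IsTransitionSystem (G.insertLoop e P o) := by
  have hne := G.opp_ne e
  have hoo := G.opp_opp
  have key : ∀ h, ¬ (h ≠ e ∧ h ≠ G.opp e) → h = e ∨ h = G.opp e := by intro h; tauto
  have h1 : ∀ h : {h // h ≠ e ∧ h ≠ G.opp e}, P (P h) = h := fun h => (hP h).1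
  have h2 : ∀ h : {h // h ≠ e ∧ h ≠ G.opp e}, (P h).1 ≠ h.1 :=
    fun h h' => (hP h).2.1 (Subtype.ext h')
  have h3 : ∀ h : {h // h ≠ e ∧ h ≠ G.opp e}, G.vert (P h).1 = G.vert h.1 := fun h => (hP h).2.2
  have h4 : ∀ h : {h // h ≠ e ∧ h ≠ G.opp e}, h.1 ≠ e ∧ h.1 ≠ G.opp e := fun h => h.2
  intro h
  rcases o with _ | a
  · by_cases hh : h ≠ e ∧ h ≠ G.opp e
    · simp only [insertLoop, dif_pos hh, dif_pos (h4 _)]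
      exact ⟨congrArg Subtype.val (h1 _), h2 _, h3 _⟩
    · rcases key h hh with rfl | rfl
      · simp [insertLoop, hne, hoo, he]
      · simp [insertLoop, hne.symm, hoo, he]
  · have ha : G.vert a.1.1 = G.vert e := a.2
    by_cases hh : h ≠ e ∧ h ≠ G.opp e
    · by_cases ha1 : h = a.1.1
      · subst ha1
        simp [insertLoop, ha, h4]
        exact (h4 _).1.symm
      · by_cases ha2 : h = (P a.1).1
        · subst ha2
          simp [insertLoop, ha, h4, hne, h2, he, h3]
          exact (h4 _).2.symm
        · have e1 : (P ⟨h, hh⟩).1 ≠ a.1.1 := fun h5 => ha2 (by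
            rw [← Subtype.ext (a1 := P ⟨h, hh⟩) (a2 := a.1) h5, h1])
          have e2 : (P ⟨h, hh⟩).1 ≠ (P a.1).1 := fun h5 => ha1 (by
            have := congrArg P (Subtype.ext h5)
            rw [h1, h1] at this
            exact congrArg Subtype.val this)
          simp only [insertLoop, dif_pos hh, if_neg ha1, if_neg ha2, dif_pos (h4 _), if_neg e1,
            if_neg e2]
          exact ⟨congrArg Subtype.val (h1 _), h2 _, h3 _⟩
    · rcases key h hh with rfl | rfl
      · simp [insertLoop, h4, ha]
      · simp [insertLoop, hne, h4, h2, h3, ha, he]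

/-- The partner of `e` determines how the self-loop was inserted: it is `opp e` if the loop is a
circuit of its own, and otherwise it is the half-edge `a`. -/
theorem insertLoop_bijective [DecidableEq H] (G : HGraph V H) (e : H)
    (he : G.vert (G.opp e) = G.vert e) :
    Function.Bijective (fun x : Option {a // (G.deleteEdge e).vert a = G.vert e} ×
        {P // (G.deleteEdge e).IsTransitionSystem P} =>
      (⟨G.insertLoop e x.2.1 x.1, G.insertLoop_isTransitionSystem e he _ x.2.2 _⟩ :
        {P // G.IsTransitionSystem P})) := by
  have hne := G.opp_ne e
  have h4 : ∀ h : {h // h ≠ e ∧ h ≠ G.opp e}, h.1 ≠ e ∧ h.1 ≠ G.opp e := fun h => h.2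
  have key : ∀ h, ¬ (h ≠ e ∧ h ≠ G.opp e) → h = e ∨ h = G.opp e := by intro h; tauto
  constructor
  · rintro ⟨o, P, hP⟩ ⟨o', P', hP'⟩ hx
    have hx : ∀ h, G.insertLoop e P o h = G.insertLoop e P' o' h :=
      fun h => congrFun (congrArg Subtype.val hx) h
    have hxe := hx e
    have hxe' := hx (G.opp e)
    rcases o with _ | a <;> rcases o' with _ | a'
    · refine Prod.ext rfl (Subtype.ext (funext fun h => Subtype.ext ?_))
      simpa only [insertLoop, dif_pos h.2] using hx h.1
    · simp [insertLoop] at hxe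
      exact absurd hxe.symm (h4 _).2
    · simp [insertLoop] at hxe
      exact absurd hxe (h4 _).2
    · simp only [insertLoop, ne_eq, not_true_eq_false, false_and, dite_false, if_true] at hxe
      have haa : a = a' := Subtype.ext (Subtype.ext hxe)
      subst haa
      simp only [insertLoop, ne_eq, not_true_eq_false, and_false, dite_false, if_neg hne] at hxe'
      have hPa : P a.1 = P' a.1 := Subtype.ext hxe'
      refine Prod.ext rfl (Subtype.ext (funext fun h => ?_))
      by_cases h1 : h = a.1
      · rw [h1]; exact hPa
      by_cases h2 : h = P a.1
      · show P h = P' h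
        rw [h2, (hP _).1, hPa, (hP' _).1]
      · have h1' : h.1 ≠ a.1.1 := fun h5 => h1 (Subtype.ext h5)
        have h2' : h.1 ≠ (P a.1).1 := fun h5 => h2 (Subtype.ext h5)
        have := hx h.1
        simp only [insertLoop, dif_pos h.2, if_neg h1', if_neg h2', ← hPa] at this
        exact Subtype.ext this
  · rintro ⟨P, hP⟩
    have hPi : ∀ {x y}, P x = P y → x = y := fun {x y} hxy => by
      rw [← (hP x).1, hxy, (hP y).1]
    by_cases hPe : P e = G.opp e
    · have hPe' : P (G.opp e) = e := by rw [← hPe, (hP e).1]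
      refine ⟨⟨none, fun h => ⟨P h.1, fun h1 => h.2.2 (hPi (h1.trans hPe'.symm)),
        fun h1 => h.2.1 (hPi (h1.trans hPe.symm))⟩,
        fun h => ⟨Subtype.ext (hP _).1, fun h1 => (hP h.1).2.1 (congrArg Subtype.val h1),
          (hP _).2.2⟩⟩, Subtype.ext (funext fun h => ?_)⟩
      by_cases hh : h ≠ e ∧ h ≠ G.opp e
      · simp only [insertLoop, dif_pos hh]
      · rcases key h hh with rfl | rfl
        · simp [insertLoop, hPe]
        · simp [insertLoop, hPe', G.opp_opp]
    · have hPe' : P (G.opp e) ≠ e := fun h => hPe ((congrArg P h).symm.trans (hP _).1)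
      have hPPe : P (P e) = e := (hP e).1
      have hPPe' : P (P (G.opp e)) = G.opp e := (hP _).1
      have hn : P e ≠ e := (hP e).2.1
      have hn' : P (G.opp e) ≠ G.opp e := (hP _).2.1
      -- Deleting the loop joins the two half-edges that were the partners of its ends.
      let Q : {h // h ≠ e ∧ h ≠ G.opp e} → {h // h ≠ e ∧ h ≠ G.opp e} := fun h =>
        if h1 : h.1 = P e then ⟨P (G.opp e), hPe', hn'⟩
        else if h2 : h.1 = P (G.opp e) then ⟨P e, hn, hPe⟩
        else ⟨P h.1, fun h3 => h1 (hPi (h3.trans hPPe.symm)),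
          fun h3 => h2 (hPi (h3.trans hPPe'.symm))⟩
      have hne' : P (G.opp e) ≠ P e := fun h => hne (hPi h)
      refine ⟨⟨some ⟨⟨P e, hn, hPe⟩, (hP e).2.2⟩, Q, ?_⟩, Subtype.ext (funext fun h => ?_)⟩
      · intro h
        by_cases h1 : h.1 = P e
        · have : Q h = ⟨P (G.opp e), hPe', hn'⟩ := by simp [Q, h1]
          rw [this]
          refine ⟨Subtype.ext ?_, fun h5 => hne' (h1 ▸ congrArg Subtype.val h5), ?_⟩
          · simp [Q, hne', h1]
          · show G.vert (P (G.opp e)) = G.vert h.1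
            rw [(hP _).2.2, he, h1, (hP _).2.2]
        · by_cases h2 : h.1 = P (G.opp e)
          · have : Q h = ⟨P e, hn, hPe⟩ := by simp [Q, h2, hne']
            rw [this]
            refine ⟨Subtype.ext ?_, fun h5 => h1 (congrArg Subtype.val h5).symm, ?_⟩
            · simp [Q, h2]
            · show G.vert (P e) = G.vert h.1
              rw [(hP _).2.2, h2, (hP _).2.2, he]
          · have : (Q h).1 = P h.1 := by simp [Q, h1, h2]
            refine ⟨Subtype.ext ?_, fun h5 => (hP h.1).2.1 (this ▸ congrArg Subtype.val h5), ?_⟩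
            · have g1 : P h.1 ≠ P e := fun h5 => h.2.1 (hPi h5)
              have g2 : P h.1 ≠ P (G.opp e) := fun h5 => h.2.2 (hPi h5)
              have : (Q (Q h)).1 = P (Q h).1 := by
                simp only [Q, h1, h2, dite_false]
                simp [g1, g2]
              rw [this, ‹(Q h).1 = P h.1›, (hP _).1]
            · show G.vert (Q h).1 = G.vert h.1
              rw [this, (hP _).2.2]
      · have hQ : (Q ⟨P e, hn, hPe⟩).1 = P (G.opp e) := by simp [Q]
        by_cases hh : h ≠ e ∧ h ≠ G.opp e
        · simp only [insertLoop, dif_pos hh, hQ]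
          by_cases h1 : h = P e
          · simp [h1, hPPe]
          by_cases h2 : h = P (G.opp e)
          · simp [h2, hne', hPPe']
          · simp [h1, h2, Q]
        · rcases key h hh with rfl | rfl
          · simp [insertLoop]
          · simp [insertLoop, hne, hQ]

theorem circuitCount_insertLoop_none [Finite H] [DecidableEq H] (G : HGraph V H) (e : H)
    (P : {h // h ≠ e ∧ h ≠ G.opp e} → {h // h ≠ e ∧ h ≠ G.opp e})
    (hP : ∀ h, G.insertLoop e P none (G.insertLoop e P none h) = h) :
    G.circuitCount (G.insertLoop e P none) = (G.deleteEdge e).circuitCount P + 1 := by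
  refine card_orbits_remove e (G.opp e) _ _ hP G.opp_opp ?_ rfl _ _ ?_ ?_
  · simp [insertLoop]
  · intro h
    simp only [insertLoop, dif_pos h.2]
  · intro h
    rfl

theorem circuitCount_insertLoop_some [DecidableEq H] (G : HGraph V H) (e : H)
    (P : {h // h ≠ e ∧ h ≠ G.opp e} → {h // h ≠ e ∧ h ≠ G.opp e})
    (hPP : (G.deleteEdge e).IsTransitionSystem P)
    (a : {a // (G.deleteEdge e).vert a = G.vert e})
    (hP : ∀ h, G.insertLoop e P (some a) (G.insertLoop e P (some a) h) = h) :
    G.circuitCount (G.insertLoop e P (some a)) = (G.deleteEdge e).circuitCount P := by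
  unfold circuitCount
  -- The involutions swap roles here: the contracted pair `{e, opp e}` is stable under `opp` and
  -- moved off itself by the transitions.
  simp only [or_comm (b := _ = G.opp _), or_comm (b := _ = (G.deleteEdge e).opp _)]
  have h4 : ∀ h : {h // h ≠ e ∧ h ≠ G.opp e}, h.1 ≠ e ∧ h.1 ≠ G.opp e := fun h => h.2
  have hne := G.opp_ne e
  have h2 : ∀ h : {h // h ≠ e ∧ h ≠ G.opp e}, (P h).1 ≠ h.1 :=
    fun h h' => (hPP h).2.1 (Subtype.ext h')
  refine card_orbits_contract (fun h => h ≠ e ∧ h ≠ G.opp e) _ _ G.opp_opp hP ?_ ?_ _ _ ?_ ?_ ?_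
  · exact fun h hh => ((G.deleteEdge e).opp ⟨h, hh⟩).2
  · intro h hh
    simp only [insertLoop, dif_neg hh]
    split_ifs
    · exact h4 _
    · exact h4 _
  · intro h
    rfl
  · intro h hh
    simp only [insertLoop, dif_pos h.2] at hh ⊢
    split_ifs at hh ⊢ with h5 h6
    · simp at hh
    · simp at hh
    · rfl
  · intro h hh
    by_cases h5 : h.1 = a.1.1
    · have : h = a.1 := Subtype.ext h5
      simp [insertLoop, hne, this, h4]
    by_cases h6 : h.1 = (P a.1).1
    · have : h = P a.1 := Subtype.ext h6
      simp [insertLoop, h2, G.opp_opp, this, (hPP _).1, h4]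
    · simp only [insertLoop, dif_pos h.2, if_neg h5, if_neg h6] at hh
      exact absurd (h4 _) hh

/-- The loop closed up by itself is one additional circuit, hence the factor `X`. Inserting it next
to one of the remaining half-edges at its vertex only lengthens a circuit; choosing `a` or its
partner gives the two directions of traversal. -/
theorem circuitPolynomial_loop [Finite H] (G : HGraph V H) (e : H)
    (he : G.vert (G.opp e) = G.vert e) :
    G.circuitPolynomial =
      (X + C (Nat.card {a // (G.deleteEdge e).vert a = G.vert e} : ℤ)) *
        (G.deleteEdge e).circuitPolynomial := by
  classical
  let _ := Fintype.ofFinite {P // G.IsTransitionSystem P}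
  let _ := Fintype.ofFinite {P // (G.deleteEdge e).IsTransitionSystem P}
  let _ := Fintype.ofFinite {a // (G.deleteEdge e).vert a = G.vert e}
  rw [circuitPolynomial_eq_sum, circuitPolynomial_eq_sum,
    ← Fintype.sum_bijective _ (G.insertLoop_bijective e he)
      (fun x => X ^ G.circuitCount (G.insertLoop e x.2.1 x.1)) _ (fun _ => rfl),
    Fintype.sum_prod_type_right, Finset.mul_sum]
  refine Finset.sum_congr rfl fun P _ => ?_
  rw [Fintype.sum_option, circuitCount_insertLoop_none _ _ _
    fun h => (G.insertLoop_isTransitionSystem e he _ P.2 none h).1]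
  rw [Finset.sum_congr rfl fun a _ => by
    rw [circuitCount_insertLoop_some _ _ _ P.2 _
      fun h => (G.insertLoop_isTransitionSystem e he _ P.2 (some a) h).1]]
  simp only [Finset.sum_const, Finset.card_univ, Nat.card_eq_fintype_card, nsmul_eq_mul]
  simp
  ring

end HGraph

end

/-! ### Roots of the circuit polynomial; relation with the Martin invariant -/

section

namespace HGraph

open Polynomial

universe u
variable {V : Type*} {H : Type u}

theorem card_deleteEdge_lt [Finite H] (G : HGraph V H) (e : H) :
    Nat.card {h // h ≠ e ∧ h ≠ G.opp e} < Nat.card H :=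
  Finite.card_subtype_lt (x := e) (by simp)

theorem circuitPolynomial_loop' [Finite H] (G : HGraph V H) (e : H)
    (he : G.vert (G.opp e) = G.vert e) {d : ℕ} (hd : Nat.card {h // G.vert h = G.vert e} = d) :
    G.circuitPolynomial = (X + C ((d : ℤ) - 2)) * (G.deleteEdge e).circuitPolynomial := by
  rw [G.circuitPolynomial_loop e he, ← hd, ← G.card_deleteEdge_loop e he]
  simp

/-- A vertex of degree `d ≥ 1` gives rise to the root `2 - d`. -/
theorem dvd_circuitPolynomial {d : ℕ} (hd : 1 ≤ d) (n : ℕ) :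
    ∀ {H : Type u} [Finite H] (G : HGraph V H) (u : V), Nat.card H = n →
      Nat.card {h // G.vert h = u} = d → X + C ((d : ℤ) - 2) ∣ G.circuitPolynomial := by
  classical
  induction n using Nat.strong_induction_on with
  | _ n ih =>
  intro H _ G u hn hu
  by_cases h1 : ∃ e, G.vert e = u ∧ G.vert (G.opp e) = u
  · obtain ⟨e, he, he'⟩ := h1
    rw [G.circuitPolynomial_loop' e (he'.trans he.symm) (he ▸ hu)]
    exact dvd_mul_right _ _
  have hne : Nonempty {h // G.vert h = u} := (Nat.card_pos_iff.1 (by omega)).1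
  obtain ⟨h, hh⟩ := hne
  -- Without a self-loop at `u`, its neighbour `w` can be reduced, by deleting a self-loop at `w` or
  -- by splitting `w`. Both lower the number of half-edges and keep the degree of `u`.
  have hw : G.vert (G.opp h) ≠ u := fun h2 => h1 ⟨h, hh, h2⟩
  set w := G.vert (G.opp h) with hwdef
  by_cases h2 : ∃ e, G.vert e = w ∧ G.vert (G.opp e) = w
  · obtain ⟨e, he, he'⟩ := h2
    rw [G.circuitPolynomial_loop e (he'.trans he.symm)]
    refine Dvd.dvd.mul_left (ih _ (hn ▸ G.card_deleteEdge_lt e) _ u rfl ?_) _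
    rw [card_deleteEdge_of_ne _ _ _ (by rw [he]; exact hw.symm) (by rw [he']; exact hw.symm), hu]
  · have hl : G.NoSelfLoopAt w := fun e he he' => h2 ⟨e, he, he'⟩
    have := Fintype.ofFinite {τ : {h // G.vert h = w} → {h // G.vert h = w} // IsMatching τ}
    rw [G.circuitPolynomial_splitVertex w hl]
    refine Finset.dvd_sum fun τ _ => ih _ ?_ _ u rfl ?_
    · rw [← hn]
      exact Finite.card_subtype_lt (x := G.opp h) (by simp [hwdef])
    · rw [card_splitVertex _ _ _ _ _ _ hw.symm, hu]

/-- A self-loop in a graph with a further vertex of the same degree gives rise to a double root. -/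
theorem sq_dvd_circuitPolynomial [Finite H] (G : HGraph V H) (e : H)
    (he : G.vert (G.opp e) = G.vert e) {d : ℕ} (hd : 1 ≤ d)
    (hd' : Nat.card {h // G.vert h = G.vert e} = d) (u : V) (hu : u ≠ G.vert e)
    (hu' : Nat.card {h // G.vert h = u} = d) :
    (X + C ((d : ℤ) - 2)) ^ 2 ∣ G.circuitPolynomial := by
  rw [G.circuitPolynomial_loop' e he hd', sq]
  refine mul_dvd_mul_left _ (dvd_circuitPolynomial hd _ _ u rfl ?_)
  rw [card_deleteEdge_of_ne _ _ _ hu (by rwa [he]), hu']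

/-- All edges are self-loops at a single vertex; deleting them one after another yields the factors
`X + (2k - 2)`, ..., `X + 0`. -/
theorem circuitPolynomial_of_forall_vert_eq (k : ℕ) :
    ∀ {H : Type u} [Finite H] (G : HGraph V H) (u : V), (∀ h, G.vert h = u) →
      Nat.card H = 2 * k → G.circuitPolynomial = ∏ j ∈ Finset.range k, (X + C (2 * (j : ℤ))) := by
  induction k with
  | zero =>
    intro H _ G u hu hH
    have : IsEmpty H := (Finite.card_eq_zero_iff).1 hH
    have : Unique {P : H → H // G.IsTransitionSystem P} :=
      { default := ⟨id, fun h => isEmptyElim h⟩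
        uniq := fun P => Subtype.ext (funext fun h => isEmptyElim h) }
    have : IsEmpty (Quot fun h h' => h' = (id : H → H) h ∨ h' = G.opp h) :=
      ⟨fun x => Quot.inductionOn x isEmptyElim⟩
    rw [circuitPolynomial_eq_sum, Fintype.sum_unique]
    simp [circuitCount]
  | succ k ih =>
    intro H _ G u hu hH
    have : Nonempty H := (Nat.card_pos_iff.1 (by omega)).1
    obtain ⟨e⟩ := this
    have hc : ∀ {H' : Type u} (G' : HGraph V H') (v : V), (∀ h, G'.vert h = v) →
        Nat.card {h // G'.vert h = v} = Nat.card H' := fun G' v hv =>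
      Nat.card_congr (Equiv.subtypeUnivEquiv hv)
    have h2 := G.card_deleteEdge_loop e (by rw [hu, hu])
    rw [hu, hc _ _ hu, hc (G.deleteEdge e) u fun h => hu _] at h2
    rw [G.circuitPolynomial_loop' e (by rw [hu, hu]) (by rw [hu, hc _ _ hu, hH]),
      ih (G.deleteEdge e) u (fun h => hu _) (by omega), Finset.prod_range_succ, mul_comm]
    congr 3
    push_cast
    ring

theorem circuitCount_pos [Finite H] [Nonempty H] (G : HGraph V H) (P : H → H) :
    0 < G.circuitCount P := by
  unfold circuitCount
  have : Nonempty (Quot fun h h' => h' = P h ∨ h' = G.opp h) :=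
    ⟨Quot.mk _ (Classical.arbitrary H)⟩
  have : Finite (Quot fun h h' => h' = P h ∨ h' = G.opp h) := Quot.finite _
  exact Nat.card_pos

/-- The truncated exponent `c(P) - 1` is harmless because there is at least one circuit. -/
theorem circuitPolynomial_comp [Fintype H] [Nonempty H] (G : HGraph V H) :
    G.circuitPolynomial.comp (X - 2) = (X - 2) * G.martinPolynomial := by
  classical
  rw [martinPolynomial, circuitPolynomial_eq_sum, Finset.mul_sum, Polynomial.sum_comp]
  refine Finset.sum_congr ?_ fun P _ => ?_
  · congr!
  rw [pow_comp, X_comp, ← pow_succ', Nat.sub_add_cancel (G.circuitCount_pos P.1)]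

/-- Since `2 - 2k ≠ 0`, the root of the circuit polynomial at `2 - 2k` is a root of the Martin
polynomial at `4 - 2k`; so the product rule for `J(x - 2) = (x - 2) 𝔪(x)` leaves a single term
there. -/
theorem martinInvariant_eq [Fintype H] [Nonempty H] (G : HGraph V H) {k : ℕ} (hk : 2 ≤ k)
    (h : G.circuitPolynomial.eval (2 - 2 * (k : ℤ)) = 0) :
    G.martinInvariant k =
      4 * (-1) ^ k / ((Nat.factorial (k - 2) : ℚ) * (Nat.factorial (2 * k) : ℚ)) *
        (((G.circuitPolynomial.derivative.eval (2 - 2 * (k : ℤ)) : ℤ) : ℚ) / (2 - 2 * k)) := by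
  have hk' : (2 - 2 * (k : ℤ)) ≠ 0 := by omega
  have hc := G.circuitPolynomial_comp
  have h1 := congrArg (fun p => p.eval (4 - 2 * (k : ℤ))) hc
  have h2 := congrArg (fun p => p.derivative.eval (4 - 2 * (k : ℤ))) hc
  have e : (4 - 2 * (k : ℤ)) - 2 = 2 - 2 * k := by ring
  simp only [eval_comp, eval_sub, eval_X, eval_ofNat, e, eval_mul, h] at h1
  have h3 : G.martinPolynomial.eval (4 - 2 * (k : ℤ)) = 0 := by
    rcases mul_eq_zero.1 h1.symm with h' | h'
    · exact absurd h' hk'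
    · exact h'
  simp only [derivative_comp, derivative_mul, eval_mul, eval_add, eval_comp, eval_sub, eval_X,
    eval_ofNat, e, h3, derivative_sub, derivative_X, derivative_ofNat, sub_zero,
    one_mul, zero_add] at h2
  rw [martinInvariant, h2]
  have : (2 - 2 * (k : ℚ)) ≠ 0 := by exact_mod_cast hk'
  congr 1
  push_cast
  rw [mul_div_cancel_left₀ _ this]

end HGraph

end

/-! ### Coefficients of the product of all variables; Wick's rule -/

section

open MvPolynomial

/-- The exponent vector of the product of all variables. -/
noncomputable def onesExponent (σ : Type*) [Finite σ] : σ →₀ ℕ :=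
  Finsupp.equivFunOnFinite.symm fun _ => 1

@[simp] theorem onesExponent_apply {σ : Type*} [Finite σ] (i : σ) : onesExponent σ i = 1 := rfl

namespace MvPolynomial

variable {σ τ R : Type*} [CommRing R]

theorem prod_monomial {ι : Type*} (t : Finset ι) (u : ι → σ →₀ ℕ) (v : ι → R) :
    ∏ i ∈ t, monomial (u i) (v i) = monomial (∑ i ∈ t, u i) (∏ i ∈ t, v i) := by
  classical
  induction t using Finset.induction_on with
  | empty => simp
  | insert i t hi ih => rw [Finset.prod_insert hi, Finset.sum_insert hi, Finset.prod_insert hi, ih,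
      monomial_mul]

theorem aeval_monomial_monomial (s : σ → τ →₀ ℕ) (c : σ → R) (m : σ →₀ ℕ) (r : R) :
    aeval (fun i => monomial (s i) (c i)) (monomial m r) =
      monomial (m.sum fun i n => n • s i) (r * m.prod fun i n => c i ^ n) := by
  rw [aeval_monomial, Finsupp.prod]
  simp only [monomial_pow]
  rw [prod_monomial, algebraMap_eq, C_mul_monomial]
  rfl

/-- Two substitutions of monomials have the same coefficients if they do on monomials. -/
theorem coeff_aeval_monomial_congr {τ' : Type*} (s : σ → τ →₀ ℕ) (s' : σ → τ' →₀ ℕ) (e : τ →₀ ℕ)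
    (e' : τ' →₀ ℕ) (f : MvPolynomial σ R)
    (h : ∀ m ∈ f.support,
      (m.sum fun i n => n • s i) = e ↔ (m.sum fun i n => n • s' i) = e') :
    coeff e (aeval (fun i => monomial (s i) (1 : R)) f) =
      coeff e' (aeval (fun i => monomial (s' i) (1 : R)) f) := by
  classical
  conv_lhs => rw [f.as_sum]
  conv_rhs => rw [f.as_sum]
  rw [map_sum, map_sum, coeff_sum, coeff_sum]
  refine Finset.sum_congr rfl fun m hm => ?_
  rw [aeval_monomial_monomial, aeval_monomial_monomial, coeff_monomial, coeff_monomial]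
  simp [h m hm]

theorem prod_ite_pow (m : σ →₀ ℕ) (K : σ → Prop) [DecidablePred K] :
    (m.prod fun i n => (if K i then (1 : R) else 0) ^ n) =
      if ∀ i ∈ m.support, K i then 1 else 0 := by
  rw [Finsupp.prod]
  split_ifs with h
  · exact Finset.prod_eq_one fun i hi => by rw [if_pos (h i hi), one_pow]
  · push Not at h
    obtain ⟨i, hi, hK⟩ := h
    exact Finset.prod_eq_zero hi (by rw [if_neg hK, zero_pow (Finsupp.mem_support_iff.1 hi)])

/-- A family of pairs that covers every element exactly once is the graph of a unique matching. -/
theorem existsUnique_matching {X : Type*} [Fintype X] [DecidableEq X] (m : X × X →₀ ℕ)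
    (hm : ∀ h, ∑ p, m p * ((if p.1 = h then 1 else 0) + if p.2 = h then 1 else 0) = 1) :
    ∃ μ : X → X, IsMatching μ ∧ (∀ p ∈ m.support, p.2 = μ p.1) ∧
      (∀ h, ∃ p ∈ m.support, p = (h, μ h) ∨ p = (μ h, h)) ∧
      ∀ μ' : X → X, IsMatching μ' → (∀ p ∈ m.support, p.2 = μ' p.1) → μ' = μ := by
  have ha : ∀ h, ∃ p ∈ m.support, p.1 = h ∨ p.2 = h := by
    intro h
    by_contra! hc
    refine one_ne_zero (α := ℕ) ((hm h).symm.trans (Finset.sum_eq_zero fun p _ => ?_))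
    by_cases hp : p ∈ m.support
    · simp [hc p hp]
    · simp [Finsupp.notMem_support_iff.1 hp]
  have hb : ∀ p ∈ m.support, p.1 ≠ p.2 := by
    intro p hp hpp
    have h1 := Finset.single_le_sum (fun q _ => Nat.zero_le (m q *
      ((if q.1 = p.1 then 1 else 0) + if q.2 = p.1 then 1 else 0))) (Finset.mem_univ p)
    rw [hm] at h1
    have := Nat.pos_of_ne_zero (Finsupp.mem_support_iff.1 hp)
    simp [hpp] at h1
    omega
  have hc : ∀ h, ∀ p ∈ m.support, ∀ q ∈ m.support, (p.1 = h ∨ p.2 = h) → (q.1 = h ∨ q.2 = h) →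
      p = q := by
    intro h p hp q hq h1 h2
    by_contra hpq
    have h3 := Finset.sum_le_sum_of_subset (f := fun q => m q *
      ((if q.1 = h then 1 else 0) + if q.2 = h then 1 else 0)) (Finset.subset_univ {p, q})
    rw [hm, Finset.sum_pair hpq] at h3
    have := Nat.pos_of_ne_zero (Finsupp.mem_support_iff.1 hp)
    have := Nat.pos_of_ne_zero (Finsupp.mem_support_iff.1 hq)
    have e1 : 1 ≤ m p * ((if p.1 = h then 1 else 0) + if p.2 = h then 1 else 0) :=
      Nat.mul_pos ‹0 < m p› (by rcases h1 with h1 | h1 <;> simp [h1])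
    have e2 : 1 ≤ m q * ((if q.1 = h then 1 else 0) + if q.2 = h then 1 else 0) :=
      Nat.mul_pos ‹0 < m q› (by rcases h2 with h2 | h2 <;> simp [h2])
    omega
  choose P hP hPh using ha
  let μ : X → X := fun h => if (P h).1 = h then (P h).2 else (P h).1
  have h1 : ∀ p ∈ m.support, μ p.1 = p.2 ∧ μ p.2 = p.1 := by
    intro p hp
    have e1 : P p.1 = p := hc p.1 _ (hP _) _ hp (hPh _) (Or.inl rfl)
    have e2 : P p.2 = p := hc p.2 _ (hP _) _ hp (hPh _) (Or.inr rfl)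
    simp [μ, e1, e2, hb p hp]
  have h2 : ∀ h, ∃ p ∈ m.support, p = (h, μ h) ∨ p = (μ h, h) := by
    intro h
    refine ⟨P h, hP h, ?_⟩
    rcases hPh h with h3 | h3
    · left
      have := (h1 _ (hP h)).1
      rw [h3] at this
      rw [this]
      exact Prod.ext h3 rfl
    · right
      have := (h1 _ (hP h)).2
      rw [h3] at this
      rw [this]
      exact Prod.ext rfl h3
  refine ⟨μ, fun h => ?_, fun p hp => (h1 p hp).1.symm, h2, ?_⟩
  · obtain ⟨p, hp, h3 | h3⟩ := h2 h
    · have e1 := (h1 p hp).2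
      have e2 := hb p hp
      rw [h3] at e1 e2
      exact ⟨e1, e2.symm⟩
    · have e1 := (h1 p hp).1
      have e2 := hb p hp
      rw [h3] at e1 e2
      exact ⟨e1, e2⟩
  · intro μ' hμ' h3
    funext h
    obtain ⟨p, hp, h4 | h4⟩ := h2 h
    · have := h3 p hp
      rw [h4] at this
      exact this.symm
    · have := h3 p hp
      rw [h4] at this
      simp only at this
      rw [this, (hμ' _).1, ← this]

theorem X_mul_X_eq (i j : τ) :
    (X i * X j : MvPolynomial τ R) = monomial (Finsupp.single i 1 + Finsupp.single j 1) 1 := by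
  rw [X, X, monomial_mul, one_mul]

theorem ite_X_mul_X (K : Prop) [Decidable K] (i j : τ) :
    (if K then X i * X j else 0 : MvPolynomial τ R) =
      monomial (Finsupp.single i 1 + Finsupp.single j 1) (if K then 1 else 0) := by
  split_ifs
  · exact X_mul_X_eq i j
  · simp

/-- **Wick's rule**: the coefficient of the product of all variables `x_h` in a polynomial in the
products `x_h x_h'` is a sum over perfect matchings of the variables. -/
theorem coeff_aeval_X_mul_X {X' : Type*} [Fintype X'] [DecidableEq X'] (K : X' → X' → Prop)
    [DecidableRel K] (hK : ∀ h h', K h h' → K h' h)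
    [Fintype {μ : X' → X' // IsMatching μ ∧ ∀ h, K h (μ h)}] (f : MvPolynomial (X' × X') R) :
    coeff (onesExponent X') (aeval (fun p => if K p.1 p.2 then
        (X p.1 * X p.2 : MvPolynomial X' R) else 0) f) =
      ∑ μ : {μ : X' → X' // IsMatching μ ∧ ∀ h, K h (μ h)},
        coeff (onesExponent X') (aeval (fun p => if p.2 = μ.1 p.1 then
          (X p.1 * X p.2 : MvPolynomial X' R) else 0) f) := by
  simp only [ite_X_mul_X]
  induction f using MvPolynomial.induction_on' with
  | add p q hp hq => simp only [map_add, coeff_add, Finset.sum_add_distrib, hp, hq]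
  | monomial m r =>
    simp only [aeval_monomial_monomial, coeff_monomial]
    rw [prod_ite_pow (R := R) m fun p : X' × X' => K p.1 p.2]
    have e : ∀ μ : X' → X', (m.prod fun i n => (if i.2 = μ i.1 then (1 : R) else 0) ^ n) =
        if ∀ i ∈ m.support, i.2 = μ i.1 then 1 else 0 := fun μ => by
      rw [prod_ite_pow m fun i => i.2 = μ i.1]
      congr!
    simp only [e]
    by_cases h1 : (m.sum fun i n => n • (Finsupp.single i.1 1 + Finsupp.single i.2 1)) =
        onesExponent X'
    · simp only [h1, if_true]
      rw [← Finset.mul_sum]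
      congr 1
      have hm : ∀ h, ∑ p, m p * ((if p.1 = h then 1 else 0) + if p.2 = h then 1 else 0) = 1 := by
        intro h
        have := DFunLike.congr_fun h1 h
        rw [Finsupp.sum_apply, Finsupp.sum_fintype _ _ (by simp)] at this
        simpa [Finsupp.single_apply, mul_add] using this
      -- A monomial in pair variables that becomes the product of all `x_h` covers each `h` exactly
      -- once, so precisely one matching on the right keeps it, and that matching is admissible
      -- exactly if all its pairs satisfy `K`.
      obtain ⟨μ, hμ, h2, h3, h4⟩ := existsUnique_matching m hm
      by_cases h5 : ∀ p ∈ m.support, K p.1 p.2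
      · rw [if_pos h5]
        have h6 : ∀ h, K h (μ h) := by
          intro h
          obtain ⟨p, hp, h7 | h7⟩ := h3 h
          · simpa [h7] using h5 p hp
          · exact hK _ _ (by simpa [h7] using h5 p hp)
        rw [Finset.sum_eq_single ⟨μ, hμ, h6⟩, if_pos h2]
        · intro μ' _ hne
          rw [if_neg]
          exact fun h7 => hne (Subtype.ext (h4 _ μ'.2.1 h7))
        · simp
      · rw [if_neg h5, Finset.sum_eq_zero]
        intro μ' _
        rw [if_neg]
        exact fun h7 => h5 fun p hp => by rw [h7 p hp]; exact μ'.2.2 _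
    · simp only [h1, if_false, Finset.sum_const_zero]

/-- The coefficient of the product of all variables is homogeneous in any subset of them. -/
theorem coeff_onesExponent_scale [Fintype σ] (p : σ → Prop) [DecidablePred p]
    (f : MvPolynomial σ R) (n : ℕ) (hn : Nat.card {h // p h} = n) :
    coeff (onesExponent σ) ((aeval (fun h => if p h then
        (Polynomial.X * Polynomial.C (X h) : Polynomial (MvPolynomial σ R))
        else Polynomial.C (X h)) f).coeff n) = coeff (onesExponent σ) f := by
  classical
  induction f using MvPolynomial.induction_on' with
  | add f g hf hg => rw [map_add, Polynomial.coeff_add, coeff_add, coeff_add, hf, hg]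
  | monomial m r =>
    have e1 : aeval (fun h => if p h then
        (Polynomial.X * Polynomial.C (X h) : Polynomial (MvPolynomial σ R))
        else Polynomial.C (X h)) (monomial m r) =
        Polynomial.C (monomial m r) * Polynomial.X ^ (∑ i, if p i then m i else 0) := by
      rw [aeval_monomial, Finsupp.prod_fintype _ _ (by simp), ← Finset.prod_pow_eq_pow_sum]
      have e2 : ∀ i : σ, (if p i then
        (Polynomial.X * Polynomial.C (X i) : Polynomial (MvPolynomial σ R))
          else Polynomial.C (X i)) ^ m i =
          Polynomial.C (X i ^ m i) * Polynomial.X ^ (if p i then m i else 0) := by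
        intro i
        split_ifs
        · rw [mul_pow, map_pow, mul_comm]
        · simp
      simp only [e2, Finset.prod_mul_distrib]
      rw [← map_prod, ← mul_assoc]
      congr 1
      rw [monomial_eq, Finsupp.prod_fintype _ _ (by simp), map_mul]
      rfl
    rw [e1, Polynomial.coeff_C_mul_X_pow]
    by_cases h : m = onesExponent σ
    · rw [if_pos]
      subst h
      rw [← hn, Nat.card_eq_fintype_card, Fintype.card_subtype]
      simp
    · split_ifs
      · rfl
      · rw [coeff_zero, coeff_monomial, if_neg h]

end MvPolynomial

end

/-! ### The star-mesh transformation of determinants -/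

section

open Polynomial in
/-- Elimination of one row and column from a weighted Laplacian, to leading order in the weights of
the edges in the star of that row. -/
theorem coeff_det_star {R ι : Type*} [CommRing R] [IsDomain R] [Fintype ι] [DecidableEq ι] {k : ℕ}
    (hk : 1 ≤ k) (s₀ s S : R) (b : ι → R) (L : ι → ι → R)
    (hb : S = 0 → b = 0) :
    ((C s₀ + X * C s) ^ (2 * k) * (Matrix.fromBlocks (Matrix.of fun _ _ => X * C S : Matrix Unit Unit R[X])
      (Matrix.of fun _ j => -(X * C (b j))) (Matrix.of fun i _ => -(X * C (b i)))
      (Matrix.of fun i j => C (L i j) + X * C (if i = j then b i else 0))).det ^ k).coeff (2 * k) =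
    ((C s₀ + X ^ 2 * C (s * S)) ^ (2 * k) * (Matrix.of fun i j =>
      C (L i j) + X ^ 2 * C ((if i = j then S * b i else 0) - b i * b j)).det ^ k).coeff
        (2 * k) := by
  set P : R[X] := (C s₀ + X * C s) ^ (2 * k) *
    (Matrix.fromBlocks (Matrix.of fun _ _ => X * C S : Matrix Unit Unit R[X])
      (Matrix.of fun _ j => -(X * C (b j))) (Matrix.of fun i _ => -(X * C (b i)))
      (Matrix.of fun i j => C (L i j) + X * C (if i = j then b i else 0))).det ^ k with hP
  set Q : R[X] := (C s₀ + X * C (s * S)) ^ (2 * k) * (Matrix.of fun i j =>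
      C (L i j) + X * C ((if i = j then S * b i else 0) - b i * b j)).det ^ k with hQ
  have h1 : ((C s₀ + X ^ 2 * C (s * S)) ^ (2 * k) * (Matrix.of fun i j =>
      C (L i j) + X ^ 2 * C ((if i = j then S * b i else 0) - b i * b j)).det ^ k) =
      -- The right-hand side is `Q(t²)`, so the coefficient wanted from `Q` is that of `t^k`.
      expand R 2 Q := by
    rw [hQ, map_mul (expand R 2), map_pow (expand R 2), map_pow (expand R 2), AlgHom.map_det]
    congr 2
    · simp
    · congr 1
      ext1 i j
      simp
  rw [h1, show 2 * k = k * 2 from mul_comm _ _, coeff_expand_mul (by norm_num)]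
  -- Rescaling `t` to `S t` allows elimination of the row of the star without division. The two
  -- triangular factors in `e3` contribute `S · t S` and the mesh determinant; comparing
  -- coefficients of `t^(2k)` gives the claim times `S^(2k)`.
  have h2 : P.comp (C S * X) = X ^ k * (C S ^ (2 * k) * Q) := by
    have e1 : (Matrix.fromBlocks (Matrix.of fun _ _ => X * C S : Matrix Unit Unit R[X])
      (Matrix.of fun _ j => -(X * C (b j))) (Matrix.of fun i _ => -(X * C (b i)))
      (Matrix.of fun i j => C (L i j) + X * C (if i = j then b i else 0))).det.comp (C S * X) =
      C S * (X * C S) * (Matrix.of fun i j =>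
      C (L i j) + X * C ((if i = j then S * b i else 0) - b i * b j)).det := by
      have e2 : ∀ p : R[X], p.comp (C S * X) = compRingHom (C S * X) p := fun _ => rfl
      have e3 : ((Matrix.fromBlocks (Matrix.of fun _ _ => X * C S : Matrix Unit Unit R[X])
          (Matrix.of fun _ j => -(X * C (b j))) (Matrix.of fun i _ => -(X * C (b i)))
          (Matrix.of fun i j => C (L i j) + X * C (if i = j then b i else 0))).map
            (compRingHom (C S * X))) =
          Matrix.fromBlocks (Matrix.of fun _ _ => C S : Matrix Unit Unit R[X]) 0
            (Matrix.of fun i _ => - C (b i)) (1 : Matrix ι ι R[X]) *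
          Matrix.fromBlocks (Matrix.of fun _ _ => X * C S : Matrix Unit Unit R[X])
            (Matrix.of fun _ j => - (X * C (b j))) 0 (Matrix.of fun i j =>
              C (L i j) + X * C ((if i = j then S * b i else 0) - b i * b j)) := by
        rw [Matrix.fromBlocks_multiply, Matrix.fromBlocks_map]
        congr 1
        · ext1 i j
          simp [Matrix.mul_apply]
        · ext1 i j
          simp [Matrix.mul_apply]
          ring
        · ext1 i j
          simp [Matrix.mul_apply]
        · ext1 i j
          by_cases hij : i = j
          · simp [Matrix.mul_apply, hij]
            ring
          · simp [Matrix.mul_apply, hij]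
            ring
      rw [e2, RingHom.map_det, RingHom.mapMatrix_apply, e3, Matrix.det_mul, Matrix.det_fromBlocks_zero₁₂, Matrix.det_fromBlocks_zero₂₁]
      simp
      ring
    rw [hP, mul_comp, pow_comp, pow_comp, e1, hQ]
    simp
    ring
  have h3 := congrArg (fun p => p.coeff (k * 2)) h2
  rw [comp_C_mul_X_coeff, show k * 2 = k + k by ring, coeff_X_pow_mul, ← C_pow, coeff_C_mul,
    ← two_mul, mul_comm] at h3
  -- Here `S^(2k)` cannot be cancelled. But then `b = 0`, so `P` has a zero row in its determinant
  -- and `Q` is constant: both coefficients vanish as `k ≥ 1`.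
  by_cases hS : S = 0
  · have hP0 : P = 0 := by
      rw [hP, Matrix.det_eq_zero_of_row_eq_zero (Sum.inl ()), zero_pow (by omega), mul_zero]
      rintro (_ | j) <;> simp [hS, hb hS]
    have hQ0 : Q = C (s₀ ^ (2 * k) * (Matrix.of L).det ^ k) := by
      rw [hQ, C_mul (a := s₀ ^ (2 * k)), C_pow, C_pow, RingHom.map_det]
      simp [hS, hb hS]
      exact Or.inl rfl
    rw [hP0, hQ0, coeff_C_of_ne_zero (by omega), coeff_zero]
  · rw [mul_comm k 2]
    exact mul_left_cancel₀ (pow_ne_zero _ hS) h3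

end

/-! ### Weighted Laplacians and the Kirchhoff number of a graph -/

section

open MvPolynomial

section Kirchhoff

variable {V ι P R : Type*} [DecidableEq V]

/-- `1` for an edge that joins `v` with another vertex, `0` for other edges. -/
def edgeScalar (v u u' : V) : ℚ :=
  if u = v then (if u' = v then 0 else 1) else (if u' = v then 1 else 0)

/-- The reduced incidence vector of an edge, with rows for the vertices `a i`. -/
def incidence (a : ι → V) (u u' : V) (i : ι) : ℚ :=
  (if u = a i then 1 else 0) - (if u' = a i then 1 else 0)

/-- The contribution of an edge to the reduced Laplacian of the graph without the vertex `v`. -/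
def edgeMatrix (v : V) (a : ι → V) (u u' : V) (i j : ι) : ℚ :=
  if u = v ∨ u' = v then 0 else incidence a u u' i * incidence a u u' j

theorem edgeScalar_comm (v u u' : V) : edgeScalar v u u' = edgeScalar v u' u := by
  unfold edgeScalar
  split_ifs <;> rfl

theorem edgeMatrix_comm (v : V) (a : ι → V) (u u' : V) (i j : ι) :
    edgeMatrix v a u u' i j = edgeMatrix v a u' u i j := by
  unfold edgeMatrix incidence
  by_cases h : u = v <;> by_cases h' : u' = v <;> simp only [h, h', or_self, or_true, true_or,
    if_true, if_false]
  ring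

@[simp] theorem edgeScalar_self (v u : V) : edgeScalar v u u = 0 := by
  unfold edgeScalar
  split_ifs <;> rfl

@[simp] theorem edgeMatrix_self (v : V) (a : ι → V) (u : V) (i j : ι) :
    edgeMatrix v a u u i j = 0 := by
  simp [edgeMatrix, incidence]

variable [CommRing R] [Algebra ℚ R]

/-- The sum of the weights of the edges between `v` and the other vertices. -/
noncomputable def starWeight [Fintype P] (v : V) (s t : P → V) (y : P → R) : R :=
  ∑ p, edgeScalar v (s p) (t p) • y p

/-- The weighted Laplacian of the graph without `v`, with rows for the vertices `a i`. -/
noncomputable def weightedLaplacian [Fintype P] (v : V) (a : ι → V) (s t : P → V) (y : P → R) :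
    Matrix ι ι R :=
  Matrix.of fun i j => ∑ p, edgeMatrix v a (s p) (t p) i j • y p

/-- The `2k`-th power of the weight of the star of `v` times the `k`-th power of the Kirchhoff
polynomial of the graph without `v`. -/
noncomputable def kirchhoff [Fintype P] [Fintype ι] [DecidableEq ι] (k : ℕ) (v : V) (a : ι → V)
    (s t : P → V) (y : P → R) : R :=
  starWeight v s t y ^ (2 * k) * (weightedLaplacian v a s t y).det ^ k

variable [Fintype P] [Fintype ι] [DecidableEq ι]

theorem map_kirchhoff {S : Type*} [CommRing S] [Algebra ℚ S] (f : R →ₐ[ℚ] S) (k : ℕ) (v : V)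
    (a : ι → V) (s t : P → V) (y : P → R) :
    f (kirchhoff k v a s t y) = kirchhoff k v a s t fun p => f (y p) := by
  rw [kirchhoff, kirchhoff, map_mul f, map_pow f, map_pow f, AlgHom.map_det]
  congr 3
  · simp [starWeight]
  · ext i j
    simp [weightedLaplacian]

theorem kirchhoff_reindex {ι' : Type*} [Fintype ι'] [DecidableEq ι'] (e : ι' ≃ ι) (k : ℕ) (v : V)
    (a : ι → V) (s t : P → V) (y : P → R) :
    kirchhoff k v (a ∘ e) s t y = kirchhoff k v a s t y := by
  rw [kirchhoff, kirchhoff, ← Matrix.det_submatrix_equiv_self e (weightedLaplacian v a s t y)]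
  rfl

theorem kirchhoff_congr {P' : Type*} [Fintype P'] (k : ℕ) (v : V) (a : ι → V) (s t : P → V)
    (y : P → R) (s' t' : P' → V) (y' : P' → R)
    (h₁ : ∑ p, edgeScalar v (s p) (t p) • y p = ∑ p, edgeScalar v (s' p) (t' p) • y' p)
    (h₂ : ∀ i j, ∑ p, edgeMatrix v a (s p) (t p) i j • y p =
      ∑ p, edgeMatrix v a (s' p) (t' p) i j • y' p) :
    kirchhoff k v a s t y = kirchhoff k v a s' t' y' := by
  rw [kirchhoff, kirchhoff, starWeight, starWeight, h₁, weightedLaplacian, weightedLaplacian]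
  simp only [h₂]

end Kirchhoff

namespace HGraph

variable {V H ι : Type*} [DecidableEq V]

/-- The coefficient of the product of all edge variables (each written as the product of the
variables of its two half-edges) in the polynomial `kirchhoff`. -/
noncomputable def kirchhoffNumber [Fintype H] [Fintype ι] [DecidableEq ι] (k : ℕ) (v : V)
    (a : ι → V) (G : HGraph V H) : ℚ :=
  coeff (onesExponent H) (kirchhoff k v a G.vert (fun h => G.vert (G.opp h))
    -- The sum runs over half-edges, so every edge occurs twice; the factor `1/2` corrects this.
    fun h => (1 / 2 : ℚ) • (X h * X (G.opp h) : MvPolynomial H ℚ))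

/-- The pairs of half-edges that are joined after some splitting of the vertex `w`. -/
def Joinable (G : HGraph V H) (w : V) (h h' : {h // G.vert h ≠ w}) : Prop :=
  h'.1 = G.opp h.1 ∨ (G.vert (G.opp h.1) = w ∧ G.vert (G.opp h'.1) = w)

/-- The edge sets of the splittings of `w` are precisely the perfect matchings by joinable pairs, so
Wick's rule with `Joinable` as relation produces the sum over all splittings. -/
theorem splitVertex_opp_bijective (G : HGraph V H) (w : V) (hw : G.NoSelfLoopAt w) :
    Function.Bijective (fun τ : {τ : {h // G.vert h = w} → {h // G.vert h = w} // IsMatching τ} =>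
      (⟨(G.splitVertex w hw τ.1 τ.2).opp, fun h => ⟨(G.splitVertex w hw τ.1 τ.2).opp_opp h,
        (G.splitVertex w hw τ.1 τ.2).opp_ne h⟩, fun h => by
          by_cases hh : G.vert (G.opp h.1) = w
          · refine Or.inr ⟨hh, ?_⟩
            simp only [splitVertex, hh, dite_true, G.opp_opp]
            exact (τ.1 _).2
          · exact Or.inl (by simp [splitVertex, hh])⟩ :
        {μ : {h // G.vert h ≠ w} → {h // G.vert h ≠ w} //
          IsMatching μ ∧ ∀ h, G.Joinable w h (μ h)})) := by
  constructor
  · intro τ τ' hττ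
    refine Subtype.ext (funext fun h => Subtype.ext ?_)
    have := congrArg (fun x => G.opp (x.1 ⟨G.opp h.1, hw _ h.2⟩).1) hττ
    simpa [splitVertex, G.opp_opp, h.2] using this
  · rintro ⟨μ, hμ, hJ⟩
    have h1 : ∀ h : {h // G.vert h = w}, G.vert (G.opp (μ ⟨G.opp h.1, hw _ h.2⟩).1) = w := by
      intro h
      rcases hJ ⟨G.opp h.1, hw _ h.2⟩ with h2 | h2
      · exact absurd (by simp [h2, G.opp_opp, h.2]) (μ ⟨G.opp h.1, hw _ h.2⟩).2
      · exact h2.2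
    refine ⟨⟨fun h => ⟨G.opp (μ ⟨G.opp h.1, hw _ h.2⟩).1, h1 h⟩, fun h => ⟨?_, ?_⟩⟩, ?_⟩
    · apply Subtype.ext
      simp [G.opp_opp, (hμ _).1]
    · intro h2
      have := congrArg (fun x => G.opp x.1) h2
      simp only [G.opp_opp] at this
      exact (hμ _).2 (Subtype.ext this)
    · refine Subtype.ext (funext fun h => Subtype.ext ?_)
      by_cases hh : G.vert (G.opp h.1) = w
      · simp [splitVertex, hh, G.opp_opp]
      · rcases hJ h with h2 | h2
        · simp [splitVertex, hh, h2]
        · exact absurd h2.1 hh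

variable [Fintype H] [Fintype ι] [DecidableEq ι]

theorem kirchhoffNumber_reindex {ι' : Type*} [Fintype ι'] [DecidableEq ι'] (e : ι' ≃ ι) (k : ℕ)
    (v : V) (a : ι → V) (G : HGraph V H) :
    G.kirchhoffNumber k v (a ∘ e) = G.kirchhoffNumber k v a := by
  rw [kirchhoffNumber, kirchhoff_reindex, kirchhoffNumber]

/-- The half-edges away from `w`, when no edge is a self-loop at `w`. -/
theorem sum_eq_sum_away {M : Type*} [AddCommMonoid M] (G : HGraph V H) (w : V)
    (hw : G.NoSelfLoopAt w) (F : H → M) (hF : ∀ h, F (G.opp h) = F h) :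
    ∑ h, F h = ∑ h : {h // G.vert h ≠ w},
      if G.vert (G.opp h.1) = w then F h.1 + F h.1 else F h.1 := by
  have h1 : ∑ h, F h = ∑ h : {h // G.vert h = w}, F h.1 + ∑ h : {h // G.vert h ≠ w}, F h.1 :=
    (Fintype.sum_subtype_add_sum_subtype (fun h => G.vert h = w) F).symm
  have h2 : ∑ h : {h // G.vert h = w}, F h.1 =
      ∑ h : {h // G.vert h ≠ w}, if G.vert (G.opp h.1) = w then F h.1 else 0 := by
    rw [← Finset.sum_filter]
    refine Finset.sum_bij (fun h _ => ⟨G.opp h.1, hw _ h.2⟩) ?_ ?_ ?_ ?_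
    · intro h _
      simp [G.opp_opp, h.2]
    · intro h _ h' _ e
      have := congrArg (fun x => G.opp x.1) e
      simp only [G.opp_opp] at this
      exact Subtype.ext this
    · intro h hh
      refine ⟨⟨G.opp h.1, by simpa using hh⟩, Finset.mem_univ _, Subtype.ext (G.opp_opp _)⟩
    · intro h _
      exact (hF _).symm
  rw [h1, h2, ← Finset.sum_add_distrib]
  refine Finset.sum_congr rfl fun h _ => ?_
  split_ifs <;> simp

end HGraph

end

/-! ### Kirchhoff numbers in the half-edges away from a vertex -/

section

open MvPolynomial

namespace HGraph

variable {V H ι : Type*} [DecidableEq V] [Fintype H] [Fintype ι] [DecidableEq ι]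

/-- The edges of the graph enter only through the substitution for the pair variables, while the
polynomial itself depends only on `vert`. It is therefore common to all splittings of a vertex, as
Wick's rule requires. -/
theorem kirchhoffNumber_eq_coeff_pairs [DecidableEq H] (k : ℕ) (v : V) (a : ι → V)
    (G : HGraph V H) :
    G.kirchhoffNumber k v a = coeff (onesExponent H)
      (aeval (fun p => if p.2 = G.opp p.1 then (X p.1 * X p.2 : MvPolynomial H ℚ) else 0)
        (kirchhoff k v a (fun p : H × H => G.vert p.1) (fun p => G.vert p.2)
          fun p => (1 / 2 : ℚ) • (X p : MvPolynomial (H × H) ℚ))) := by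
  rw [map_kirchhoff, kirchhoffNumber]
  congr 1
  refine kirchhoff_congr _ _ _ _ _ _ _ _ _ ?_ fun i j => ?_
  · simp [Fintype.sum_prod_type]
  · simp [Fintype.sum_prod_type]

theorem sum_smul_single_add_single (G : HGraph V H) (m : H →₀ ℕ) (h : H) :
    (m.sum fun i n => n • (Finsupp.single i 1 + Finsupp.single (G.opp i) 1) : H →₀ ℕ) h =
      m h + m (G.opp h) := by
  classical
  have e : ∀ x, (G.opp x = h) = (x = G.opp h) := fun x =>
    propext ⟨fun hx => by rw [← hx, G.opp_opp], fun hx => by rw [hx, G.opp_opp]⟩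
  rw [Finsupp.sum_apply, Finsupp.sum_fintype _ _ (by simp)]
  simp [Finsupp.single_apply, Finset.sum_add_distrib, e]

/-- The half-edge variables, with those at the vertex `w` set to `1`. -/
noncomputable def awayVar (G : HGraph V H) (w : V) (h : H) :
    MvPolynomial {h // G.vert h ≠ w} ℚ :=
  if hh : G.vert h ≠ w then X ⟨h, hh⟩ else 1

/-- No information is lost by setting the variables at `w` to `1`: the exponents of `x_h` and
`x_(opp h)` always agree, and the opposite of a half-edge at `w` lies away from `w`. -/
theorem kirchhoffNumber_eq_coeff_away (k : ℕ) (v : V) (a : ι → V) (G : HGraph V H) (w : V)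
    (hw : G.NoSelfLoopAt w) :
    G.kirchhoffNumber k v a = coeff (onesExponent {h // G.vert h ≠ w})
      (kirchhoff k v a G.vert (fun h => G.vert (G.opp h))
        fun h => (1 / 2 : ℚ) • (G.awayVar w h * G.awayVar w (G.opp h))) := by
  let s' : H → {h // G.vert h ≠ w} →₀ ℕ := fun h =>
    if hh : G.vert h ≠ w then Finsupp.single ⟨h, hh⟩ 1 else 0
  have e1 : ∀ h, G.awayVar w h = monomial (s' h) 1 := by
    intro h
    simp only [awayVar, s']
    split_ifs <;> rfl
  have e2 := coeff_aeval_monomial_congr (R := ℚ)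
    (fun h => Finsupp.single h 1 + Finsupp.single (G.opp h) 1)
    (fun h => s' h + s' (G.opp h)) (onesExponent H) (onesExponent {h // G.vert h ≠ w})
    (kirchhoff k v a G.vert (fun h => G.vert (G.opp h))
      fun h => (1 / 2 : ℚ) • (X h : MvPolynomial H ℚ)) ?_
  · rw [map_kirchhoff, map_kirchhoff] at e2
    simp only [map_smul, aeval_X, ← X_mul_X_eq] at e2
    rw [kirchhoffNumber, e2]
    simp only [e1, monomial_mul, one_mul]
  · intro m _
    have e3 : ∀ h : {h // G.vert h ≠ w},
        (m.sum fun i n => n • (s' i + s' (G.opp i)) : {h // G.vert h ≠ w} →₀ ℕ) h = m h + m (G.opp h) := by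
      intro h
      rw [← G.sum_smul_single_add_single, Finsupp.sum_apply, Finsupp.sum_apply]
      refine Finset.sum_congr rfl fun i _ => ?_
      have e4 : ∀ i, s' i h = Finsupp.single i 1 h.1 := by
        classical
        intro i
        simp only [s']
        split_ifs with hi
        · simp [Finsupp.single_apply, Subtype.ext_iff]
        · rw [Finsupp.single_apply, if_neg]
          · rfl
          · rintro rfl
            exact hi h.2
      classical
      simp [e4, Finsupp.single_apply]
    constructor
    · intro h
      ext i
      rw [e3, ← G.sum_smul_single_add_single, h]
      rfl
    · intro h
      ext i
      rw [G.sum_smul_single_add_single]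
      by_cases hi : G.vert i ≠ w
      · rw [← e3 ⟨i, hi⟩, h]
        rfl
      · have h2 := e3 ⟨G.opp i, hw i (not_not.1 hi)⟩
        rw [h] at h2
        simp only [onesExponent_apply, G.opp_opp] at h2
        rw [add_comm, ← h2]
        rfl

/-- A half-edge not adjacent to `w` can only be joined to its opposite, whereas the neighbouring
half-edges of `w` form a complete mesh, including diagonal pairs. -/
theorem sum_joinable {M : Type*} [AddCommMonoid M] (G : HGraph V H) (w : V)
    (F : H → H → M) [∀ h h', Decidable (G.Joinable w h h')] :
    ∑ p : {h // G.vert h ≠ w} × {h // G.vert h ≠ w},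
      (if G.Joinable w p.1 p.2 then F p.1.1 p.2.1 else 0) =
    ∑ h : {h // G.vert h ≠ w}, if G.vert (G.opp h.1) = w then
      ∑ h' : {h // G.vert h ≠ w}, (if G.vert (G.opp h'.1) = w then F h.1 h'.1 else 0)
      else F h.1 (G.opp h.1) := by
  classical
  rw [Fintype.sum_prod_type]
  refine Finset.sum_congr rfl fun h _ => ?_
  split_ifs with hh
  · refine Finset.sum_congr rfl fun h' _ => ?_
    have : G.Joinable w h h' ↔ G.vert (G.opp h'.1) = w := by
      refine ⟨fun h1 => h1.elim (fun h2 => absurd (h2 ▸ hh) h'.2) And.right,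
        fun h1 => Or.inr ⟨hh, h1⟩⟩
    simp [this]
  · rw [Finset.sum_eq_single ⟨G.opp h.1, hh⟩]
    · exact if_pos (Or.inl rfl)
    · intro h' _ hne
      refine if_neg ?_
      rintro (h1 | h1)
      · exact hne (Subtype.ext h1)
      · exact hh h1.1
    · simp

end HGraph

end

/-! ### Edge weights of the star and of the mesh -/

section

open MvPolynomial

/-- Each term on the right is a function of `u` and `x` times a function of `u'` and `x'`; hence the
double sum over the mesh splits into products of link sums. -/
theorem edgeMatrix_smul_half {V ι R : Type*} [DecidableEq V] [DecidableEq ι] [CommRing R]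
    [Algebra ℚ R] {v : V} (a : ι → V) (ha : Function.Injective a) (hv : ∀ i, a i ≠ v) (u u' : V)
    (i j : ι) (x x' : R) :
    edgeMatrix v a u u' i j • ((1 / 2 : ℚ) • (x * x')) =
      (1 / 2 : ℚ) • (((if i = j then (if u ≠ v then x else 0) * (if u' = a i then x' else 0) else 0) +
        (if i = j then (if u = a i then x else 0) * (if u' ≠ v then x' else 0) else 0) -
        (if u = a i then x else 0) * (if u' = a j then x' else 0)) -
        (if u = a j then x else 0) * (if u' = a i then x' else 0)) := by
  have h1 := hv i
  have h2 := hv j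
  unfold edgeMatrix incidence
  by_cases hu : u = v
  · subst hu
    simp [h1.symm, h2.symm]
  by_cases hu' : u' = v
  · subst hu'
    simp [h1.symm, h2.symm]
  by_cases hij : i = j
  · subst hij
    by_cases h3 : u = a i <;> by_cases h4 : u' = a i <;> simp [h3, h4, h1, hu, hu']
  · have h5 : a i ≠ a j := fun h => hij (ha h)
    by_cases h3 : u = a i <;> by_cases h4 : u' = a i <;> by_cases h6 : u = a j <;>
      by_cases h7 : u' = a j <;> simp_all

theorem Polynomial.C_rat_smul {σ : Type*} (q : ℚ) (r : MvPolynomial σ ℚ) :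
    Polynomial.C (q • r) = q • Polynomial.C r :=
  (Polynomial.smul_C q r).symm

namespace HGraph

variable {V H ι : Type*} [DecidableEq V] [Fintype H] [Fintype ι] [DecidableEq ι]

/-- The half-edge variables, with those of the neighbouring half-edges of `w` scaled by a new
variable. -/
noncomputable def scaledVar (G : HGraph V H) (w : V) (h : H) :
    Polynomial (MvPolynomial {h // G.vert h ≠ w} ℚ) :=
  if G.vert (G.opp h) = w then Polynomial.X * Polynomial.C (G.awayVar w h)
  else Polynomial.C (G.awayVar w h)

/-- The sum of the variables of those half-edges with property `p` whose opposites are at `w`. -/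
noncomputable def linkSum (G : HGraph V H) (w : V) (p : V → Prop) [DecidablePred p] :
    MvPolynomial {h // G.vert h ≠ w} ℚ :=
  ∑ h : {h // G.vert h ≠ w}, if G.vert (G.opp h.1) = w then
    (if p (G.vert h.1) then G.awayVar w h.1 else 0) else 0

/-- A weighted sum over the edges that are not incident with `w`. -/
noncomputable def restSum (G : HGraph V H) (w : V) (c : V → V → ℚ) :
    MvPolynomial {h // G.vert h ≠ w} ℚ :=
  ∑ h : {h // G.vert h ≠ w}, if G.vert (G.opp h.1) = w then 0 else
    c (G.vert h.1) (G.vert (G.opp h.1)) •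
      ((1 / 2 : ℚ) • (G.awayVar w h.1 * G.awayVar w (G.opp h.1)))

variable (G : HGraph V H) (w : V)

theorem scaledVar_mul_of_eq (h : {h // G.vert h ≠ w}) (hh : G.vert (G.opp h.1) = w) :
    G.scaledVar w h.1 * G.scaledVar w (G.opp h.1) =
      Polynomial.X * Polynomial.C (G.awayVar w h.1) := by
  have : G.awayVar w (G.opp h.1) = 1 := by simp [awayVar, hh]
  rw [scaledVar, if_pos hh, scaledVar, if_neg (by rw [G.opp_opp]; exact h.2), this]
  simp

theorem scaledVar_mul_of_ne (h : {h // G.vert h ≠ w}) (hh : G.vert (G.opp h.1) ≠ w) :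
    G.scaledVar w h.1 * G.scaledVar w (G.opp h.1) =
      Polynomial.C (G.awayVar w h.1 * G.awayVar w (G.opp h.1)) := by
  rw [scaledVar, if_neg hh, scaledVar, if_neg (by rw [G.opp_opp]; exact h.2), map_mul]

/-- Sorting the edges of a weighted sum by whether they are incident with `w`. -/
theorem sum_scaledVar (hw : G.NoSelfLoopAt w) (c : V → V → ℚ) (hc : ∀ u u', c u u' = c u' u) :
    ∑ h, c (G.vert h) (G.vert (G.opp h)) •
      ((1 / 2 : ℚ) • (G.scaledVar w h * G.scaledVar w (G.opp h))) =
    Polynomial.C (G.restSum w c) + Polynomial.X * Polynomial.C (∑ h : {h // G.vert h ≠ w},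
      if G.vert (G.opp h.1) = w then c (G.vert h.1) w • G.awayVar w h.1 else 0) := by
  rw [G.sum_eq_sum_away w hw _ fun h => ?_]
  · rw [restSum, map_sum, map_sum, Finset.mul_sum, ← Finset.sum_add_distrib]
    refine Finset.sum_congr rfl fun h _ => ?_
    split_ifs with hh
    · rw [scaledVar_mul_of_eq _ _ _ hh, hh, Polynomial.C_rat_smul, map_zero, zero_add,
        mul_smul_comm]
      module
    · rw [scaledVar_mul_of_ne _ _ _ hh, Polynomial.C_rat_smul, Polynomial.C_rat_smul, map_zero,
        mul_zero, add_zero]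
  · rw [G.opp_opp, hc, mul_comm]

/-- Both ends of a mesh edge are scaled, so the mesh carries `X ^ 2` where the star carries `X`. -/
theorem sum_joinable_scaledVar (c : V → V → ℚ) [∀ h h', Decidable (G.Joinable w h h')] :
    ∑ p : {h // G.vert h ≠ w} × {h // G.vert h ≠ w}, c (G.vert p.1.1) (G.vert p.2.1) •
      ((1 / 2 : ℚ) • (if G.Joinable w p.1 p.2 then
        G.scaledVar w p.1.1 * G.scaledVar w p.2.1 else 0)) =
    Polynomial.C (G.restSum w c) + Polynomial.X ^ 2 * Polynomial.C (∑ h : {h // G.vert h ≠ w},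
      ∑ h' : {h // G.vert h ≠ w}, if G.vert (G.opp h.1) = w then
        (if G.vert (G.opp h'.1) = w then c (G.vert h.1) (G.vert h'.1) •
          ((1 / 2 : ℚ) • (G.awayVar w h.1 * G.awayVar w h'.1)) else 0) else 0) := by
  simp only [smul_ite, smul_zero]
  rw [G.sum_joinable w fun h h' => c (G.vert h) (G.vert h') •
      ((1 / 2 : ℚ) • (G.scaledVar w h * G.scaledVar w h'))]
  rw [restSum, map_sum, map_sum, Finset.mul_sum, ← Finset.sum_add_distrib]
  refine Finset.sum_congr rfl fun h _ => ?_
  split_ifs with hh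
  · rw [map_zero, zero_add, map_sum, Finset.mul_sum]
    refine Finset.sum_congr rfl fun h' _ => ?_
    split_ifs with hh'
    · have e : G.scaledVar w h.1 * G.scaledVar w h'.1 =
          Polynomial.X ^ 2 * Polynomial.C (G.awayVar w h.1 * G.awayVar w h'.1) := by
        rw [scaledVar, if_pos hh, scaledVar, if_pos hh', map_mul]
        ring
      rw [e, Polynomial.C_rat_smul, Polynomial.C_rat_smul, mul_smul_comm, mul_smul_comm]
    · rw [map_zero, mul_zero]
  · rw [scaledVar_mul_of_ne _ _ _ hh, Polynomial.C_rat_smul, Polynomial.C_rat_smul]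
    simp only [Finset.sum_const_zero, map_zero, mul_zero, add_zero]

theorem sum_edgeScalar_link {v : V} (hv : w ≠ v) :
    (∑ h : {h // G.vert h ≠ w}, if G.vert (G.opp h.1) = w then
      edgeScalar v (G.vert h.1) w • G.awayVar w h.1 else 0) = G.linkSum w (· = v) := by
  refine Finset.sum_congr rfl fun h _ => ?_
  simp [edgeScalar, hv]

/-- A mesh edge counts here if exactly one of its ends is at `v`. Each such pair occurs in both
orders, which cancels the factor `1/2`. -/
theorem sum_sum_edgeScalar_link {v : V} :
    (∑ h : {h // G.vert h ≠ w}, ∑ h' : {h // G.vert h ≠ w}, if G.vert (G.opp h.1) = w then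
        (if G.vert (G.opp h'.1) = w then edgeScalar v (G.vert h.1) (G.vert h'.1) •
          ((1 / 2 : ℚ) • (G.awayVar w h.1 * G.awayVar w h'.1)) else 0) else 0) =
      G.linkSum w (· = v) * G.linkSum w (· ≠ v) := by
  have h1 : G.linkSum w (· = v) * G.linkSum w (· ≠ v) =
      (1 / 2 : ℚ) • (G.linkSum w (· = v) * G.linkSum w (· ≠ v) +
        G.linkSum w (· ≠ v) * G.linkSum w (· = v)) := by
    rw [mul_comm (G.linkSum w (· ≠ v)), ← two_smul ℚ, smul_smul]
    norm_num
  rw [h1, linkSum, linkSum, Finset.sum_mul_sum, Finset.sum_mul_sum, ← Finset.sum_add_distrib,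
    Finset.smul_sum]
  refine Finset.sum_congr rfl fun h _ => ?_
  rw [← Finset.sum_add_distrib, Finset.smul_sum]
  refine Finset.sum_congr rfl fun h' _ => ?_
  unfold edgeScalar
  split_ifs <;> simp_all

/-- This Laplacian of the mesh with product weights is the Schur complement in `coeff_det_star`. -/
theorem sum_sum_edgeMatrix_link {v : V} (a : ι → V) (ha : Function.Injective a)
    (hv : ∀ i, a i ≠ v) (i j : ι) :
    (∑ h : {h // G.vert h ≠ w}, ∑ h' : {h // G.vert h ≠ w}, if G.vert (G.opp h.1) = w then
        (if G.vert (G.opp h'.1) = w then edgeMatrix v a (G.vert h.1) (G.vert h'.1) i j •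
          ((1 / 2 : ℚ) • (G.awayVar w h.1 * G.awayVar w h'.1)) else 0) else 0) =
      (if i = j then G.linkSum w (· ≠ v) * G.linkSum w (· = a i) else 0) -
        G.linkSum w (· = a i) * G.linkSum w (· = a j) := by
  have h1 : (if i = j then G.linkSum w (· ≠ v) * G.linkSum w (· = a i) else 0) -
        G.linkSum w (· = a i) * G.linkSum w (· = a j) =
      (1 / 2 : ℚ) • ((if i = j then G.linkSum w (· ≠ v) * G.linkSum w (· = a i) else 0) +
        (if i = j then G.linkSum w (· = a i) * G.linkSum w (· ≠ v) else 0) -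
        G.linkSum w (· = a i) * G.linkSum w (· = a j) -
        G.linkSum w (· = a j) * G.linkSum w (· = a i)) := by
    rw [mul_comm (G.linkSum w (· ≠ v)), mul_comm (G.linkSum w (· = a j))]
    module
  rw [h1]
  by_cases hij : i = j
  · simp only [hij, if_true]
    simp only [linkSum, Finset.sum_mul_sum, ← Finset.sum_add_distrib, ← Finset.sum_sub_distrib,
      Finset.smul_sum]
    refine Finset.sum_congr rfl fun h _ => Finset.sum_congr rfl fun h' _ => ?_
    by_cases hN : G.vert (G.opp h.1) = w
    · by_cases hN' : G.vert (G.opp h'.1) = w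
      · simp only [hN, hN', if_true]
        rw [edgeMatrix_smul_half a ha hv, if_pos rfl, if_pos rfl]
      · simp [hN']
    · simp [hN]
  · simp only [hij, if_false, add_zero, zero_sub]
    simp only [linkSum, Finset.sum_mul_sum, ← Finset.sum_neg_distrib, ← Finset.sum_sub_distrib,
      Finset.smul_sum]
    refine Finset.sum_congr rfl fun h _ => Finset.sum_congr rfl fun h' _ => ?_
    by_cases hN : G.vert (G.opp h.1) = w
    · by_cases hN' : G.vert (G.opp h'.1) = w
      · simp only [hN, hN', if_true]
        rw [edgeMatrix_smul_half a ha hv, if_neg hij, if_neg hij, add_zero, zero_sub]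
      · simp [hN']
    · simp [hN]

end HGraph

end

/-! ### The splitting recursion for Kirchhoff numbers -/

section

open MvPolynomial

theorem Polynomial.X_mul_C_neg {R : Type*} [CommRing R] (r : R) :
    (Polynomial.X * Polynomial.C (-r) : Polynomial R) = -(Polynomial.X * Polynomial.C r) := by
  rw [map_neg, mul_neg]

namespace HGraph

variable {V H ι : Type*} [DecidableEq V] [Fintype H] [Fintype ι] [DecidableEq ι]

theorem restSum_eq_zero (G : HGraph V H) (w : V) (c : V → V → ℚ)
    (hc : ∀ u u', u ≠ w → u' ≠ w → c u u' = 0) : G.restSum w c = 0 := by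
  refine Finset.sum_eq_zero fun h _ => ?_
  split_ifs with hh
  · rfl
  · rw [hc _ _ h.2 hh, zero_smul]

/-- Evaluation at all variables equal to `1` counts the links; if the count vanishes, there are
none. -/
theorem linkSum_eq_zero_of_sum_eq_zero (G : HGraph V H) (w v : V)
    (h : G.linkSum w (· ≠ v) = 0) {u : V} (hu : u ≠ v) : G.linkSum w (· = u) = 0 := by
  have e1 : ∀ h : {h // G.vert h ≠ w}, G.awayVar w h.1 = X h := fun h => dif_pos h.2
  have h1 := congrArg (eval fun _ => (1 : ℚ)) h
  rw [linkSum, map_sum, map_zero] at h1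
  have h2 : ∀ h : {h // G.vert h ≠ w}, eval (fun _ => (1 : ℚ)) (if G.vert (G.opp h.1) = w then
    (if G.vert h.1 ≠ v then G.awayVar w h.1 else 0) else 0) =
      if G.vert (G.opp h.1) = w ∧ G.vert h.1 ≠ v then 1 else 0 := by
    intro h
    rw [e1]
    by_cases h3 : G.vert (G.opp h.1) = w <;> by_cases h4 : G.vert h.1 ≠ v <;> simp [h3, h4]
  rw [Finset.sum_congr rfl fun h _ => h2 h, Finset.sum_eq_zero_iff_of_nonneg
    fun h _ => by split_ifs <;> norm_num] at h1
  refine Finset.sum_eq_zero fun h _ => ?_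
  have h5 := h1 h (Finset.mem_univ h)
  split_ifs with h3 h4
  · rw [if_pos ⟨h3, h4 ▸ hu⟩] at h5
    exact absurd h5 one_ne_zero
  · rfl
  · rfl

/-- The graph before splitting, in the shape of the left-hand side of `coeff_det_star`: the row of
`w` sees only its star, each edge of which is scaled once. -/
theorem kirchhoff_scaledVar (G : HGraph V H) (k : ℕ) (v : V) (a : Unit ⊕ ι → V)
    (ha : Function.Injective a) (hv : ∀ i, a i ≠ v) (w : V) (hwdef : w = a (Sum.inl ())) (hw : G.NoSelfLoopAt w) :
    kirchhoff k v a G.vert (fun h => G.vert (G.opp h)) (fun h => (1 / 2 : ℚ) •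
        (G.scaledVar w h * G.scaledVar w (G.opp h))) =
      (Polynomial.C (G.restSum (w) (edgeScalar v)) +
        Polynomial.X * Polynomial.C (G.linkSum (w) (· = v))) ^ (2 * k) *
      (Matrix.fromBlocks
        (Matrix.of fun _ _ => Polynomial.X * Polynomial.C (G.linkSum (w) (· ≠ v)) :
          Matrix Unit Unit _)
        (Matrix.of fun _ j =>
          -(Polynomial.X * Polynomial.C (G.linkSum (w) (· = a (Sum.inr j)))))
        (Matrix.of fun i _ =>
          -(Polynomial.X * Polynomial.C (G.linkSum (w) (· = a (Sum.inr i)))))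
        (Matrix.of fun i j => Polynomial.C (G.restSum (w) fun u u' =>
            edgeMatrix v (a ∘ Sum.inr) u u' i j) +
          Polynomial.X * Polynomial.C
            (if i = j then G.linkSum (w) (· = a (Sum.inr i)) else 0))).det ^ k := by
  have hwv : w ≠ v := hwdef ▸ hv _
  have hj : ∀ j, a (Sum.inr j) ≠ w := fun j h => by
    simpa using ha (h.trans hwdef)
  rw [kirchhoff]
  congr 2
  · rw [starWeight, G.sum_scaledVar w hw _ (edgeScalar_comm v), sum_edgeScalar_link _ _ hwv]
  · congr 1
    ext1 i j
    rw [weightedLaplacian, Matrix.of_apply,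
      G.sum_scaledVar w hw (fun u u' => edgeMatrix v a u u' i j)
        (fun u u' => edgeMatrix_comm v a u u' i j)]
    have hz : ∀ i, (i = Sum.inl ()) → ∀ u u', u ≠ w → u' ≠ w → incidence a u u' i = 0 := by
      rintro i rfl u u' hu hu'
      rw [incidence, if_neg (hwdef ▸ hu), if_neg (hwdef ▸ hu'), sub_zero]
    have hr : (i = Sum.inl () ∨ j = Sum.inl ()) →
        G.restSum w (fun u u' => edgeMatrix v a u u' i j) = 0 := by
      intro h
      refine restSum_eq_zero _ _ _ fun u u' hu hu' => ?_
      rw [edgeMatrix]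
      split_ifs
      · rfl
      · rcases h with h | h <;> rw [hz _ h _ _ hu hu'] <;> simp
    rcases i with i | i <;> rcases j with j | j
    · rw [hr (Or.inl rfl), map_zero, zero_add, Matrix.fromBlocks_apply₁₁, Matrix.of_apply]
      congr 2
      refine Finset.sum_congr rfl fun h _ => ?_
      have := h.2
      by_cases h1 : G.vert h.1 = v <;>
        simp [edgeMatrix, incidence, ← hwdef, this, hwv, h1]
    · rw [hr (Or.inl rfl), map_zero, zero_add, Matrix.fromBlocks_apply₁₂, Matrix.of_apply]
      refine Eq.trans ?_ (Polynomial.X_mul_C_neg _)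
      congr 2
      rw [linkSum, ← Finset.sum_neg_distrib]
      refine Finset.sum_congr rfl fun h _ => ?_
      have h2 := h.2
      have h3 := hv (Sum.inr j)
      by_cases h1 : G.vert h.1 = v
      · simp [edgeMatrix, h1, h3.symm]
      · by_cases h4 : G.vert h.1 = a (Sum.inr j) <;> by_cases hN : G.vert (G.opp h.1) = w <;>
          simp [edgeMatrix, incidence, ← hwdef, h2, hwv, h1, h4, (hj j).symm, h3, hj j, hN]
    · rw [hr (Or.inr rfl), map_zero, zero_add, Matrix.fromBlocks_apply₂₁, Matrix.of_apply]
      refine Eq.trans ?_ (Polynomial.X_mul_C_neg _)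
      congr 2
      rw [linkSum, ← Finset.sum_neg_distrib]
      refine Finset.sum_congr rfl fun h _ => ?_
      have h2 := h.2
      have h3 := hv (Sum.inr i)
      by_cases h1 : G.vert h.1 = v
      · simp [edgeMatrix, h1, h3.symm]
      · by_cases h4 : G.vert h.1 = a (Sum.inr i) <;> by_cases hN : G.vert (G.opp h.1) = w <;>
          simp [edgeMatrix, incidence, ← hwdef, h2, hwv, h1, h4, (hj i).symm, h3, hj i, hN]
    · rw [Matrix.fromBlocks_apply₂₂, Matrix.of_apply]
      congr 3
      have e : (if i = j then G.linkSum w (· = a (Sum.inr i)) else 0) =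
          ∑ h : {h // G.vert h ≠ w}, if G.vert (G.opp h.1) = w then
            (if i = j then (if G.vert h.1 = a (Sum.inr i) then G.awayVar w h.1 else 0) else 0)
              else 0 := by
        split_ifs with hij
        · rfl
        · simp
      rw [e]
      refine Finset.sum_congr rfl fun h _ => ?_
      have h2 := h.2
      have h3 := hv (Sum.inr i)
      have h3' := hv (Sum.inr j)
      by_cases h1 : G.vert h.1 = v
      · simp [edgeMatrix, h1, h3.symm]
      · by_cases hij : i = j
        · subst hij
          by_cases h4 : G.vert h.1 = a (Sum.inr i) <;>
            simp [edgeMatrix, incidence, hwv, h1, h4, (hj i).symm, h3]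
        · have h5 : a (Sum.inr i) ≠ a (Sum.inr j) := fun h => hij (by simpa using ha h)
          by_cases h4 : G.vert h.1 = a (Sum.inr i) <;>
            simp [edgeMatrix, incidence, hwv, h1, h4, (hj i).symm, (hj j).symm, h3, hij, h5]

/-- The mesh replacing `w`, in the shape of the right-hand side of `coeff_det_star`. -/
theorem kirchhoff_joinable_scaledVar (G : HGraph V H) (k : ℕ) (v : V) (a : Unit ⊕ ι → V)
    (ha : Function.Injective a) (hv : ∀ i, a i ≠ v) (w : V)
    [∀ h h', Decidable (G.Joinable (w) h h')] :
    kirchhoff k v (a ∘ Sum.inr)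
      (fun p : {h // G.vert h ≠ w} × {h // G.vert h ≠ w} =>
        G.vert p.1.1) (fun p => G.vert p.2.1) (fun p => (1 / 2 : ℚ) •
        (if G.Joinable (w) p.1 p.2 then G.scaledVar w p.1.1 *
          G.scaledVar w p.2.1 else 0)) =
      (Polynomial.C (G.restSum (w) (edgeScalar v)) + Polynomial.X ^ 2 * Polynomial.C
        (G.linkSum (w) (· = v) * G.linkSum (w) (· ≠ v))) ^ (2 * k) *
      (Matrix.of fun i j => Polynomial.C (G.restSum (w) fun u u' =>
            edgeMatrix v (a ∘ Sum.inr) u u' i j) + Polynomial.X ^ 2 * Polynomial.C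
          ((if i = j then G.linkSum (w) (· ≠ v) *
              G.linkSum (w) (· = a (Sum.inr i)) else 0) -
            G.linkSum (w) (· = a (Sum.inr i)) *
              G.linkSum (w) (· = a (Sum.inr j)))).det ^ k := by
  rw [kirchhoff]
  congr 2
  · rw [starWeight, G.sum_joinable_scaledVar, sum_sum_edgeScalar_link]
  · congr 1
    ext1 i j
    rw [weightedLaplacian, Matrix.of_apply,
      G.sum_joinable_scaledVar _ (fun u u' => edgeMatrix v (a ∘ Sum.inr) u u' i j),
      sum_sum_edgeMatrix_link _ _ _ (ha.comp Sum.inr_injective) fun i => hv _]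
    rfl

theorem card_neighbours (G : HGraph V H) (w : V) (hw : G.NoSelfLoopAt w) :
    Nat.card {h : {h // G.vert h ≠ w} // G.vert (G.opp h.1) = w} =
      Nat.card {h // G.vert h = w} :=
  Nat.card_congr
    { toFun := fun h => ⟨G.opp h.1.1, h.2⟩
      invFun := fun h => ⟨⟨G.opp h.1, hw _ h.2⟩, by rw [G.opp_opp]; exact h.2⟩
      left_inv := fun h => Subtype.ext (Subtype.ext (G.opp_opp _))
      right_inv := fun h => Subtype.ext (G.opp_opp _) }

/-- The recursion for the number of spanning tree partitions: splitting a vertex. -/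
theorem kirchhoffNumber_splitVertex (G : HGraph V H) {k : ℕ} (hk : 1 ≤ k) (v : V)
    (a : Unit ⊕ ι → V) (ha : Function.Injective a) (hv : ∀ i, a i ≠ v) (w : V)
    (hwdef : w = a (Sum.inl ())) (hw : G.NoSelfLoopAt w)
    (hd : Nat.card {h // G.vert h = w} = 2 * k)
    [Fintype {τ : {h // G.vert h = w} → {h // G.vert h = w} //
      IsMatching τ}] :
    G.kirchhoffNumber k v a =
      ∑ τ : {τ : {h // G.vert h = w} → {h // G.vert h = w} //
        IsMatching τ},
        (G.splitVertex w hw τ.1 τ.2).kirchhoffNumber k v (a ∘ Sum.inr) := by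
  classical
  have e1 : ∀ τ : {τ : {h // G.vert h = w} → {h // G.vert h = w} // IsMatching τ},
      (G.splitVertex w hw τ.1 τ.2).kirchhoffNumber k v (a ∘ Sum.inr) =
      coeff (onesExponent {h // G.vert h ≠ w})
        (aeval (fun p => if p.2 = (G.splitVertex w hw τ.1 τ.2).opp p.1 then
          (X p.1 * X p.2 : MvPolynomial {h // G.vert h ≠ w} ℚ) else 0)
        (kirchhoff k v (a ∘ Sum.inr)
          (fun p : {h // G.vert h ≠ w} × {h // G.vert h ≠ w} => G.vert p.1.1)
          (fun p => G.vert p.2.1) fun p => (1 / 2 : ℚ) • (X p : MvPolynomial _ ℚ))) :=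
    fun τ => kirchhoffNumber_eq_coeff_pairs _ _ _ _
  -- Wick's rule: the sum over all splittings is one coefficient for the graph in which the star of
  -- `w` is replaced by the mesh.
  have e2 := coeff_aeval_X_mul_X (R := ℚ) (G.Joinable w)
    (fun h h' hJ => hJ.elim (fun h1 => Or.inl (by rw [h1, G.opp_opp])) fun h1 => Or.inr h1.symm)
    (kirchhoff k v (a ∘ Sum.inr)
      (fun p : {h // G.vert h ≠ w} × {h // G.vert h ≠ w} => G.vert p.1.1)
      (fun p => G.vert p.2.1) fun p => (1 / 2 : ℚ) • (X p : MvPolynomial _ ℚ))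
  rw [← Fintype.sum_bijective _ (G.splitVertex_opp_bijective w hw)
    (fun τ => (G.splitVertex w hw τ.1 τ.2).kirchhoffNumber k v (a ∘ Sum.inr)) _ e1] at e2
  -- The product of all variables contains the `2k` neighbouring half-edges of `w` once each. On
  -- both sides only the coefficient of degree `2k` in the scaling variable matters.
  rw [← e2, G.kirchhoffNumber_eq_coeff_away k v a w hw,
    ← coeff_onesExponent_scale (fun h : {h // G.vert h ≠ w} => G.vert (G.opp h.1) = w) _ (2 * k)
      ((G.card_neighbours w hw).trans hd),
    ← coeff_onesExponent_scale (fun h : {h // G.vert h ≠ w} => G.vert (G.opp h.1) = w)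
      (aeval _ _) (2 * k) ((G.card_neighbours w hw).trans hd)]
  congr 1
  let σ : MvPolynomial {h // G.vert h ≠ w} ℚ →ₐ[ℚ]
      Polynomial (MvPolynomial {h // G.vert h ≠ w} ℚ) :=
    aeval (fun h => if G.vert (G.opp h.1) = w then Polynomial.X * Polynomial.C (X h)
        else Polynomial.C (X h))
  have hσ : ∀ h, σ (G.awayVar w h) = G.scaledVar w h := by
    intro h
    by_cases hh : G.vert h = w
    · rw [scaledVar, if_neg (hw h hh)]
      simp [awayVar, hh]
    · simp [awayVar, hh, scaledVar, σ]
  have hσ' : ∀ h : {h // G.vert h ≠ w}, σ (X h) = G.scaledVar w h.1 := by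
    intro h
    rw [← hσ, awayVar, dif_pos h.2]
  have p1 := G.kirchhoff_scaledVar k v a ha hv w hwdef hw
  have p2 := G.kirchhoff_joinable_scaledVar k v a ha hv w
  have q1 : σ (kirchhoff k v a G.vert (fun h => G.vert (G.opp h))
        fun h => (1 / 2 : ℚ) • (G.awayVar w h * G.awayVar w (G.opp h))) =
      kirchhoff k v a G.vert (fun h => G.vert (G.opp h)) (fun h => (1 / 2 : ℚ) •
        (G.scaledVar w h * G.scaledVar w (G.opp h))) := by
    rw [map_kirchhoff]
    simp only [map_smul, map_mul σ, hσ]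
  have q2 : σ (aeval (fun p => if G.Joinable w p.1 p.2 then
          (X p.1 * X p.2 : MvPolynomial {h // G.vert h ≠ w} ℚ) else 0) (kirchhoff k v (a ∘ Sum.inr)
      (fun p : {h // G.vert h ≠ w} × {h // G.vert h ≠ w} => G.vert p.1.1)
      (fun p => G.vert p.2.1) fun p => (1 / 2 : ℚ) • (X p : MvPolynomial _ ℚ))) =
      kirchhoff k v (a ∘ Sum.inr)
      (fun p : {h // G.vert h ≠ w} × {h // G.vert h ≠ w} =>
        G.vert p.1.1) (fun p => G.vert p.2.1) (fun p => (1 / 2 : ℚ) •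
        (if G.Joinable w p.1 p.2 then G.scaledVar w p.1.1 *
          G.scaledVar w p.2.1 else 0)) := by
    rw [map_kirchhoff, map_kirchhoff]
    congr 1
    funext p
    rw [map_smul, aeval_X, map_smul]
    split_ifs
    · rw [map_mul σ, hσ', hσ']
    · rw [map_zero]
  refine (congrArg (Polynomial.coeff · (2 * k)) (q1.trans p1)).trans (Eq.trans ?_
    (congrArg (Polynomial.coeff · (2 * k)) (q2.trans p2)).symm)
  refine coeff_det_star hk _ _ _ _ _ fun hS => funext fun i => ?_
  exact linkSum_eq_zero_of_sum_eq_zero _ _ _ hS (hv _)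

end HGraph

end

/-! ### Sums of variables over parallel edges, and one variable per edge -/

section

open MvPolynomial

namespace MvPolynomial

variable {E K R : Type*} [CommRing R]

theorem pderiv_aeval_fiberSum [Fintype K] [DecidableEq E] (π : K → E) (κ : K)
    (f : MvPolynomial E R) :
    pderiv κ (aeval (fun e => ∑ κ, if π κ = e then (X κ : MvPolynomial K R) else 0) f) =
      aeval (fun e => ∑ κ, if π κ = e then (X κ : MvPolynomial K R) else 0)
        (pderiv (π κ) f) := by
  classical
  induction f using MvPolynomial.induction_on with
  | C r => simp
  | add p q hp hq => simp only [map_add, hp, hq]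
  | mul_X p e hp =>
    rw [map_mul, Derivation.leibniz, hp, Derivation.leibniz, aeval_X, pderiv_X, map_add]
    simp only [smul_eq_mul, map_mul, aeval_X, map_sum]
    congr 2
    have : ∀ x, pderiv κ (if π x = e then (X x : MvPolynomial K R) else 0) =
        if x = κ then (if π κ = e then 1 else 0) else 0 := by
      intro x
      by_cases hx : x = κ
      · subst hx
        rw [if_pos rfl]
        split_ifs <;> simp
      · rw [if_neg hx]
        split_ifs
        · rw [pderiv_X_of_ne hx]
        · simp
    simp only [this, Finset.sum_ite_eq', Finset.mem_univ, if_true]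
    by_cases h : π κ = e
    · subst h; simp
    · simp [h, Ne.symm h]

/-- The coefficient of a square-free monomial is an iterated derivative at `0`. By the chain rule, a
derivative in `X κ` becomes one in `X (π κ)`, and repeated derivatives in the same variable produce
the factorials. -/
theorem coeff_sum_single_aeval_fiberSum [Fintype K] [Fintype E] [DecidableEq E] (π : K → E)
    (s : Finset K) (f : MvPolynomial E R) :
    coeff (∑ κ ∈ s, Finsupp.single κ 1)
        (aeval (fun e => ∑ κ, if π κ = e then (X κ : MvPolynomial K R) else 0) f) =
      (∏ e, ((∑ κ ∈ s, Finsupp.single (π κ) 1 : E →₀ ℕ) e).factorial : ℕ) *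
        coeff (∑ κ ∈ s, Finsupp.single (π κ) 1) f := by
  classical
  induction s using Finset.induction_on generalizing f with
  | empty =>
    simp only [Finset.sum_empty, Finsupp.coe_zero, Pi.zero_apply, Nat.factorial_zero,
      Finset.prod_const_one, Nat.cast_one, one_mul]
    induction f using MvPolynomial.induction_on with
    | C r => simp
    | add p q hp hq => rw [map_add, coeff_add, coeff_add, hp, hq]
    | mul_X p e hp =>
      simp only [← constantCoeff_eq, map_mul, aeval_X, map_sum, constantCoeff_X, mul_zero]
      rw [Finset.sum_eq_zero, mul_zero]
      intro x _
      split_ifs <;> simp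
  | insert κ s hκ ih =>
    have h1 : (∑ x ∈ s, Finsupp.single x 1 : K →₀ ℕ) κ = 0 := by
      rw [Finsupp.finsetSum_apply]
      exact Finset.sum_eq_zero fun x hx => Finsupp.single_eq_of_ne fun h => hκ (h ▸ hx)
    have h2 := coeff_pderiv (i := κ)
      (aeval (fun e => ∑ κ, if π κ = e then (X κ : MvPolynomial K R) else 0) f)
      (∑ x ∈ s, Finsupp.single x 1)
    rw [h1, pderiv_aeval_fiberSum, ih, coeff_pderiv] at h2
    rw [Finset.sum_insert hκ, Finset.sum_insert hκ, add_comm, add_comm (Finsupp.single (π κ) 1)]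
    simp only [Nat.cast_zero, zero_add, mul_one] at h2
    rw [← h2]
    set m : E →₀ ℕ := ∑ x ∈ s, Finsupp.single (π x) 1
    have h3 : ∏ e, ((m + Finsupp.single (π κ) 1 : E →₀ ℕ) e).factorial =
        (∏ e, (m e).factorial) * (m (π κ) + 1) := by
      rw [← Finset.mul_prod_erase _ _ (Finset.mem_univ (π κ)),
        ← Finset.mul_prod_erase _ (fun e => (m e).factorial) (Finset.mem_univ (π κ))]
      rw [Finset.prod_congr rfl fun e he => by
        rw [Finsupp.add_apply, Finsupp.single_eq_of_ne (Finset.ne_of_mem_erase he), add_zero]]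
      simp only [Finsupp.add_apply, Finsupp.single_eq_same, Nat.factorial_succ]
      ring
    rw [h3]
    push_cast
    ring

/-- Replacing each variable by a sum of new variables. -/
theorem coeff_onesExponent_aeval_fiberSum [Fintype K] [Fintype E] [DecidableEq E] (π : K → E)
    (r : E → ℕ) (hr : ∀ e, Nat.card {κ // π κ = e} = r e) (f : MvPolynomial E R) :
    coeff (onesExponent K)
        (aeval (fun e => ∑ κ, if π κ = e then (X κ : MvPolynomial K R) else 0) f) =
      (∏ e, (r e).factorial : ℕ) * coeff (Finsupp.equivFunOnFinite.symm r) f := by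
  classical
  have h1 : onesExponent K = ∑ κ, Finsupp.single κ 1 := by
    ext i
    simp [Finsupp.single_apply]
  have h2 : Finsupp.equivFunOnFinite.symm r = ∑ κ, Finsupp.single (π κ) 1 := by
    ext e
    rw [Finsupp.finsetSum_apply]
    simp [Finsupp.single_apply, ← hr, Fintype.card_subtype]
  rw [h1, coeff_sum_single_aeval_fiberSum, h2]
  simp only [← h2, Finsupp.equivFunOnFinite_symm_apply_apply]

end MvPolynomial

namespace HGraph

variable {V H ι : Type*} [DecidableEq V] [Fintype H] [Fintype ι] [DecidableEq ι]

theorem exists_orientation [Finite H] (G : HGraph V H) :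
    ∃ o : H → Prop, ∀ h, o (G.opp h) ↔ ¬ o h := by
  obtain ⟨n, ⟨e⟩⟩ := Finite.exists_equiv_fin H
  refine ⟨fun h => e h < e (G.opp h), fun h => ?_⟩
  have : e h ≠ e (G.opp h) := fun h1 => G.opp_ne h (e.injective h1).symm
  simp only [G.opp_opp, not_lt]
  exact ⟨le_of_lt, fun h1 => lt_of_le_of_ne h1 this.symm⟩

theorem sum_orientation {M : Type*} [AddCommMonoid M] (G : HGraph V H) (o : H → Prop)
    [DecidablePred o] (ho : ∀ h, o (G.opp h) ↔ ¬ o h) (F : H → M) :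
    ∑ h, F h = ∑ e : {h // o h}, (F e.1 + F (G.opp e.1)) := by
  rw [← Fintype.sum_subtype_add_sum_subtype o F, Finset.sum_add_distrib]
  congr 1
  refine Finset.sum_bij (fun h _ => ⟨G.opp h.1, (ho _).2 h.2⟩) (fun _ _ => Finset.mem_univ _)
    ?_ ?_ ?_
  · intro h _ h' _ e
    have := congrArg (fun x => G.opp x.1) e
    simp only [G.opp_opp] at this
    exact Subtype.ext this
  · intro e _
    exact ⟨⟨G.opp e.1, fun h => (ho _).1 h e.2⟩, Finset.mem_univ _, Subtype.ext (G.opp_opp _)⟩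
  · intro h _
    rw [G.opp_opp]

/-- The orientation `o` selects one half of each edge. Replacing each edge variable by the product
of its two half-edge variables is injective on monomials, and the two halves of the sum cancel the
factor `1/2`. -/
theorem kirchhoffNumber_eq_coeff_edges (k : ℕ) (v : V) (a : ι → V) (G : HGraph V H)
    (o : H → Prop) [DecidablePred o] (ho : ∀ h, o (G.opp h) ↔ ¬ o h) :
    G.kirchhoffNumber k v a = coeff (onesExponent {h // o h})
      (kirchhoff k v a (fun e : {h // o h} => G.vert e.1) (fun e => G.vert (G.opp e.1))
        fun e => (X e : MvPolynomial {h // o h} ℚ)) := by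
  classical
  set f := (kirchhoff k v a (fun e : {h // o h} => G.vert e.1) (fun e => G.vert (G.opp e.1))
        fun e => (X e : MvPolynomial {h // o h} ℚ)) with hf
  have h1 : aeval (fun e : {h // o h} => monomial (Finsupp.single e 1) (1 : ℚ)) f = f :=
    aeval_X_left_apply f
  rw [← h1, ← coeff_aeval_monomial_congr
    (fun e : {h // o h} => Finsupp.single e.1 1 + Finsupp.single (G.opp e.1) 1) _
    (onesExponent H) _ f, kirchhoffNumber, hf, map_kirchhoff]
  · congr 1
    have key : ∀ c : V → V → ℚ, (∀ u u', c u u' = c u' u) →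
        ∑ h, c (G.vert h) (G.vert (G.opp h)) •
          ((1 / 2 : ℚ) • (X h * X (G.opp h) : MvPolynomial H ℚ)) =
        ∑ e : {h // o h}, c (G.vert e.1) (G.vert (G.opp e.1)) •
          (aeval (fun e : {h // o h} => monomial (Finsupp.single e.1 1 +
            Finsupp.single (G.opp e.1) 1) (1 : ℚ)) (X e : MvPolynomial {h // o h} ℚ) :
              MvPolynomial H ℚ) := by
      intro c hc
      rw [G.sum_orientation o ho]
      refine Finset.sum_congr rfl fun e _ => ?_
      rw [aeval_X, G.opp_opp, hc (G.vert (G.opp e.1)), mul_comm (X (G.opp e.1)), ← X_mul_X_eq]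
      module
    exact kirchhoff_congr _ _ _ _ _ _ _ _ _ (key _ (edgeScalar_comm v))
      fun i j => key (fun u u' => edgeMatrix v a u u' i j) fun u u' => edgeMatrix_comm v a u u' i j
  · intro m _
    have h2 : ∀ h, (m.sum fun i n => n • (Finsupp.single i.1 1 + Finsupp.single (G.opp i.1) 1) :
        H →₀ ℕ) h = if hh : o h then m ⟨h, hh⟩ else m ⟨G.opp h, (ho h).2 hh⟩ := by
      intro h
      rw [Finsupp.sum_apply, Finsupp.sum_fintype _ _ (by simp)]
      by_cases hh : o h
      · rw [dif_pos hh, Finset.sum_eq_single ⟨h, hh⟩]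
        · simp [G.opp_ne]
        · intro e _ he
          have e1 : e.1 ≠ h := fun h' => he (Subtype.ext h')
          have e2 : G.opp e.1 ≠ h := fun h' => (ho e.1).1 (h' ▸ hh) e.2
          simp [e1, e2]
        · simp
      · rw [dif_neg hh, Finset.sum_eq_single ⟨G.opp h, (ho h).2 hh⟩]
        · simp [G.opp_ne, G.opp_opp]
        · intro e _ he
          have e1 : e.1 ≠ h := fun h' => hh (h' ▸ e.2)
          have e2 : G.opp e.1 ≠ h := fun h' => he (Subtype.ext
            ((G.opp_opp e.1).symm.trans (congrArg G.opp h')))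
          simp [e1, e2]
        · simp
    have h3 : (m.sum fun i n => n • Finsupp.single i 1) = m := by
      conv_rhs => rw [← Finsupp.sum_single m]
      simp
    rw [h3]
    constructor
    · intro h
      ext e
      have := h2 e.1
      rw [h, dif_pos e.2] at this
      exact this.symm
    · rintro rfl
      ext h
      rw [h2]
      split_ifs <;> rfl

end HGraph

end

/-! ### Proportionality of derivative and Kirchhoff number -/

section

theorem MvPolynomial.coeff_onesExponent_aeval_erase {σ R : Type*} [CommRing R] [Finite σ]
    [DecidableEq σ] (e : σ) (f : MvPolynomial σ R) :
    coeff (onesExponent σ) (aeval (fun x => if x = e then 0 else (X x : MvPolynomial σ R)) f) =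
      0 := by
  have h1 : (fun x => if x = e then 0 else (X x : MvPolynomial σ R)) =
      fun x => monomial (Finsupp.single x 1) (if x = e then 0 else 1) := by
    funext x
    split_ifs
    · simp
    · rfl
  rw [h1]
  induction f using MvPolynomial.induction_on' with
  | add p q hp hq => rw [map_add, coeff_add, hp, hq, add_zero]
  | monomial m r =>
    rw [aeval_monomial_monomial, coeff_monomial]
    split_ifs with h
    · have h3 : (m.sum fun i n => n • Finsupp.single i 1) = m := by
        conv_rhs => rw [← Finsupp.sum_single m]
        simp
      rw [h3] at h
      rw [h, Finsupp.prod, Finset.prod_eq_zero (i := e), mul_zero]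
      · simp
      · simp
    · rfl

theorem card_isMatching_congr {X Y : Type*} (e : X ≃ Y) :
    Nat.card {τ : X → X // IsMatching τ} = Nat.card {τ : Y → Y // IsMatching τ} := by
  refine Nat.card_congr ((Equiv.arrowCongr e e).subtypeEquiv fun τ => ?_)
  unfold IsMatching
  rw [← e.forall_congr_right (q := fun h => _ ∧ _)]
  simp

namespace HGraph

open Polynomial in
/-- The derivative of the circuit polynomial of the graph with two vertices and `2k` edges between
them, at `2 - 2k`. -/
noncomputable def dipoleDerivative (k : ℕ) : ℤ :=
  Nat.card {τ : Fin (2 * k) → Fin (2 * k) // IsMatching τ} *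
    (derivative (∏ j ∈ Finset.range k, (X + C (2 * (j : ℤ))))).eval (2 - 2 * (k : ℤ))

universe u
variable {V : Type*} {H : Type u} {ι : Type*} [DecidableEq V] [Fintype ι] [DecidableEq ι]

/-- A self-loop has weight zero in the star and in the Laplacian, so its variable does not occur and
the product of all variables has coefficient zero. -/
theorem kirchhoffNumber_of_loop [Fintype H] (G : HGraph V H) (k : ℕ) (v : V) (a : ι → V) (e : H)
    (he : G.vert (G.opp e) = G.vert e) : G.kirchhoffNumber k v a = 0 := by
  classical
  rw [kirchhoffNumber, ← MvPolynomial.coeff_onesExponent_aeval_erase e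
    (kirchhoff k v a G.vert (fun h => G.vert (G.opp h))
      fun h => (1 / 2 : ℚ) • (MvPolynomial.X h * MvPolynomial.X (G.opp h)))]
  rw [map_kirchhoff]
  congr 1
  have h1 : ∀ h, (h = e ∨ G.opp h = e) ∨ (h ≠ e ∧ G.opp h ≠ e) := fun h => by tauto
  have h2 : ∀ h, (h = e ∨ G.opp h = e) → G.vert (G.opp h) = G.vert h := by
    rintro h (rfl | rfl)
    · exact he
    · rw [G.opp_opp] at he
      exact he.symm
  refine kirchhoff_congr _ _ _ _ _ _ _ _ _ (Finset.sum_congr rfl fun h _ => ?_)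
    fun i j => Finset.sum_congr rfl fun h _ => ?_
  · rcases h1 h with h3 | h3
    · simp [h2 h h3]
    · simp [h3.1, h3.2]
  · rcases h1 h with h3 | h3
    · simp [h2 h h3]
    · simp [h3.1, h3.2]

open Polynomial in
-- The counterpart of `kirchhoffNumber_of_loop`: at a double root the derivative vanishes too.
theorem eval_derivative_of_loop [Finite H] (G : HGraph V H) (e : H)
    (he : G.vert (G.opp e) = G.vert e) {k : ℕ} (hk : 1 ≤ k)
    (hd : Nat.card {h // G.vert h = G.vert e} = 2 * k) (u : V) (hu : u ≠ G.vert e)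
    (hu' : Nat.card {h // G.vert h = u} = 2 * k) :
    (derivative G.circuitPolynomial).eval (2 - 2 * (k : ℤ)) = 0 := by
  obtain ⟨q, hq⟩ := G.sq_dvd_circuitPolynomial e he (by omega) hd u hu hu'
  rw [hq, derivative_mul, derivative_pow]
  simp

/-- The determinant is empty, and what remains is the multilinear coefficient of the `2k`-th power
of a sum of `2k` variables. -/
theorem kirchhoffNumber_dipole [Fintype H] (G : HGraph V H) (k : ℕ) (v : V) (a : Fin 0 → V)
    (hd : Nat.card {h // G.vert h = v} = 2 * k)
    (hG : ∀ h, G.vert (G.opp h) = v ↔ G.vert h ≠ v) :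
    G.kirchhoffNumber k v a = (2 * k).factorial := by
  classical
  rw [G.kirchhoffNumber_eq_coeff_edges k v a (fun h => G.vert h = v) hG]
  have h1 : kirchhoff k v a (fun e : {h // G.vert h = v} => G.vert e.1)
      (fun e => G.vert (G.opp e.1)) (fun e => (MvPolynomial.X e : MvPolynomial {h // G.vert h = v} ℚ)) =
      MvPolynomial.aeval (fun e : Unit => ∑ κ, if (fun _ : {h // G.vert h = v} => ()) κ = e then
        (MvPolynomial.X κ : MvPolynomial {h // G.vert h = v} ℚ) else 0)
        (MvPolynomial.X () ^ (2 * k) : MvPolynomial Unit ℚ) := by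
    have h2 : ∀ e : {h // G.vert h = v}, G.vert (G.opp e.1) ≠ v := fun e h => (hG _).1 h e.2
    rw [kirchhoff, Matrix.det_isEmpty, one_pow, mul_one, map_pow, MvPolynomial.aeval_X]
    congr 1
    refine Finset.sum_congr rfl fun e _ => ?_
    simp [edgeScalar, e.2, h2]
  rw [h1, MvPolynomial.coeff_onesExponent_aeval_fiberSum _ (fun _ => 2 * k)]
  · rw [MvPolynomial.coeff_X_pow, if_pos]
    · simp
    · ext
      simp
  · rintro ⟨⟩
    rw [← hd]
    exact Nat.card_congr (Equiv.subtypeUnivEquiv fun _ => rfl)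

open Polynomial in
-- Every splitting of `w` leaves `2k` half-edges at the one vertex `v`, so all summands coincide.
theorem eval_derivative_dipole [Finite H] (G : HGraph V H) (k : ℕ) (v : V) (w : V) (hvw : v ≠ w)
    (hdv : Nat.card {h // G.vert h = v} = 2 * k)
    (hd : Nat.card {h // G.vert h = w} = 2 * k) (hG : ∀ h, G.vert h = v ∨ G.vert h = w)
    (hw : G.NoSelfLoopAt w) :
    (derivative G.circuitPolynomial).eval (2 - 2 * (k : ℤ)) = dipoleDerivative k := by
  have := Fintype.ofFinite {τ : {h // G.vert h = w} → {h // G.vert h = w} // IsMatching τ}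
  have h1 : ∀ τ : {τ : {h // G.vert h = w} → {h // G.vert h = w} // IsMatching τ},
      (G.splitVertex w hw τ.1 τ.2).circuitPolynomial =
        ∏ j ∈ Finset.range k, (X + C (2 * (j : ℤ))) := by
    intro τ
    have h2 : ∀ h : {h // G.vert h ≠ w}, G.vert h.1 = v := fun h => (hG h.1).resolve_right h.2
    refine circuitPolynomial_of_forall_vert_eq k _ v h2 ?_
    rw [← hdv]
    exact Nat.card_congr (Equiv.subtypeEquivRight fun h =>
      ⟨fun h1 => (hG h).resolve_right h1, fun h1 h3 => hvw (h1.symm.trans h3)⟩)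
  rw [G.circuitPolynomial_splitVertex w hw, Finset.sum_congr rfl fun τ _ => h1 τ,
    Finset.sum_const, derivative_smul, eval_smul, dipoleDerivative, Finset.card_univ,
    ← Nat.card_eq_fintype_card, nsmul_eq_mul]
  have hf : Finite {h // G.vert h = w} := inferInstance
  obtain ⟨e⟩ : Nonempty ({h // G.vert h = w} ≃ Fin (2 * k)) :=
    ⟨(Finite.equivFin _).trans (finCongr hd)⟩
  rw [card_isMatching_congr e]

open Polynomial in
/-- The derivative of the circuit polynomial at the critical point counts spanning tree
partitions. -/
theorem eval_derivative_circuitPolynomial {k : ℕ} (hk : 1 ≤ k) (v w : V) (hvw : v ≠ w) (n : ℕ) :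
    ∀ {H : Type u} [Fintype H] (G : HGraph V H) (a : Fin n → V), Function.Injective a →
      (∀ i, a i ≠ v) → (∀ i, a i ≠ w) → Nat.card {h // G.vert h = v} = 2 * k →
      Nat.card {h // G.vert h = w} = 2 * k → (∀ i, Nat.card {h // G.vert h = a i} = 2 * k) →
      (∀ h, G.vert h = v ∨ G.vert h = w ∨ ∃ i, G.vert h = a i) →
      (((derivative G.circuitPolynomial).eval (2 - 2 * (k : ℤ)) : ℤ) : ℚ) *
        (2 * k).factorial = dipoleDerivative k * G.kirchhoffNumber k v a := by
  induction n with
  | zero =>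
    intro H _ G a _ _ _ hdv hdw _ hG
    -- A self-loop anywhere makes both sides zero, since `v` and `w` provide another vertex of
    -- degree `2k`.
    by_cases hl : ∃ e, G.vert (G.opp e) = G.vert e
    · obtain ⟨e, he⟩ := hl
      rw [kirchhoffNumber_of_loop G k v a e he]
      rcases hG e with h | h | ⟨i, _⟩
      · rw [G.eval_derivative_of_loop e he hk (by rw [h, hdv]) w (by rw [h]; exact hvw.symm) hdw]
        simp
      · rw [G.eval_derivative_of_loop e he hk (by rw [h, hdw]) v (by rw [h]; exact hvw) hdv]
        simp
      · exact i.elim0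
    · push Not at hl
      have hG' : ∀ h, G.vert h = v ∨ G.vert h = w := fun h => by
        rcases hG h with h | h | ⟨i, _⟩
        · exact Or.inl h
        · exact Or.inr h
        · exact i.elim0
      rw [G.eval_derivative_dipole k v w hvw hdv hdw hG' fun h h1 h2 => hl h (h2.trans h1.symm),
        G.kirchhoffNumber_dipole k v a hdv]
      intro h
      constructor
      · intro h1 h2
        exact hl h (h1.trans h2.symm)
      · intro h1
        have h2 := (hG' h).resolve_left h1
        exact (hG' (G.opp h)).resolve_right fun h3 => hl h (h3.trans h2.symm)
  | succ n ih =>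
    intro H _ G a ha hav haw hdv hdw hda hG
    by_cases hl : ∃ e, G.vert (G.opp e) = G.vert e
    · obtain ⟨e, he⟩ := hl
      rw [kirchhoffNumber_of_loop G k v a e he]
      rcases hG e with h | h | ⟨i, h⟩
      · rw [G.eval_derivative_of_loop e he hk (by rw [h, hdv]) w (by rw [h]; exact hvw.symm) hdw]
        simp
      · rw [G.eval_derivative_of_loop e he hk (by rw [h, hdw]) v (by rw [h]; exact hvw) hdv]
        simp
      · rw [G.eval_derivative_of_loop e he hk (by rw [h, hda]) v (by rw [h]; exact (hav i).symm)
          hdv]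
        simp
    push Not at hl
    have hns : ∀ u, G.NoSelfLoopAt u := fun u h h1 h2 => hl h (h2.trans h1.symm)
    let e : Unit ⊕ Fin n ≃ Fin (n + 1) := Fintype.equivOfCardEq (by simp [add_comm])
    let b := a ∘ e
    have hb : Function.Injective b := ha.comp e.injective
    have := Fintype.ofFinite {τ : {h // G.vert h = b (Sum.inl ())} →
      {h // G.vert h = b (Sum.inl ())} // IsMatching τ}
    have hbr : ∀ j, b (Sum.inr j) ≠ b (Sum.inl ()) := fun j h => by simpa using hb h
    -- Both sides are additive over the splittings of a vertex other than `v` and `w`, and each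
    -- splitting has one row fewer.
    rw [← G.kirchhoffNumber_reindex e,
      G.kirchhoffNumber_splitVertex hk v b hb (fun i => hav _) _ rfl (hns _) (hda _),
      G.circuitPolynomial_splitVertex _ (hns (b (Sum.inl ()))), derivative_sum, eval_finsetSum,
      Int.cast_sum, Finset.sum_mul, Finset.mul_sum]
    refine Finset.sum_congr rfl fun τ _ => ih _ _ (hb.comp Sum.inr_injective) (fun i => hav _)
      (fun i => haw _) ?_ ?_ ?_ ?_
    · exact (card_splitVertex _ _ _ _ _ _ (hav (e (Sum.inl ()))).symm).trans hdv
    · exact (card_splitVertex _ _ _ _ _ _ (haw (e (Sum.inl ()))).symm).trans hdw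
    · exact fun j => (card_splitVertex _ _ _ _ _ _ (hbr j)).trans (hda _)
    · intro h
      rcases hG h.1 with h1 | h1 | ⟨i, h1⟩
      · exact Or.inl h1
      · exact Or.inr (Or.inl h1)
      · obtain ⟨j, rfl⟩ := e.surjective i
        rcases j with j | j
        · exact absurd h1 h.2
        · exact Or.inr (Or.inr ⟨j, h1⟩)

end HGraph

end

/-! ### Kirchhoff polynomials of integer matrices; graphs with multiplied edges -/

section

open MvPolynomial

section KirchhoffPolynomial

variable {ι E : Type*} [Fintype ι] [DecidableEq ι] [Fintype E]

/-- The Kirchhoff polynomial `det (B X Bᵀ)` of an integer matrix `B`. -/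
noncomputable def kirchhoffPolynomial (R : Type*) [CommRing R] (B : Matrix ι E ℤ) :
    MvPolynomial E R :=
  (Matrix.of fun i j => ∑ e, C ((B i e * B j e : ℤ) : R) * X e).det

theorem map_kirchhoffPolynomial {R S : Type*} [CommRing R] [CommRing S] (f : R →+* S)
    (B : Matrix ι E ℤ) : map f (kirchhoffPolynomial R B) = kirchhoffPolynomial S B := by
  rw [kirchhoffPolynomial, kirchhoffPolynomial, RingHom.map_det]
  congr 1
  ext1 i j
  simp [map_sum]

theorem coeff_kirchhoffPolynomial_pow_cast (B : Matrix ι E ℤ) (k : ℕ) (m : E →₀ ℕ) :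
    coeff m (kirchhoffPolynomial ℚ B ^ k) = ((coeff m (kirchhoffPolynomial ℤ B ^ k) : ℤ) : ℚ) := by
  rw [← map_kirchhoffPolynomial (Int.castRingHom ℚ), ← map_pow, coeff_map]
  simp

end KirchhoffPolynomial

namespace HGraph

/-- The signed incidence matrix of an oriented graph, with rows for the vertices `a i`. -/
def incidenceMatrix {V H ι : Type*} [DecidableEq V] (G : HGraph V H) (a : ι → V) (o : H → Prop) :
    Matrix ι {h // o h} ℤ :=
  Matrix.of fun i e => (if G.vert e.1 = a i then 1 else 0) -
    (if G.vert (G.opp e.1) = a i then 1 else 0)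

theorem coeff_X_none_pow_mul_rename {E R : Type*} [CommRing R] [Finite E] (n : ℕ) (r : E → ℕ)
    (p : MvPolynomial E R) :
    coeff (Finsupp.equivFunOnFinite.symm fun x : Option E => x.elim n r)
      (X none ^ n * rename some p) = coeff (Finsupp.equivFunOnFinite.symm r) p := by
  classical
  have h1 : (Finsupp.equivFunOnFinite.symm fun x : Option E => x.elim n r) =
      Finsupp.single none n + (Finsupp.equivFunOnFinite.symm r).mapDomain some := by
    ext x
    rcases x with _ | e
    · rw [Finsupp.add_apply, Finsupp.mapDomain_of_notMem_range _ _ (by simp)]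
      simp
    · rw [Finsupp.add_apply, Finsupp.mapDomain_apply (Option.some_injective E)]
      simp
  rw [h1, X_pow_eq_monomial, coeff_monomial_mul, one_mul,
    coeff_rename_mapDomain _ (Option.some_injective E)]

variable {V H K ι : Type*} [DecidableEq V] [Fintype H] [Fintype K] [Fintype ι] [DecidableEq ι]

/-- Each edge variable of `G ∖ v` is replaced by the sum over its `r` copies, and one auxiliary
variable by the sum over the `2k` edges at `v`. These fibre sizes give the factorials. -/
theorem kirchhoffNumber_cover (G : HGraph V H) (v : V) (hv : G.NoSelfLoopAt v)
    (a : ι → {w // w ≠ v}) (o : {h // G.vert h ≠ v ∧ G.vert (G.opp h) ≠ v} → Prop)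
    (ho : ∀ h, o ((G.deleteVertex v).opp h) ↔ ¬ o h) [Fintype {h // o h}]
    (G' : HGraph V K) (ρ : K → H) (hvert : ∀ κ, G'.vert κ = G.vert (ρ κ))
    (hopp : ∀ κ, ρ (G'.opp κ) = G.opp (ρ κ)) (r : ℕ) (hr : ∀ h, Nat.card {κ // ρ κ = h} = r)
    (k d : ℕ) (hd : Nat.card {κ // G'.vert κ = v} = 2 * k) (hdE : Nat.card {h // o h} = d) :
    G'.kirchhoffNumber k v (fun i => (a i).1) = (2 * k).factorial * (r.factorial : ℚ) ^ d *
      ((coeff (Finsupp.equivFunOnFinite.symm fun _ => r)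
        (kirchhoffPolynomial ℤ ((G.deleteVertex v).incidenceMatrix a o) ^ k) : ℤ) : ℚ) := by
  classical
  let P : K → Prop := fun κ => ∃ h : G.vert (ρ κ) ≠ v ∧ G.vert (G.opp (ρ κ)) ≠ v, o ⟨ρ κ, h⟩
  -- Edges at `v` are represented by their half at `v`, the others by the half lying over the
  -- orientation `o`.
  let o' : K → Prop := fun κ => G.vert (ρ κ) = v ∨ P κ
  have hP : ∀ κ, G.vert (ρ κ) ≠ v → G.vert (G.opp (ρ κ)) ≠ v → (P (G'.opp κ) ↔ ¬ P κ) := by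
    intro κ h1 h2
    have e1 := ho ⟨ρ κ, h1, h2⟩
    have e2 : P κ ↔ o ⟨ρ κ, h1, h2⟩ := ⟨fun h => h.2, fun h => ⟨⟨h1, h2⟩, h⟩⟩
    have e3 : P (G'.opp κ) ↔ o ((G.deleteVertex v).opp ⟨ρ κ, h1, h2⟩) := by
      simp only [P, hopp, G.opp_opp, deleteVertex]
      exact ⟨fun h => h.2, fun h => ⟨⟨h2, h1⟩, h⟩⟩
    rw [e2, e3, e1]
  have ho' : ∀ κ, o' (G'.opp κ) ↔ ¬ o' κ := by
    intro κ
    by_cases h1 : G.vert (ρ κ) = v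
    · have h2 := hv _ h1
      simp only [o', P, hopp, G.opp_opp, h1, h2]
      simp
    · by_cases h2 : G.vert (G.opp (ρ κ)) = v
      · simp only [o', P, hopp, G.opp_opp, h1, h2]
        simp
      · simp only [o', hopp, h1, h2, false_or]
        exact hP κ h1 h2
  let π : {κ // o' κ} → Option {h // o h} := fun κ =>
    if h : P κ.1 then some ⟨⟨ρ κ.1, h.1⟩, h.2⟩ else none
  have hπ : ∀ κ : {κ // o' κ}, (π κ = none ∧ G.vert (ρ κ.1) = v) ∨
      ∃ e, π κ = some e ∧ ρ κ.1 = e.1.1 := by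
    intro κ
    by_cases h : P κ.1
    · exact Or.inr ⟨⟨⟨ρ κ.1, h.1⟩, h.2⟩, by simp [π, h], rfl⟩
    · exact Or.inl ⟨by simp [π, h], κ.2.resolve_right h⟩
  rw [G'.kirchhoffNumber_eq_coeff_edges k v _ o' ho']
  set B := (G.deleteVertex v).incidenceMatrix a o with hB
  have h1 : kirchhoff k v (fun i => (a i).1) (fun κ : {κ // o' κ} => G'.vert κ.1)
      (fun κ => G'.vert (G'.opp κ.1)) (fun κ => (X κ : MvPolynomial {κ // o' κ} ℚ)) =
      aeval (fun x => ∑ κ, if π κ = x then (X κ : MvPolynomial {κ // o' κ} ℚ) else 0)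
        (X none ^ (2 * k) * rename some (kirchhoffPolynomial ℚ B ^ k) :
          MvPolynomial (Option {h // o h}) ℚ) := by
    rw [kirchhoff, map_mul, map_pow, map_pow, map_pow, aeval_X, aeval_rename,
      kirchhoffPolynomial, AlgHom.map_det]
    congr 3
    · refine Finset.sum_congr rfl fun κ _ => ?_
      beta_reduce
      rw [hvert, hvert, hopp]
      rcases hπ κ with ⟨h2, h3⟩ | ⟨e, h2, h3⟩
      · simp [h2, edgeScalar, h3, hv _ h3]
      · simp [h2, edgeScalar, h3, e.1.2.1, e.1.2.2]
    · ext1 i j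
      simp only [weightedLaplacian, Matrix.of_apply, AlgHom.mapMatrix_apply, Matrix.map_apply,
        map_sum, map_mul, aeval_X, algHom_C, Function.comp_apply, Finset.mul_sum, mul_ite,
        mul_zero]
      rw [Finset.sum_comm]
      refine Finset.sum_congr rfl fun κ _ => ?_
      rw [hvert, hvert, hopp]
      rcases hπ κ with ⟨h2, h3⟩ | ⟨e, h2, h3⟩
      · simp [h2, edgeMatrix, h3]
      · simp only [h2, Option.some.injEq]
        rw [Finset.sum_ite_eq, if_pos (Finset.mem_univ _), h3, edgeMatrix,
          if_neg (by simp [e.1.2.1, e.1.2.2]), Algebra.smul_def]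
        congr 2
        simp [hB, incidenceMatrix, incidence, deleteVertex, Subtype.ext_iff]
  have hr' : ∀ x, Nat.card {κ // π κ = x} = x.elim (2 * k) fun _ => r := by
    rintro (_ | e)
    · rw [Option.elim_none, ← hd]
      refine Nat.card_congr ⟨fun κ => ⟨κ.1.1, ?_⟩, fun κ => ⟨⟨κ.1, Or.inl ?_⟩, ?_⟩,
        fun κ => rfl, fun κ => rfl⟩
      · rcases hπ κ.1 with ⟨h2, h3⟩ | ⟨e, h2, h3⟩
        · rw [hvert, h3]
        · rw [κ.2] at h2
          exact absurd h2 (by simp)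
      · rw [← hvert, κ.2]
      · have h4 : ¬ P κ.1 := fun h => h.1.1 (by rw [← hvert, κ.2])
        simp [π, h4]
    · rw [Option.elim_some, ← hr e.1.1]
      refine Nat.card_congr ⟨fun κ => ⟨κ.1.1, ?_⟩, fun κ => ⟨⟨κ.1, Or.inr ?_⟩, ?_⟩,
        fun κ => rfl, fun κ => rfl⟩
      · rcases hπ κ.1 with ⟨h2, h3⟩ | ⟨e', h2, h3⟩
        · rw [κ.2] at h2
          exact absurd h2 (by simp)
        · rw [κ.2, Option.some.injEq] at h2
          rw [h3, h2]
      · refine ⟨by rw [κ.2]; exact e.1.2, ?_⟩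
        simpa only [κ.2] using e.2
      · have h4 : P κ.1 := ⟨by rw [κ.2]; exact e.1.2, by simpa only [κ.2] using e.2⟩
        simp only [π, h4, dite_true, Option.some.injEq]
        exact Subtype.ext (Subtype.ext κ.2)
  rw [h1, coeff_onesExponent_aeval_fiberSum π _ hr', coeff_X_none_pow_mul_rename,
    coeff_kirchhoffPolynomial_pow_cast, Fintype.prod_option]
  simp only [Option.elim_none, Option.elim_some, Finset.prod_const, Finset.card_univ]
  rw [← Nat.card_eq_fintype_card, hdE]
  push_cast
  ring

/-- The factor between the Martin invariant and the number of spanning tree partitions. -/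
noncomputable def martinConstant (k : ℕ) : ℚ :=
  4 * (-1) ^ k / ((k - 2).factorial * (2 * k).factorial) * (dipoleDerivative k / (2 - 2 * k))

/-- The derivative formula needs `2 - 2k` to be a root, which the vertex `v` of degree `2k`
guarantees; the vertex `w` only serves as the omitted row of the Laplacian. -/
theorem martinInvariant_eq_kirchhoffNumber [Fintype V] (G : HGraph V H) {k : ℕ} (hk : 2 ≤ k)
    (hG : G.IsRegular (2 * k)) (v w : V) (hvw : v ≠ w) (a : ι → V) (ha : Function.Injective a)
    (hav : ∀ i, a i ≠ v) (haw : ∀ i, a i ≠ w) (hcov : ∀ u, u = v ∨ u = w ∨ ∃ i, u = a i) :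
    G.martinInvariant k = martinConstant k * (G.kirchhoffNumber k v a / (2 * k).factorial) := by
  have hne : Nonempty {h // G.vert h = v} := by
    refine (Nat.card_pos_iff.1 ?_).1
    rw [hG v]
    omega
  have : Nonempty H := hne.map Subtype.val
  have h0 : (G.circuitPolynomial).eval (2 - 2 * (k : ℤ)) = 0 := by
    obtain ⟨q, hq⟩ := dvd_circuitPolynomial (d := 2 * k) (by omega) _ G v rfl (hG v)
    rw [hq]
    simp
  let e := (Fintype.equivFin ι).symm
  have h1 := eval_derivative_circuitPolynomial (k := k) (by omega) v w hvw _ G (a ∘ e)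
    (ha.comp e.injective) (fun i => hav _) (fun i => haw _) (hG v) (hG w) (fun i => hG _)
    (fun h => by
      rcases hcov (G.vert h) with h | h | ⟨i, h⟩
      · exact Or.inl h
      · exact Or.inr (Or.inl h)
      · exact Or.inr (Or.inr ⟨e.symm i, by simp [h]⟩))
  rw [kirchhoffNumber_reindex] at h1
  have h2 : ((2 * k).factorial : ℚ) ≠ 0 := by positivity
  rw [G.martinInvariant_eq hk h0, eq_div_of_mul_eq h2 h1, martinConstant]
  ring

end HGraph

end

/-! ### Duality for orthogonal integer matrices -/

section

open MvPolynomial Matrix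

section Duality

variable {ι ι₁ ι₂ E R S : Type*} [Fintype ι] [DecidableEq ι] [Fintype ι₁] [DecidableEq ι₁]
  [Fintype ι₂] [DecidableEq ι₂] [Fintype E] [CommRing R] [CommRing S]

/-- The matrix `B X Bᵀ`. -/
def weightedGram (B : Matrix ι E ℤ) (x : E → R) : Matrix ι ι R :=
  Matrix.of fun i j => ∑ e, ((B i e * B j e : ℤ) : R) * x e

theorem map_weightedGram (φ : R →+* S) (B : Matrix ι E ℤ) (x : E → R) :
    φ.mapMatrix (weightedGram B x) = weightedGram B fun e => φ (x e) := by
  ext i j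
  simp [weightedGram]

theorem map_det_weightedGram (φ : R →+* S) (B : Matrix ι E ℤ) (x : E → R) :
    φ (weightedGram B x).det = (weightedGram B fun e => φ (x e)).det := by
  rw [RingHom.map_det, map_weightedGram]

theorem kirchhoffPolynomial_eq_det (B : Matrix ι E ℤ) :
    kirchhoffPolynomial ℤ B = (weightedGram B (X : E → MvPolynomial E ℤ)).det := by
  rw [kirchhoffPolynomial, weightedGram]
  simp only [Int.cast_id, eq_intCast]

/-- If `B Bᵀ u = 0` then `Bᵀ u` has norm zero, hence `Bᵀ u = 0`, and `u` lies in the kernel of `B X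
Bᵀ` for every `x`. -/
theorem det_weightedGram_one_ne_zero (B : Matrix ι E ℤ) (x : E → ℤ)
    (h : (weightedGram B x).det ≠ 0) : (weightedGram B (1 : E → ℤ)).det ≠ 0 := by
  intro h0
  obtain ⟨u, hu, h1⟩ := exists_mulVec_eq_zero_iff.2 h0
  refine h (exists_mulVec_eq_zero_iff.1 ⟨u, hu, ?_⟩)
  have h2 : ∀ x : E → ℤ, weightedGram B x *ᵥ u = B *ᵥ fun e => x e * (u ᵥ* B) e := by
    intro x
    ext i
    simp only [weightedGram, mulVec, vecMul, dotProduct, Matrix.of_apply, Int.cast_id,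
      Finset.sum_mul, Finset.mul_sum]
    rw [Finset.sum_comm]
    exact Finset.sum_congr rfl fun e _ => Finset.sum_congr rfl fun j _ => by ring
  have h3 : u ᵥ* B = 0 := by
    rw [← dotProduct_self_eq_zero, ← dotProduct_mulVec]
    rw [h2] at h1
    simp only [Pi.one_apply, one_mul] at h1
    rw [h1, dotProduct_zero]
  rw [h2, h3]
  simp only [Pi.zero_apply, mul_zero]
  exact mulVec_zero B

/-- The square matrix with the rows of `B₁ X` and of `B₂ Y`. -/
def stackedMatrix (B₁ : Matrix ι₁ E ℤ) (B₂ : Matrix ι₂ E ℤ) (f : ι₁ ⊕ ι₂ ≃ E) (x y : E → R) :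
    Matrix (ι₁ ⊕ ι₂) (ι₁ ⊕ ι₂) R :=
  Matrix.of fun i j => i.elim (fun i => (B₁ i (f j) : R) * x (f j))
    fun i => (B₂ i (f j) : R) * y (f j)

variable (B₁ : Matrix ι₁ E ℤ) (B₂ : Matrix ι₂ E ℤ) (f : ι₁ ⊕ ι₂ ≃ E)

theorem map_det_stackedMatrix (φ : R →+* S) (x y : E → R) :
    φ (stackedMatrix B₁ B₂ f x y).det =
      (stackedMatrix B₁ B₂ f (fun e => φ (x e)) fun e => φ (y e)).det := by
  rw [RingHom.map_det]
  congr 1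
  ext (i | i) j <;> simp [stackedMatrix]

/-- Multiplying by the transpose of the stacked matrix at `(1, 1)` gives the two Gram matrices on
the diagonal; orthogonality of the rows removes an off-diagonal block as soon as one of the two
weights is `1`. -/
theorem det_stackedMatrix_mul (h : ∀ i j, ∑ e, B₁ i e * B₂ j e = 0) (x y : E → R)
    (hxy : x = 1 ∨ y = 1) :
    (stackedMatrix B₁ B₂ f x y).det * (stackedMatrix B₁ B₂ f (1 : E → R) 1).det =
      (weightedGram B₁ x).det * (weightedGram B₂ y).det := by
  have h1 : stackedMatrix B₁ B₂ f x y * (stackedMatrix B₁ B₂ f (1 : E → R) 1)ᵀ =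
      fromBlocks (weightedGram B₁ x) (Matrix.of fun i j => ∑ e, ((B₁ i e * B₂ j e : ℤ) : R) * x e)
        (Matrix.of fun i j => ∑ e, ((B₁ j e * B₂ i e : ℤ) : R) * y e) (weightedGram B₂ y) := by
    ext (i | i) (j | j)
    all_goals
      simp only [Matrix.mul_apply, stackedMatrix, weightedGram, Matrix.of_apply, Matrix.transpose_apply,
        Sum.elim_inl, Sum.elim_inr, Pi.one_apply, mul_one, fromBlocks_apply₁₁,
        fromBlocks_apply₁₂, fromBlocks_apply₂₁, fromBlocks_apply₂₂]
      rw [← f.sum_comp]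
      refine Finset.sum_congr rfl fun k _ => ?_
      push_cast
      ring
  rw [← det_transpose (stackedMatrix B₁ B₂ f (1 : E → R) 1), ← det_mul, h1]
  rcases hxy with rfl | rfl
  · have h2 : (Matrix.of fun i j => ∑ e, ((B₁ i e * B₂ j e : ℤ) : R) * (1 : E → R) e) = 0 := by
      ext i j
      simp only [Matrix.of_apply, Pi.one_apply, mul_one, ← Int.cast_sum, h, Int.cast_zero,
        Matrix.zero_apply]
    rw [h2, det_fromBlocks_zero₁₂]
  · have h2 : (Matrix.of fun i j => ∑ e, ((B₁ j e * B₂ i e : ℤ) : R) * (1 : E → R) e) = 0 := by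
      ext i j
      simp only [Matrix.of_apply, Pi.one_apply, mul_one, ← Int.cast_sum, h, Int.cast_zero,
        Matrix.zero_apply]
    rw [h2, det_fromBlocks_zero₂₁]

/-- The column of an edge `e` is linear in the pair `(x_e, y_e)`, so the determinant has degree one
in each such pair. -/
theorem isWeightedHomogeneous_det_stackedMatrix [DecidableEq E] :
    IsWeightedHomogeneous (fun s : E ⊕ E => (Pi.single (s.elim id id) 1 : E → ℕ))
      (stackedMatrix B₁ B₂ f (fun e => X (Sum.inl e)) (fun e => X (Sum.inr e)) :
        Matrix _ _ (MvPolynomial (E ⊕ E) ℤ)).det 1 := by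
  rw [det_apply']
  refine IsWeightedHomogeneous.sum _ _ _ fun σ _ => ?_
  have h1 : (1 : E → ℕ) = 0 + ∑ j, Pi.single (f j) 1 := by
    rw [zero_add, f.sum_comp (fun e => (Pi.single e 1 : E → ℕ))]
    exact (Finset.univ_sum_single (1 : E → ℕ)).symm
  rw [h1]
  refine IsWeightedHomogeneous.mul ?_ (IsWeightedHomogeneous.prod _ _ _ fun j _ => ?_)
  · rw [← eq_intCast (C : ℤ →+* MvPolynomial (E ⊕ E) ℤ)]
    exact isWeightedHomogeneous_C _ _
  · rcases h2 : σ j with i | i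
    · simp only [stackedMatrix, Matrix.of_apply, Sum.elim_inl]
      rw [← eq_intCast (C : ℤ →+* MvPolynomial (E ⊕ E) ℤ)]
      exact (isWeightedHomogeneous_X ℤ _ (Sum.inl (f j))).C_mul _
    · simp only [stackedMatrix, Matrix.of_apply, Sum.elim_inr]
      rw [← eq_intCast (C : ℤ →+* MvPolynomial (E ⊕ E) ℤ)]
      exact (isWeightedHomogeneous_X ℤ _ (Sum.inr (f j))).C_mul _

/-- In the `K`-th power the exponents of `x_e` and `y_e` add up to `K`; so fixing the former as `m`
is the same as fixing the latter as `m'`. -/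
theorem coeff_det_stackedMatrix_pow (K : ℕ) (m m' : E →₀ ℕ) (hm : ∀ e, m e + m' e = K) :
    coeff m ((stackedMatrix B₁ B₂ f (X : E → MvPolynomial E ℤ) 1).det ^ K) =
      coeff m' ((stackedMatrix B₁ B₂ f 1 (X : E → MvPolynomial E ℤ)).det ^ K) := by
  classical
  set Q := (stackedMatrix B₁ B₂ f (fun e => X (Sum.inl e)) (fun e => X (Sum.inr e)) :
        Matrix _ _ (MvPolynomial (E ⊕ E) ℤ)).det with hQ
  have hQh := (isWeightedHomogeneous_det_stackedMatrix B₁ B₂ f).pow K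
  rw [← hQ] at hQh
  have key : ∀ s : E ⊕ E → MvPolynomial E ℤ, aeval s Q =
      (stackedMatrix B₁ B₂ f (fun e => s (Sum.inl e)) fun e => s (Sum.inr e)).det := by
    intro s
    refine (map_det_stackedMatrix B₁ B₂ f (aeval s : _ →ₐ[ℤ] MvPolynomial E ℤ).toRingHom _ _).trans
      ?_
    congr 2 <;> exact funext fun e => aeval_X _ _
  have h1 := coeff_aeval_monomial_congr (R := ℤ) (σ := E ⊕ E)
    (fun s => s.elim (fun e => Finsupp.single e 1) 0) (fun s => s.elim 0 fun e => Finsupp.single e 1)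
    m m' (Q ^ K) ?_
  · rw [map_pow, map_pow, key, key] at h1
    exact h1
  · intro n hn
    have h2 := hQh (mem_support_iff.1 hn)
    rw [Finsupp.weight_apply, Finsupp.sum_fintype _ _ (by simp)] at h2
    have h3 : ∀ e, n (Sum.inl e) + n (Sum.inr e) = K := by
      intro e
      have := congrFun h2 e
      simp only [Finset.sum_apply, Fintype.sum_sum_type, Pi.smul_apply, Sum.elim_inl,
        Sum.elim_inr, id_eq] at this
      simpa [Pi.single_apply] using this
    rw [Finsupp.sum_fintype _ _ (by simp), Finsupp.sum_fintype _ _ (by simp)]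
    simp only [Fintype.sum_sum_type, Sum.elim_inl, Sum.elim_inr, Pi.zero_apply, smul_zero,
      Finset.sum_const_zero, add_zero, zero_add, Finsupp.smul_single, smul_eq_mul, mul_one]
    simp only [Finsupp.ext_iff, Finsupp.finsetSum_apply, Finsupp.single_apply,
      Finset.sum_ite_eq', Finset.mem_univ, if_true]
    refine forall_congr' fun e => ?_
    have := h3 e
    have := hm e
    omega

/-- Both Kirchhoff polynomials are specialisations of one stacked determinant, up to a scalar.
Weights at which they take the value `1` force these scalars to be the same sign. -/
theorem coeff_kirchhoffPolynomial_pow_dual (f : ι₁ ⊕ ι₂ ≃ E) (h : ∀ i j, ∑ e, B₁ i e * B₂ j e = 0) (x y : E → ℤ)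
    (hx : (weightedGram B₁ x).det = 1) (hy : (weightedGram B₂ y).det = 1) (K : ℕ) (m m' : E →₀ ℕ)
    (hm : ∀ e, m e + m' e = K) :
    coeff m (kirchhoffPolynomial ℤ B₁ ^ K) = coeff m' (kirchhoffPolynomial ℤ B₂ ^ K) := by
  have hτ₁ := det_weightedGram_one_ne_zero B₁ x (by rw [hx]; exact one_ne_zero)
  have hτ₂ := det_weightedGram_one_ne_zero B₂ y (by rw [hy]; exact one_ne_zero)
  have e1 := det_stackedMatrix_mul B₁ B₂ f h x 1 (Or.inr rfl)
  have e2 := det_stackedMatrix_mul B₁ B₂ f h 1 y (Or.inl rfl)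
  have e3 := det_stackedMatrix_mul B₁ B₂ f h (1 : E → ℤ) 1 (Or.inl rfl)
  have e4 := det_stackedMatrix_mul B₁ B₂ f h (X : E → MvPolynomial E ℤ) 1 (Or.inr rfl)
  have e5 := det_stackedMatrix_mul B₁ B₂ f h 1 (X : E → MvPolynomial E ℤ) (Or.inl rfl)
  have hC : (fun e => C ((1 : E → ℤ) e) : E → MvPolynomial E ℤ) = 1 := by
    ext1 e
    simp
  have e6 := map_det_stackedMatrix B₁ B₂ f (C : ℤ →+* MvPolynomial E ℤ) 1 1
  have e7 := map_det_weightedGram (C : ℤ →+* MvPolynomial E ℤ) B₁ 1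
  have e8 := map_det_weightedGram (C : ℤ →+* MvPolynomial E ℤ) B₂ 1
  rw [hC] at e6 e7 e8
  rw [← e6, ← e8, ← kirchhoffPolynomial_eq_det] at e4
  rw [← e6, ← e7, ← kirchhoffPolynomial_eq_det] at e5
  rw [hx, one_mul] at e1
  rw [hy, mul_one] at e2
  have hpow := coeff_det_stackedMatrix_pow B₁ B₂ f K m m' hm
  set δ := (stackedMatrix B₁ B₂ f (1 : E → ℤ) 1).det
  set s := (stackedMatrix B₁ B₂ f x 1).det
  set s' := (stackedMatrix B₁ B₂ f 1 y).det
  have hδ : δ ≠ 0 := by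
    intro h0
    rw [h0, mul_zero] at e1
    exact hτ₂ e1.symm
  -- The product of `e1` and `e2` is `s s' δ²`, and by `e3` it equals `δ²`.
  have hs : s' * s = 1 := by
    rw [← e1, ← e2] at e3
    have : δ * δ * (s' * s - 1) = 0 := by linear_combination -e3
    rcases mul_eq_zero.1 this with h4 | h4
    · exact absurd h4 (mul_self_ne_zero.2 hδ)
    · exact sub_eq_zero.1 h4
  have hCδ : (C δ : MvPolynomial E ℤ) ≠ 0 := by simpa using hδ
  have hsC : (C s' * C s : MvPolynomial E ℤ) = 1 := by rw [← C_mul, hs, C_1]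
  have hss : s = s' := by
    rcases Int.mul_eq_one_iff_eq_one_or_neg_one.1 hs with ⟨h4, h5⟩ | ⟨h4, h5⟩ <;> rw [h4, h5]
  rw [← e1, map_mul, ← mul_assoc] at e4
  rw [← e2, map_mul, mul_comm, mul_comm (C s'), mul_assoc] at e5
  have e9 := mul_right_cancel₀ hCδ e4
  have e10 := mul_left_cancel₀ hCδ e5
  have e11 : C s * (kirchhoffPolynomial ℤ B₁) = C s * kirchhoffPolynomial ℤ B₁ := rfl
  rw [e9, e10, mul_pow, mul_pow, mul_comm, ← C_pow, ← C_pow, coeff_C_mul, coeff_C_mul, hss] at hpow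
  refine mul_left_cancel₀ (pow_ne_zero K ?_) hpow
  rintro h4
  rw [h4, zero_mul] at hs
  exact zero_ne_one hs

end Duality

end

/-! ### A spanning tree of a connected graph -/

section

open Matrix

namespace HGraph

variable {V H ι : Type*}

/-- A connected graph has a function that decreases along some edge at every vertex but one. -/
theorem IsConnected.exists_height {G : HGraph V H} (hG : G.IsConnected) (w : V) :
    ∃ d : V → ℕ, ∀ u, u ≠ w → ∃ h, G.vert h = u ∧ d (G.vert (G.opp h)) < d u := by
  classical
  -- `R n u` means that a walk of `n` edges leads from `u` to `w`; the height is the least such `n`.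
  let R : ℕ → V → Prop := fun n => Nat.rec (motive := fun _ => V → Prop) (fun u => u = w)
    (fun _ r u => ∃ h, G.vert h = u ∧ r (G.vert (G.opp h))) n
  have hR : ∀ u, ∃ n, R n u := by
    intro u
    induction hG.2 u w using Relation.ReflTransGen.head_induction_on with
    | refl => exact ⟨0, rfl⟩
    | head h _ ih =>
      obtain ⟨g, hg, hg'⟩ := h
      obtain ⟨n, hn⟩ := ih
      exact ⟨n + 1, g, hg, hg'.symm ▸ hn⟩
  refine ⟨fun u => Nat.find (hR u), fun u hu => ?_⟩
  have h1 := Nat.find_spec (hR u)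
  rcases h2 : Nat.find (hR u) with _ | n
  · rw [h2] at h1
    exact absurd h1 hu
  · rw [h2] at h1
    obtain ⟨h, h3, h4⟩ := h1
    refine ⟨h, h3, ?_⟩
    beta_reduce
    rw [h2]
    exact Nat.lt_succ_of_le (Nat.find_min' _ h4)

/-- The Kirchhoff polynomial of a connected graph takes the value `1`. -/
theorem IsConnected.exists_det_weightedGram_eq_one [DecidableEq V] [Fintype ι] [DecidableEq ι]
    {G : HGraph V H} (hG : G.IsConnected) (w : V) (a : ι → V) (ha : Function.Injective a)
    (haw : ∀ i, a i ≠ w) (o : H → Prop) (ho : ∀ h, o (G.opp h) ↔ ¬ o h) [Fintype {h // o h}] :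
    ∃ x : {h // o h} → ℤ, (weightedGram (G.incidenceMatrix a o) x).det = 1 := by
  classical
  obtain ⟨d, hd⟩ := hG.exists_height w
  -- The half-edges `p i` point towards `w` along a spanning tree. Ordered by height, the incidence
  -- matrix `C` of the tree is triangular with ones on the diagonal.
  choose p hp hpd using fun i => hd (a i) (haw i)
  let edge : H → {h // o h} := fun h => if hh : o h then ⟨h, hh⟩ else ⟨G.opp h, (ho h).2 hh⟩
  let c : H → ι → ℤ := fun h i =>
    (if G.vert h = a i then 1 else 0) - (if G.vert (G.opp h) = a i then 1 else 0)
  have h1 : ∀ h i j, G.incidenceMatrix a o i (edge h) * G.incidenceMatrix a o j (edge h) =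
      c h i * c h j := by
    intro h i j
    by_cases hh : o h
    · simp [edge, hh, incidenceMatrix, c]
    · simp only [edge, hh, dite_false, incidenceMatrix, c, Matrix.of_apply, G.opp_opp]
      ring
  let C : Matrix ι ι ℤ := Matrix.of fun i j => c (p j) i
  have hC : ∀ i j, C i j = (if i = j then 1 else 0) -
      (if G.vert (G.opp (p j)) = a i then 1 else 0) := by
    intro i j
    simp [C, c, hp, ha.eq_iff, eq_comm]
  have hC' : BlockTriangular C (fun i => d (a i)) := by
    intro i j hij
    have e1 : i ≠ j := by
      rintro rfl
      exact lt_irrefl _ hij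
    have e2 : G.vert (G.opp (p j)) ≠ a i := by
      intro h2
      have := hpd j
      rw [h2] at this
      exact lt_asymm this hij
    rw [hC, if_neg e1, if_neg e2, sub_zero]
  have hdet : C.det = 1 := by
    rw [hC'.det]
    refine Finset.prod_eq_one fun n _ => ?_
    have : C.toSquareBlock (fun i => d (a i)) n = 1 := by
      ext i j
      have e2 : G.vert (G.opp (p j.1)) ≠ a i.1 := by
        intro h2
        have := hpd j.1
        rw [h2] at this
        have e3 := i.2
        have e4 := j.2
        omega
      rw [toSquareBlock_def, Matrix.of_apply, hC, if_neg e2, sub_zero, Matrix.one_apply]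
      simp [Subtype.ext_iff]
    rw [this, det_one]
  -- The weight of an edge is the number of times it is chosen, which makes the weighted Gram matrix
  -- `C Cᵀ`.
  refine ⟨fun e => ∑ j, if edge (p j) = e then 1 else 0, ?_⟩
  have h2 : weightedGram (G.incidenceMatrix a o)
      (fun e => ∑ j, if edge (p j) = e then (1 : ℤ) else 0) = C * Cᵀ := by
    ext i j
    simp only [weightedGram, Matrix.of_apply, Int.cast_id, Finset.mul_sum, Matrix.mul_apply,
      Matrix.transpose_apply, mul_ite, mul_one, mul_zero, C]
    rw [Finset.sum_comm]
    refine Finset.sum_congr rfl fun l _ => ?_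
    rw [Finset.sum_ite_eq, if_pos (Finset.mem_univ _), h1]
  rw [h2, det_mul, det_transpose, hdet, one_mul]

end HGraph

end

/-! ### Plane embeddings and the duality of Kirchhoff polynomials -/

section

open MvPolynomial

theorem coeff_kirchhoffPolynomial_submatrix {ι ι' E E' : Type*} [Fintype ι] [DecidableEq ι]
    [Fintype ι'] [DecidableEq ι'] [Fintype E] [Fintype E'] (B : Matrix ι E ℤ) (f : ι' ≃ ι)
    (g : E' ≃ E) (n K : ℕ) :
    coeff (Finsupp.equivFunOnFinite.symm fun _ => n)
        (kirchhoffPolynomial ℤ (B.submatrix f g) ^ K) =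
      coeff (Finsupp.equivFunOnFinite.symm fun _ => n) (kirchhoffPolynomial ℤ B ^ K) := by
  have h1 : rename g (kirchhoffPolynomial ℤ (B.submatrix f g)) = kirchhoffPolynomial ℤ B := by
    rw [kirchhoffPolynomial_eq_det, kirchhoffPolynomial_eq_det]
    refine (map_det_weightedGram (rename g : _ →ₐ[ℤ] MvPolynomial E ℤ).toRingHom _ _).trans ?_
    rw [← Matrix.det_submatrix_equiv_self f (weightedGram B X)]
    congr 1
    ext1 i j
    simp only [weightedGram, Matrix.of_apply, Matrix.submatrix_apply]
    rw [← g.sum_comp]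
    exact Finset.sum_congr rfl fun e _ => congrArg _ (rename_X _ _)
  have h2 : (Finsupp.equivFunOnFinite.symm fun _ : E => n) =
      (Finsupp.equivFunOnFinite.symm fun _ : E' => n).mapDomain g := by
    ext e
    obtain ⟨e, rfl⟩ := g.surjective e
    rw [Finsupp.mapDomain_apply g.injective]
    simp
  rw [h2, ← h1, ← map_pow, coeff_rename_mapDomain _ g.injective]

namespace HGraph

variable {V H V' H' : Type*}

theorem card_orientation [Finite H] (G : HGraph V H) (o : H → Prop)
    (ho : ∀ h, o (G.opp h) ↔ ¬ o h) : Nat.card H = 2 * Nat.card {h // o h} := by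
  classical
  have := Fintype.ofFinite H
  have h1 := G.sum_orientation o ho fun _ => 1
  simp only [Finset.sum_const, Finset.card_univ, smul_eq_mul, mul_one] at h1
  rw [Nat.card_eq_fintype_card, Nat.card_eq_fintype_card, h1, mul_comm]

namespace PlaneEmbedding

variable {G : HGraph V H} (e : G.PlaneEmbedding)

theorem vert_rot (h : H) : G.vert (e.rot h) = G.vert h :=
  (e.rot_cycle _ _).1 ⟨-1, by simp⟩

/-- The face permutation sends `opp h` to `rot h`, so these half-edges lie on the same face. -/
theorem dual_vert_rot (h : H) : e.dual.vert (e.rot h) = e.dual.vert (G.opp h) := by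
  refine congrArg Sum.inl (Quotient.sound ⟨-1, ?_⟩)
  rw [zpow_neg_one, Equiv.Perm.inv_eq_iff_eq]
  simp [facePerm, oppPerm, G.opp_opp]

/-- Each turn around a vertex passes to an adjacent face, and a step along an edge connects its two
sides; so a walk in the graph yields a walk in the dual. Without edges there is just one face. -/
theorem dual_connected [Finite H] : e.dual.IsConnected := by
  set R := Relation.ReflTransGen
    (fun a b => ∃ h, e.dual.vert h = a ∧ e.dual.vert (e.dual.opp h) = b) with hR
  have hopp : ∀ h, R (e.dual.vert h) (e.dual.vert (G.opp h)) := fun h =>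
    Relation.ReflTransGen.single ⟨h, rfl, rfl⟩
  have hrot : ∀ n : ℕ, ∀ h, R (e.dual.vert h) (e.dual.vert ((e.rot ^ n) h)) := by
    intro n
    induction n with
    | zero => exact fun h => Relation.ReflTransGen.refl
    | succ n ih =>
      intro h
      rw [pow_succ', Equiv.Perm.mul_apply, e.dual_vert_rot]
      exact (ih h).trans (hopp _)
  have hvert : ∀ h h', G.vert h = G.vert h' → R (e.dual.vert h) (e.dual.vert h') := by
    intro h h' hh
    obtain ⟨n, rfl⟩ := ((e.rot_cycle h h').2 hh).exists_nat_pow_eq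
    exact hrot n h
  have hpath : ∀ h u, Relation.ReflTransGen
      (fun a b => ∃ h, G.vert h = a ∧ G.vert (G.opp h) = b) (G.vert h) u →
      ∀ h', G.vert h' = u → R (e.dual.vert h) (e.dual.vert h') := by
    intro h u hu
    induction hu with
    | refl => exact fun h' hh => hvert _ _ hh.symm
    | tail _ hstep ih =>
      obtain ⟨g, hg, hg'⟩ := hstep
      exact fun h' hh => ((ih g hg).trans (hopp g)).trans (hvert _ _ (hg'.trans hh.symm))
  constructor
  · cases isEmpty_or_nonempty H with
    | inl h => exact ⟨Sum.inr ⟨h⟩⟩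
    | inr h => exact ⟨e.dual.vert h.some⟩
  · rintro (u | ⟨⟨hu⟩⟩) (w | ⟨⟨hw⟩⟩)
    · induction u using Quotient.inductionOn with
      | _ h =>
      induction w using Quotient.inductionOn with
      | _ h' => exact hpath h _ (e.connected.2 _ _) h' rfl
    · induction u using Quotient.inductionOn with
      | _ h => exact (hw.false h).elim
    · induction w using Quotient.inductionOn with
      | _ h => exact (hu.false h).elim
    · exact Relation.ReflTransGen.refl

/-- Written over half-edges, the sum is a difference of two sums that `rot` carries into each other:
it fixes the vertex of `h`, and the face of `rot h` is that of `opp h`. -/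
theorem sum_incidenceMatrix_dual [Fintype H] [DecidableEq V] [DecidableEq (G.Face e.rot)]
    {ι ι' : Type*} (a : ι → G.Face e.rot) (b : ι' → V) (o : H → Prop) [Fintype {h // o h}]
    (ho : ∀ h, o (G.opp h) ↔ ¬ o h) (i : ι) (j : ι') :
    ∑ x, e.dual.incidenceMatrix a o i x * G.incidenceMatrix b o j x = 0 := by
  classical
  let F : H → ℤ := fun h => if e.dual.vert h = a i then 1 else 0
  let U : H → ℤ := fun h => if G.vert h = b j then 1 else 0
  have h1 := G.sum_orientation o ho fun h => U h * (F h - F (G.opp h))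
  have h2 : ∑ h, U h * F h = ∑ h, U h * F (G.opp h) := by
    rw [← Equiv.sum_comp e.rot]
    simp only [F, U, e.vert_rot, e.dual_vert_rot]
  simp only [mul_sub, Finset.sum_sub_distrib, h2, sub_self, G.opp_opp] at h1
  rw [h1]
  refine Finset.sum_congr (by ext; simp) fun x _ => ?_
  change (F x.1 - F (G.opp x.1)) * (U x.1 - U (G.opp x.1)) = _
  ring

end PlaneEmbedding

open Classical in
-- Euler's formula makes the stacked matrix of the two reduced incidence matrices square. It is also
-- recorded as the first conclusion, from which the absence of self-loops in the 4-regular case is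
-- derived.
theorem IsPlanarDual.exists_coeff_kirchhoffPolynomial_pow [Fintype V] [Fintype H] [Fintype V']
    [Fintype H'] {G : HGraph V H} {G' : HGraph V' H'} (hGG : G.IsPlanarDual G') (w : V) (w' : V')
    (o' : H' → Prop) (ho' : ∀ h, o' (G'.opp h) ↔ ¬ o' h) :
    Nat.card V + Nat.card V' = Nat.card {h // o' h} + 2 ∧
    ∃ o : H → Prop, (∀ h, o (G.opp h) ↔ ¬ o h) ∧ Nat.card {h // o h} = Nat.card {h // o' h} ∧
      ∀ n n' K : ℕ, n + n' = K →
        coeff (Finsupp.equivFunOnFinite.symm fun _ => n)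
          (kirchhoffPolynomial ℤ (G.incidenceMatrix
            (Subtype.val : {u // u ≠ w} → V) o) ^ K) =
        coeff (Finsupp.equivFunOnFinite.symm fun _ => n')
          (kirchhoffPolynomial ℤ (G'.incidenceMatrix
            (Subtype.val : {u // u ≠ w'} → V') o') ^ K) := by
  obtain ⟨e, ⟨φ⟩⟩ := hGG
  have hF : Fintype (G'.Face e.rot) := Fintype.ofEquiv V φ.onVert
  have hV : Nat.card V = Nat.card (G'.Face e.rot) := Nat.card_congr φ.onVert
  have hE := G'.card_orientation o' ho'
  have heuler := e.euler
  have hg : ∀ h : H, o' (φ.onHalf h) ↔ o' (φ.onHalf h) := fun h => Iff.rfl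
  let g : {h : H // o' (φ.onHalf h)} ≃ {h // o' h} := φ.onHalf.subtypeEquiv hg
  let f : {u // u ≠ w} ≃ {u // u ≠ φ.onVert w} :=
    φ.onVert.subtypeEquiv fun u => φ.onVert.injective.ne_iff.symm
  refine ⟨by omega, fun h => o' (φ.onHalf h), fun h => ?_, Nat.card_congr g, ?_⟩
  · beta_reduce
    rw [← φ.opp_eq]
    exact ho' _
  · intro n n' K hK
    have h1 : G.incidenceMatrix (Subtype.val : {u // u ≠ w} → V) (fun h => o' (φ.onHalf h)) =
        (e.dual.incidenceMatrix (Subtype.val : {u // u ≠ φ.onVert w} → _) o').submatrix f g := by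
      ext i x
      have h2 : e.dual.vert (e.dual.opp (φ.onHalf x.1)) = φ.onVert (G.vert (G.opp x.1)) := by
        rw [φ.opp_eq, φ.vert_eq]
      simp only [incidenceMatrix, Matrix.of_apply, Matrix.submatrix_apply, g, f,
        Equiv.subtypeEquiv_apply, φ.vert_eq, h2, φ.onVert.apply_eq_iff_eq]
    rw [h1, coeff_kirchhoffPolynomial_submatrix]
    obtain ⟨x, hx⟩ := e.dual_connected.exists_det_weightedGram_eq_one (φ.onVert w)
      (Subtype.val : {u // u ≠ φ.onVert w} → _) Subtype.val_injective (fun i => i.2) o' ho'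
    obtain ⟨y, hy⟩ := e.connected.exists_det_weightedGram_eq_one w'
      (Subtype.val : {u // u ≠ w'} → _) Subtype.val_injective (fun i => i.2) o' ho'
    have hcard : Fintype.card ({u // u ≠ φ.onVert w} ⊕ {u // u ≠ w'}) =
        Fintype.card {h // o' h} := by
      have : 1 ≤ Fintype.card (G'.Face e.rot) := Fintype.card_pos_iff.2 ⟨φ.onVert w⟩
      have : 1 ≤ Fintype.card V' := Fintype.card_pos_iff.2 ⟨w'⟩
      simp only [Nat.card_eq_fintype_card] at heuler hE
      rw [Fintype.card_sum, Fintype.card_subtype_compl, Fintype.card_subtype_compl,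
        Fintype.card_subtype_eq, Fintype.card_subtype_eq]
      omega
    exact coeff_kirchhoffPolynomial_pow_dual _ _ (Fintype.equivOfCardEq hcard)
      (e.sum_incidenceMatrix_dual _ _ o' ho') x y hx hy K _ _ fun _ => hK

end HGraph

end

/-! ### Martin invariants of graphs with dual vertex complements -/

section

open MvPolynomial

namespace HGraph

variable {V H : Type*}

theorem card_eq_of_isRegular [Fintype V] [Finite H] {G : HGraph V H} {d : ℕ}
    (hG : G.IsRegular d) : Nat.card H = Nat.card V * d := by
  rw [Nat.card_congr (Equiv.sigmaFiberEquiv G.vert).symm, Nat.card_sigma,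
    Finset.sum_congr rfl fun v _ => hG v, Finset.sum_const, Finset.card_univ, smul_eq_mul,
    Nat.card_eq_fintype_card]

theorem card_deleteVertex [Finite H] (G : HGraph V H) (v : V) {d : ℕ}
    (hd : Nat.card {h // G.vert h = v} = d) :
    Nat.card {h // G.vert h ≠ v ∧ G.vert (G.opp h) ≠ v} + 2 * d =
      Nat.card H + Nat.card {h // G.vert h = v ∧ G.vert (G.opp h) = v} := by
  classical
  have := Fintype.ofFinite H
  have h1 : Nat.card {h // G.vert (G.opp h) = v} = d := by
    rw [← hd]
    exact Nat.card_congr (G.oppPerm.subtypeEquiv fun h => Iff.rfl)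
  simp only [Nat.card_eq_fintype_card, Fintype.card_subtype] at hd h1 ⊢
  have h2 := Finset.card_union_add_card_inter (Finset.univ.filter fun h => G.vert h = v)
    (Finset.univ.filter fun h => G.vert (G.opp h) = v)
  rw [hd, h1, ← Finset.filter_or, ← Finset.filter_and] at h2
  have h3 := Finset.card_filter_add_card_filter_not (s := (Finset.univ : Finset H))
    (fun h => G.vert h = v ∨ G.vert (G.opp h) = v)
  simp only [not_or, Finset.card_univ] at h3
  simp only [ne_eq]
  omega

theorem IsRegular.duplicate [Finite H] {G : HGraph V H} {d : ℕ} (hG : G.IsRegular d) (r : ℕ) :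
    (G.duplicate r).IsRegular (d * r) := by
  intro v
  have e : {h // (G.duplicate r).vert h = v} ≃ {h // G.vert h = v} × Fin r :=
    { toFun := fun h => (⟨h.1.1, h.2⟩, h.1.2)
      invFun := fun h => ⟨(h.1.1, h.2), h.1.2⟩
      left_inv := fun _ => rfl
      right_inv := fun _ => rfl }
  rw [Nat.card_congr e, Nat.card_prod, hG v, Nat.card_eq_fintype_card, Fintype.card_fin]

/-- `ρ` presents `G'` as the graph obtained from `G` by replacing each edge by `r` parallel
edges. -/
structure IsMultiple {K : Type*} (G : HGraph V H) (G' : HGraph V K) (r : ℕ) (ρ : K → H) : Prop where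
  vert_eq : ∀ κ, G'.vert κ = G.vert (ρ κ)
  opp_eq : ∀ κ, ρ (G'.opp κ) = G.opp (ρ κ)
  card_fiber : ∀ h, Nat.card {κ // ρ κ = h} = r

theorem isMultiple_duplicate (G : HGraph V H) (r : ℕ) :
    G.IsMultiple (G.duplicate r) r Prod.fst where
  vert_eq _ := rfl
  opp_eq _ := rfl
  card_fiber h := by
    have e : {κ : H × Fin r // κ.1 = h} ≃ Fin r :=
      { toFun := fun κ => κ.1.2
        invFun := fun i => ⟨(h, i), rfl⟩
        left_inv := fun κ => Subtype.ext (Prod.ext κ.2.symm rfl)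
        right_inv := fun _ => rfl }
    rw [Nat.card_congr e, Nat.card_eq_fintype_card, Fintype.card_fin]

theorem isMultiple_self (G : HGraph V H) : G.IsMultiple G 1 id where
  vert_eq _ := rfl
  opp_eq _ := rfl
  card_fiber h := by simp

open Classical in
/-- The Martin invariant as a coefficient of a power of the Kirchhoff polynomial. -/
theorem martinInvariant_eq_coeff [Fintype V] [Fintype H] {K : Type*} [Fintype K] (G : HGraph V H)
    (v : V) (hv : G.NoSelfLoopAt v) (w : {w // w ≠ v})
    (o : {h // G.vert h ≠ v ∧ G.vert (G.opp h) ≠ v} → Prop)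
    (ho : ∀ h, o ((G.deleteVertex v).opp h) ↔ ¬ o h) (G' : HGraph V K) (ρ : K → H) (r : ℕ)
    (hρ : G.IsMultiple G' r ρ) {k : ℕ} (hk : 2 ≤ k) (hG' : G'.IsRegular (2 * k)) :
    G'.martinInvariant k = martinConstant k * ((r.factorial : ℚ) ^ Nat.card {h // o h} *
      ((coeff (Finsupp.equivFunOnFinite.symm fun _ => r)
        (kirchhoffPolynomial ℤ ((G.deleteVertex v).incidenceMatrix
          (Subtype.val : {u // u ≠ w} → {w // w ≠ v}) o) ^ k) : ℤ) : ℚ)) := by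
  rw [G'.martinInvariant_eq_kirchhoffNumber hk hG' v w.1 w.2.symm
    (fun i : {u : {w // w ≠ v} // u ≠ w} => i.1.1)
    (Subtype.val_injective.comp Subtype.val_injective) (fun i => i.1.2)
    (fun i h => i.2 (Subtype.ext h)),
    G.kirchhoffNumber_cover v hv (Subtype.val : {u // u ≠ w} → {w // w ≠ v}) o ho G' ρ hρ.vert_eq
      hρ.opp_eq r hρ.card_fiber k _ (hG' v) rfl, mul_assoc,
    mul_div_cancel_left₀ _ (Nat.cast_ne_zero.2 (Nat.factorial_ne_zero _))]
  intro u
  by_cases h1 : u = v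
  · exact Or.inl h1
  · by_cases h2 : u = w.1
    · exact Or.inr (Or.inl h2)
    · exact Or.inr (Or.inr ⟨⟨⟨u, h1⟩, fun h => h2 (congrArg Subtype.val h)⟩, rfl⟩)

theorem IsPlanarDual.exists_vertex {V' H' : Type*} [Finite H'] {G : HGraph V H}
    {G' : HGraph V' H'} (h : G.IsPlanarDual G') : Nonempty V ∧ Nonempty V' := by
  obtain ⟨e, ⟨φ⟩⟩ := h
  exact ⟨⟨φ.onVert.symm e.dual_connected.1.some⟩, e.connected.1⟩

/-- Both sides involve the same `k`, hence the same `martinConstant k`, and by duality the same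
coefficient; only the factors `r₁!` and `r₂!` per edge remain. -/
theorem martinInvariant_of_isPlanarDual {V₁ H₁ K₁ V₂ H₂ K₂ : Type*} [Fintype V₁] [Fintype H₁]
    [Fintype K₁] [Fintype V₂] [Fintype H₂] [Fintype K₂] (G₁ : HGraph V₁ H₁) (G₂ : HGraph V₂ H₂)
    (v₁ : V₁) (v₂ : V₂) (hv₁ : G₁.NoSelfLoopAt v₁) (hv₂ : G₂.NoSelfLoopAt v₂)
    (h : (G₁.deleteVertex v₁).IsPlanarDual (G₂.deleteVertex v₂)) (G₁' : HGraph V₁ K₁)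
    (G₂' : HGraph V₂ K₂) (ρ₁ : K₁ → H₁) (ρ₂ : K₂ → H₂) (r₁ r₂ : ℕ) (hρ₁ : G₁.IsMultiple G₁' r₁ ρ₁)
    (hρ₂ : G₂.IsMultiple G₂' r₂ ρ₂) {k : ℕ} (hk : 2 ≤ k) (hr : r₁ + r₂ = k)
    (hG₁ : G₁'.IsRegular (2 * k)) (hG₂ : G₂'.IsRegular (2 * k)) {d : ℕ}
    (hd : Nat.card {h // G₂.vert h ≠ v₂ ∧ G₂.vert (G₂.opp h) ≠ v₂} = 2 * d) :
    G₁'.martinInvariant k =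
      ((r₁.factorial : ℚ) / r₂.factorial) ^ d * G₂'.martinInvariant k := by
  classical
  obtain ⟨⟨w₁⟩, ⟨w₂⟩⟩ := h.exists_vertex
  obtain ⟨o₂, ho₂⟩ := (G₂.deleteVertex v₂).exists_orientation
  obtain ⟨-, o₁, ho₁, hcard, hdual⟩ := h.exists_coeff_kirchhoffPolynomial_pow w₁ w₂ o₂ ho₂
  have hd' : Nat.card {h // o₂ h} = d := by
    have := (G₂.deleteVertex v₂).card_orientation o₂ ho₂
    omega
  have h1 := hdual r₁ r₂ k hr
  rw [G₁.martinInvariant_eq_coeff v₁ hv₁ w₁ o₁ ho₁ G₁' ρ₁ r₁ hρ₁ hk hG₁,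
    G₂.martinInvariant_eq_coeff v₂ hv₂ w₂ o₂ ho₂ G₂' ρ₂ r₂ hρ₂ hk hG₂, hcard, hd']
  have h2 : (r₂.factorial : ℚ) ≠ 0 := by positivity
  have h3 : ((r₁.factorial : ℚ) / r₂.factorial) ^ d * (r₂.factorial : ℚ) ^ d =
      (r₁.factorial : ℚ) ^ d := by rw [← mul_pow, div_mul_cancel₀ _ h2]
  have h4 : ∀ c x y : ℚ, ∀ A B : ℤ, A = B → c * (x * y * (A : ℚ)) = x * (c * (y * (B : ℚ))) := by
    rintro c x y A _ rfl
    ring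
  rw [← h3]
  refine h4 _ _ _ _ _ ?_
  convert h1

/-- If the complements of a vertex in two `4`-regular graphs are planar duals, then these vertices
have no self-loops. -/
theorem noSelfLoopAt_of_isPlanarDual {V₁ H₁ V₂ H₂ : Type*} [Fintype V₁] [Fintype H₁]
    [Fintype V₂] [Fintype H₂] (G₁ : HGraph V₁ H₁) (G₂ : HGraph V₂ H₂)
    (v₁ : V₁) (v₂ : V₂) (hG₁ : G₁.IsRegular 4) (hG₂ : G₂.IsRegular 4)
    (h : (G₁.deleteVertex v₁).IsPlanarDual (G₂.deleteVertex v₂)) :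
    G₁.NoSelfLoopAt v₁ ∧ G₂.NoSelfLoopAt v₂ := by
  classical
  obtain ⟨⟨w₁⟩, ⟨w₂⟩⟩ := h.exists_vertex
  obtain ⟨o₂, ho₂⟩ := (G₂.deleteVertex v₂).exists_orientation
  obtain ⟨heuler, o₁, ho₁, hcard, -⟩ := h.exists_coeff_kirchhoffPolynomial_pow w₁ w₂ o₂ ho₂
  have c₁ := (G₁.deleteVertex v₁).card_orientation o₁ ho₁
  have c₂ := (G₂.deleteVertex v₂).card_orientation o₂ ho₂
  have d₁ := G₁.card_deleteVertex v₁ (hG₁ v₁)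
  have d₂ := G₂.card_deleteVertex v₂ (hG₂ v₂)
  rw [card_eq_of_isRegular hG₁] at d₁
  rw [card_eq_of_isRegular hG₂] at d₂
  have n₁ : Nat.card {w // w ≠ v₁} + 1 = Nat.card V₁ := by
    have : 1 ≤ Fintype.card V₁ := Fintype.card_pos_iff.2 ⟨v₁⟩
    rw [Nat.card_eq_fintype_card, Nat.card_eq_fintype_card, Fintype.card_subtype_compl,
      Fintype.card_subtype_eq]
    omega
  have n₂ : Nat.card {w // w ≠ v₂} + 1 = Nat.card V₂ := by
    have : 1 ≤ Fintype.card V₂ := Fintype.card_pos_iff.2 ⟨v₂⟩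
    rw [Nat.card_eq_fintype_card, Nat.card_eq_fintype_card, Fintype.card_subtype_compl,
      Fintype.card_subtype_eq]
    omega
  -- With `E` edges in each complement and `lᵢ` half-edges in self-loops at `vᵢ`, the counts are `2E
  -- + 8 = 4|Vᵢ| + lᵢ` and, by Euler, `|V₁| + |V₂| = E + 4`. Adding up gives `l₁ + l₂ = 0`.
  have l₁ : Nat.card {h // G₁.vert h = v₁ ∧ G₁.vert (G₁.opp h) = v₁} = 0 := by omega
  have l₂ : Nat.card {h // G₂.vert h = v₂ ∧ G₂.vert (G₂.opp h) = v₂} = 0 := by omega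
  rw [Finite.card_eq_zero_iff] at l₁ l₂
  exact ⟨fun h h1 h2 => l₁.false ⟨h, h1, h2⟩, fun h h1 h2 => l₂.false ⟨h, h1, h2⟩⟩

theorem NoSelfLoopAt.card_eq_zero {G : HGraph V H} {v : V} (hv : G.NoSelfLoopAt v) :
    Nat.card {h // G.vert h = v ∧ G.vert (G.opp h) = v} = 0 := by
  have : IsEmpty {h // G.vert h = v ∧ G.vert (G.opp h) = v} := ⟨fun h => hv h.1 h.2.1 h.2.2⟩
  exact Nat.card_of_isEmpty

end HGraph

end

/-! ### The theorem -/

theorem mainTheorem10 :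
    (∀ (V₁ H₁ V₂ H₂ : Type*) [Fintype V₁] [Fintype H₁] [Fintype V₂] [Fintype H₂]
        (G₁ : HGraph V₁ H₁) (G₂ : HGraph V₂ H₂) (v₁ : V₁) (v₂ : V₂),
        G₁.IsRegular 4 → G₂.IsRegular 4 →
        (G₁.deleteVertex v₁).IsPlanarDual (G₂.deleteVertex v₂) →
        G₁.martinInvariant 2 = G₂.martinInvariant 2 ∧
        (G₁.NoSelfLoopAt v₁ → G₂.NoSelfLoopAt v₂ → ∀ r : ℕ, 1 ≤ r →
          (G₁.duplicate r).martinInvariant (2 * r) =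
            (G₂.duplicate r).martinInvariant (2 * r))) ∧
    (∀ (V₃ H₃ V₆ H₆ : Type*) [Fintype V₃] [Fintype H₃] [Fintype V₆] [Fintype H₆]
        (G₃ : HGraph V₃ H₃) (G₆ : HGraph V₆ H₆) (v : V₃) (w : V₆),
        G₃.IsRegular 3 → G₆.IsRegular 6 →
        G₃.NoSelfLoopAt v → G₆.NoSelfLoopAt w →
        (G₃.deleteVertex v).IsPlanarDual (G₆.deleteVertex w) →
        ∀ r : ℕ, 1 ≤ r →
          (G₃.duplicate (2 * r)).martinInvariant (3 * r) =
            ((Nat.factorial (2 * r) : ℚ) / (Nat.factorial r : ℚ)) ^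
                (3 * (Fintype.card V₆ - 2)) *
              (G₆.duplicate r).martinInvariant (3 * r)) := by
  refine ⟨?_, ?_⟩
  · intro V₁ H₁ V₂ H₂ _ _ _ _ G₁ G₂ v₁ v₂ hG₁ hG₂ h
    obtain ⟨hv₁, hv₂⟩ := HGraph.noSelfLoopAt_of_isPlanarDual G₁ G₂ v₁ v₂ hG₁ hG₂ h
    have hd : Nat.card {h // G₂.vert h ≠ v₂ ∧ G₂.vert (G₂.opp h) ≠ v₂} =
        2 * (2 * (Nat.card V₂ - 2)) := by
      have := G₂.card_deleteVertex v₂ (hG₂ v₂)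
      rw [HGraph.card_eq_of_isRegular hG₂, hv₂.card_eq_zero] at this
      omega
    constructor
    · rw [HGraph.martinInvariant_of_isPlanarDual G₁ G₂ v₁ v₂ hv₁ hv₂ h G₁ G₂ id id 1 1
        G₁.isMultiple_self G₂.isMultiple_self le_rfl rfl hG₁ hG₂ hd]
      simp
    · intro _ _ r hr
      have e : 4 * r = 2 * (2 * r) := by ring
      rw [HGraph.martinInvariant_of_isPlanarDual G₁ G₂ v₁ v₂ hv₁ hv₂ h (G₁.duplicate r)
        (G₂.duplicate r) Prod.fst Prod.fst r r (G₁.isMultiple_duplicate r)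
        (G₂.isMultiple_duplicate r) (by omega) (by ring) (e ▸ hG₁.duplicate r)
        (e ▸ hG₂.duplicate r) hd, div_self (by positivity), one_pow, one_mul]
  · intro V₃ H₃ V₆ H₆ _ _ _ _ G₃ G₆ v w hG₃ hG₆ hv hw h r hr
    -- A 6-regular graph on `n` vertices has `3n` edges, six of which are removed with `w`; the
    -- remaining `3(n - 2)` give the exponent.
    have hd : Nat.card {h // G₆.vert h ≠ w ∧ G₆.vert (G₆.opp h) ≠ w} =
        2 * (3 * (Fintype.card V₆ - 2)) := by
      have := G₆.card_deleteVertex w (hG₆ w)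
      rw [HGraph.card_eq_of_isRegular hG₆, hw.card_eq_zero, Nat.card_eq_fintype_card (α := V₆)]
        at this
      omega
    have e₃ : 3 * (2 * r) = 2 * (3 * r) := by ring
    have e₆ : 6 * r = 2 * (3 * r) := by ring
    exact HGraph.martinInvariant_of_isPlanarDual G₃ G₆ v w hv hw h (G₃.duplicate (2 * r))
      (G₆.duplicate r) Prod.fst Prod.fst (2 * r) r (G₃.isMultiple_duplicate _)
      (G₆.isMultiple_duplicate r) (by omega) (by ring) (e₃ ▸ hG₃.duplicate (2 * r))
      (e₆ ▸ hG₆.duplicate r) hd
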